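/- Let $S\in\{\tfrac12,1,\tfrac32,\dots\}$ and, for $L\ge 1$, let $$H_L=\sum_{x=1}^{L-1}\bigl(S^2-\vec S_x\cdot\vec S_{x+1}\bigr)$$ act on $\bigotimes_{x=1}^{L}\mathbb C^{2S+1}$, where $\vec S_x=(S_x^1,S_x^2,S_x^3)$ are the spin operators of the irreducible spin-$S$ representation of $SU(2)$ acting on the $x$-th tensor factor. For $\beta>0$ let $$f_L(\beta,S)=-\frac1{\beta L}\ln\operatorname{Tr}e^{-\beta H_L},\qquad f(\beta,S)=\lim_{L\to\infty}f_L(\beta,S),\qquad C_1=\frac1{2\pi}\int_{\mathbb R}\ln\bigl(1-e^{-p^2}\bigr)\,dp .$$ Then the limit defining $f(\beta,S)$ exists for all $\beta>0$ and all $S$, and, as $\beta S\to\infty$, $$f(\beta,S)\ \ge\ C_1\,S^{-\frac12}\beta^{-\frac32}\Bigl(1+\mathcal O\bigl((\beta S)^{-\frac1{12}}(\ln\beta S)^{\frac12}(\ln\beta S^3)^{\frac13}\bigr)\Bigr).$$ That is, there are constants $C,K>0$, independent of $\beta$ and $S$, such that for all $\beta>0$ and all $S\in\{\tfrac12,1,\tfrac32,\dots\}$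 with $\beta S\ge K$, $$f(\beta,S)\ \ge\ C_1\,S^{-\frac12}\beta^{-\frac32}\Bigl(1+C\,(\beta S)^{-\frac1{12}}(\ln\beta S)^{\frac12}(\ln\beta S^3)^{\frac13}\Bigr).$$ -/

import Mathlib

namespace Heisenberg

noncomputable section

/-- Raising operator `S⁺ = S¹ + i S²` of the spin `S = N / 2` representation of `SU(2)` on
`ℂ^(2S+1)`, in the orthonormal basis `|0⟩, …, |N⟩` of eigenvectors of `S³`
(`S³ |n⟩ = (n - S) |n⟩`): `S⁺ |n⟩ = √((n + 1) (2S - n)) |n + 1⟩`. -/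
def spinPlus (N : ℕ) : Matrix (Fin (N + 1)) (Fin (N + 1)) ℂ :=
  Matrix.of fun m n =>
    if (m : ℕ) = (n : ℕ) + 1 then ((Real.sqrt (((n : ℝ) + 1) * ((N : ℝ) - (n : ℝ))) : ℝ) : ℂ)
    else 0

/-- The spin operators `(S¹, S², S³)` for spin `S = N / 2`:
`S¹ = (S⁺ + S⁻) / 2`, `S² = (S⁺ - S⁻) / (2 i)`, `S³ = diag (n - S)`, with `S⁻ = (S⁺)ᴴ`. -/
def spin (N : ℕ) : Fin 3 → Matrix (Fin (N + 1)) (Fin (N + 1)) ℂ :=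
  ![(1 / 2 : ℂ) • (spinPlus N + (spinPlus N).conjTranspose),
    (1 / (2 * Complex.I) : ℂ) • (spinPlus N - (spinPlus N).conjTranspose),
    Matrix.diagonal fun n => (n : ℂ) - (N : ℂ) / 2]

/-- Operators on the Hilbert space `⊗_{x=1}^L ℂ^(N+1)`, written as matrices in the product
basis, which is indexed by the configurations `σ : Fin L → Fin (N + 1)`. -/
abbrev ChainOp (L N : ℕ) : Type :=
  Matrix (Fin L → Fin (N + 1)) (Fin L → Fin (N + 1)) ℂ

/-- The operator acting as `A` on the tensor factor `x` and as the identity on all others. -/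
def siteOp {L N : ℕ} (x : Fin L) (A : Matrix (Fin (N + 1)) (Fin (N + 1)) ℂ) : ChainOp L N :=
  Matrix.of fun σ τ => if ∀ y, y ≠ x → σ y = τ y then A (σ x) (τ x) else 0

/-- The scalar product `S⃗_x · S⃗_y = ∑_k S^k_x S^k_y`. -/
def spinDot {L : ℕ} (N : ℕ) (x y : Fin L) : ChainOp L N :=
  ∑ k : Fin 3, siteOp x (spin N k) * siteOp y (spin N k)

/-- The Hamiltonian `H_L = ∑_{x=1}^{L-1} (S² - S⃗_x · S⃗_{x+1})` with `S = N / 2`, written as a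
sum over the pairs of sites `(x, y)` with `y = x + 1`. -/
def hamiltonian (L N : ℕ) : ChainOp L N :=
  ∑ x : Fin L, ∑ y : Fin L,
    if (x : ℕ) + 1 = (y : ℕ) then (((N : ℂ) / 2) ^ 2) • (1 : ChainOp L N) - spinDot N x y else 0

/-- `Tr e^{-β H_L}` (the trace is real, since `H_L` is Hermitian). -/
def partitionFunction (L : ℕ) (β : ℝ) (N : ℕ) : ℝ :=
  (Matrix.trace (NormedSpace.exp ((-(β : ℂ)) • hamiltonian L N))).re

/-- The finite volume specific free energy `f_L(β, S) = - (β L)⁻¹ ln Tr e^{-β H_L}`, `S = N / 2`. -/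
def finiteFreeEnergy (L : ℕ) (β : ℝ) (N : ℕ) : ℝ :=
  -(1 / (β * (L : ℝ))) * Real.log (partitionFunction L β N)

/-- The specific free energy `f(β, S) = lim_{L → ∞} f_L(β, S)`, `S = N / 2`. -/
def freeEnergy (β : ℝ) (N : ℕ) : ℝ :=
  Filter.limUnder Filter.atTop fun L : ℕ => finiteFreeEnergy L β N

/-- `C₁ = (2π)⁻¹ ∫_ℝ ln (1 - e^{-p²}) dp`. -/
def C₁ : ℝ :=
  1 / (2 * Real.pi) * ∫ p : ℝ, Real.log (1 - Real.exp (-p ^ 2))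

/-- The error `(βS)^{-1/12} (ln βS)^{1/2} (ln βS³)^{1/3}`. -/
def errorTerm (β S : ℝ) : ℝ :=
  (β * S) ^ (-(1 / 12) : ℝ) * Real.log (β * S) ^ (1 / 2 : ℝ) *
    Real.log (β * S ^ 3) ^ (1 / 3 : ℝ)

end

end Heisenberg

/-! A spin `S = N / 2` is a symmetrised stack of `N` spins 1/2. A vector with `k` raised spins
therefore becomes a symmetric function `lift ψ k` of `k` labelled particles on the points of `Fin L
× Fin N` (site, colour), and every bond acts on it as half a sum of `1 - transposition`
(`lift_bond`). The energy is thus the Dirichlet form of an exchange process, and all estimates are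
made on such functions.

A lower bound on `f` is an upper bound on the partition function. Bonds are nonnegative, so cutting
the chain makes `log Z_L` subadditive; the limit exists, and each single `L` gives a bound on `f`
(`le_freeEnergy`). For every `β` and `S` it remains to find one good `L`.

Suppose `log Z_L(β/2) ≤ X`. Energies above `E = 2X/β` contribute at most 1. Below `E`, SU(2)
symmetry is used: the lowering operator commutes with the Hamiltonian, and its kernel in the sector
with `k + 1` particles has energy at least `(k+1)N/(32L²)` (`gap_of_lowerSector_eq_zero`). Hence
every sector is dominated by one with `k` at most of order `L²E/N`
(`partitionFunction_le_of_truncSum`). In such dilute sectors the particles are nearly free bosons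
with energy `S(2 - 2 cos p)`. If the spin is small, collisions are rare (`sum_colliding_le`), and
deleting one site per particle turns hard core particles into free bosons on a shorter chain
(`truncSum_le_of_spread`). If the spin is large, `k²` is small compared with `N` and the finite
height of the stacks is hardly felt (`truncSum_le_of_stack`). The free boson sum is bounded by the
integral in `C₁` (`log_prod_boson_le`).

The relative error consists of the logarithm of the number of sectors, which favours long chains,
and of the collision error, which grows with `L` and `X`. A better `X` permits a longer chain, so
the trivial bound is improved in rounds: with `b = βS`, three rounds ending at a length of order
`b^(7/12) (log b)^(1/6)` suffice if `S < b⁴`, and one round suffices for larger `S`. Spectra are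
compared through Hall's marriage theorem (`sum_exp_le_of_functionals`) and through intertwining maps
(`spectral_sum_le_of_intertwining`). -/

namespace Heisenberg

noncomputable section

open Matrix

/-! ### Comparison of spectral sums of symmetric matrices. -/

section Spectral

variable {ι κ J : Type*} [Fintype ι] [DecidableEq ι] [Fintype κ] [DecidableEq κ] [Fintype J]

/-- The `i`-th eigenvector of a real symmetric matrix as a plain vector. -/
def eigvec {A : Matrix ι ι ℝ} (hA : A.IsHermitian) (i : ι) : ι → ℝ :=
  (hA.eigenvectorBasis i).ofLp

lemma mulVec_eigvec {A : Matrix ι ι ℝ} (hA : A.IsHermitian) (i : ι) :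
    A *ᵥ eigvec hA i = hA.eigenvalues i • eigvec hA i :=
  hA.mulVec_eigenvectorBasis i

lemma eigvec_dotProduct {A : Matrix ι ι ℝ} (hA : A.IsHermitian) (i j : ι) :
    eigvec hA i ⬝ᵥ eigvec hA j = if i = j then 1 else 0 := by
  have h := (orthonormal_iff_ite.mp hA.eigenvectorBasis.orthonormal) i j
  rw [← h, EuclideanSpace.inner_eq_star_dotProduct]
  simp [eigvec, dotProduct_comm (hA.eigenvectorBasis j).ofLp]

lemma eigvec_expansion {A : Matrix ι ι ℝ} (hA : A.IsHermitian) (ψ : ι → ℝ) :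
    ψ = ∑ i, (eigvec hA i ⬝ᵥ ψ) • eigvec hA i := by
  have h := hA.eigenvectorBasis.sum_repr' (WithLp.toLp 2 ψ)
  have h2 := congrArg WithLp.ofLp h
  simp only [WithLp.ofLp_sum, WithLp.ofLp_smul] at h2
  refine h2.symm.trans (Finset.sum_congr rfl fun i _ => ?_)
  rw [EuclideanSpace.inner_eq_star_dotProduct]
  simp [eigvec, dotProduct_comm]

omit [DecidableEq ι] in
lemma mulVec_dotProduct_symm {A : Matrix ι ι ℝ} (hA : A.IsHermitian) (v w : ι → ℝ) :
    v ⬝ᵥ A *ᵥ w = (A *ᵥ v) ⬝ᵥ w := by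
  have hT : Aᵀ = A := by simpa [conjTranspose_eq_transpose_of_trivial] using hA.eq
  rw [dotProduct_mulVec, ← mulVec_transpose, hT]

lemma dotProduct_self_eq_sum {A : Matrix ι ι ℝ} (hA : A.IsHermitian) (ψ : ι → ℝ) :
    ψ ⬝ᵥ ψ = ∑ i, (eigvec hA i ⬝ᵥ ψ) ^ 2 := by
  conv_lhs => enter [2]; rw [eigvec_expansion hA ψ]
  rw [dotProduct_sum]
  refine Finset.sum_congr rfl fun i _ => ?_
  rw [dotProduct_smul, dotProduct_comm, smul_eq_mul, sq]

lemma eigvec_dotProduct_mulVec {A : Matrix ι ι ℝ} (hA : A.IsHermitian) (i : ι) (ψ : ι → ℝ) :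
    eigvec hA i ⬝ᵥ A *ᵥ ψ = hA.eigenvalues i * (eigvec hA i ⬝ᵥ ψ) := by
  rw [mulVec_dotProduct_symm hA, mulVec_eigvec, smul_dotProduct, smul_eq_mul]

lemma dotProduct_mulVec_eq_sum {A : Matrix ι ι ℝ} (hA : A.IsHermitian) (ψ : ι → ℝ) :
    ψ ⬝ᵥ A *ᵥ ψ = ∑ i, hA.eigenvalues i * (eigvec hA i ⬝ᵥ ψ) ^ 2 := by
  conv_lhs => enter [1]; rw [eigvec_expansion hA ψ]
  rw [sum_dotProduct]
  refine Finset.sum_congr rfl fun i _ => ?_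
  rw [smul_dotProduct, eigvec_dotProduct_mulVec, smul_eq_mul]
  ring

lemma trace_exp_smul {A : Matrix ι ι ℝ} (hA : A.IsHermitian) (t : ℝ) :
    (NormedSpace.exp (t • A)).trace = ∑ i, Real.exp (t * hA.eigenvalues i) := by
  have hs := hA.spectral_theorem
  rw [Unitary.conjStarAlgAut_apply] at hs
  set U := hA.eigenvectorUnitary
  have hU : IsUnit (U : Matrix ι ι ℝ) := Unitary.isUnit_coe
  have hinv : (U : Matrix ι ι ℝ)⁻¹ = star (U : Matrix ι ι ℝ) :=
    inv_eq_left_inv (Unitary.coe_star_mul_self U)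
  have h1 : t • A = (U : Matrix ι ι ℝ) * diagonal (fun i => t * hA.eigenvalues i) *
      (U : Matrix ι ι ℝ)⁻¹ := by
    rw [hinv]
    conv_lhs => rw [hs]
    rw [← Matrix.smul_mul, ← Matrix.mul_smul, ← diagonal_smul]
    rfl
  rw [h1, exp_conj _ _ hU, trace_mul_cycle, nonsing_inv_mul _ ((isUnit_iff_isUnit_det _).mp hU),
    one_mul, exp_diagonal, trace_diagonal]
  refine Finset.sum_congr rfl fun i _ => ?_
  rw [Pi.coe_exp, Real.exp_eq_exp_ℝ]

/-- A combination of more vectors than there are functionals can be chosen to be annihilated. -/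
lemma exists_coeff_annihilated (s : Finset ι) (t : Finset J) (hst : t.card < s.card)
    (M : J → ι → ℝ) :
    ∃ c : ι → ℝ, c ≠ 0 ∧ (∀ i, i ∉ s → c i = 0) ∧ ∀ j ∈ t, ∑ i, c i * M j i = 0 := by
  classical
  let f : (s → ℝ) →ₗ[ℝ] (t → ℝ) := Matrix.toLin' (Matrix.of fun (j : t) (i : s) => M j i)
  have hk : LinearMap.ker f ≠ ⊥ := LinearMap.ker_ne_bot_of_finrank_lt (by simpa using hst)
  obtain ⟨c, hc, hc0⟩ := Submodule.exists_mem_ne_zero_of_ne_bot hk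
  refine ⟨fun i => if h : i ∈ s then c ⟨i, h⟩ else 0, ?_, ?_, ?_⟩
  · contrapose! hc0
    funext i
    simpa using congrFun hc0 i
  · intro i hi
    simp [hi]
  · intro j hj
    have h := congrFun (LinearMap.mem_ker.mp hc) ⟨j, hj⟩
    simp only [f, toLin'_apply, mulVec, dotProduct, of_apply, Pi.zero_apply] at h
    refine Eq.trans ?_ h
    rw [← Finset.sum_subset (Finset.subset_univ s)
      (fun i _ hi => by simp [hi]), ← Finset.sum_coe_sort s]
    exact Finset.sum_congr rfl fun i _ => by simp [mul_comm]

/-- The span vector `∑ cᵢ vᵢ` of eigenvectors. -/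
def eigcomb {A : Matrix ι ι ℝ} (hA : A.IsHermitian) (c : ι → ℝ) : ι → ℝ :=
  ∑ i, c i • eigvec hA i

lemma eigvec_dotProduct_eigcomb {A : Matrix ι ι ℝ} (hA : A.IsHermitian) (c : ι → ℝ) (i : ι) :
    eigvec hA i ⬝ᵥ eigcomb hA c = c i := by
  simp [eigcomb, dotProduct_sum, dotProduct_smul, eigvec_dotProduct]

lemma eigcomb_ne_zero {A : Matrix ι ι ℝ} (hA : A.IsHermitian) {c : ι → ℝ} (hc : c ≠ 0) :
    eigcomb hA c ≠ 0 := by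
  contrapose! hc
  funext i
  rw [← eigvec_dotProduct_eigcomb hA c i, hc]
  simp

/-- Variational comparison of a truncated spectral sum with a sum over functionals. -/
theorem sum_exp_le_of_functionals {A : Matrix ι ι ℝ} (hA : A.IsHermitian) (E β : ℝ) (hβ : 0 ≤ β)
    (l : J → (ι → ℝ) →ₗ[ℝ] ℝ) (b : J → ℝ)
    (H : ∀ (ψ : ι → ℝ) (e : ℝ), ψ ≠ 0 → ψ ⬝ᵥ A *ᵥ ψ ≤ E * (ψ ⬝ᵥ ψ) →
      (∀ j, b j ≤ e → l j ψ = 0) → e * (ψ ⬝ᵥ ψ) < ψ ⬝ᵥ A *ᵥ ψ) :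
    ∑ i with hA.eigenvalues i < E, Real.exp (-β * hA.eigenvalues i) ≤
      ∑ j, Real.exp (-β * b j) := by
  classical
  set I : Finset ι := Finset.univ.filter fun i => hA.eigenvalues i < E
  -- Hall's theorem takes the place of the min-max principle: each eigenvalue below `E` is to be
  -- matched with a functional of its own whose level is not larger.
  let t : I → Finset J := fun i => Finset.univ.filter fun j => b j ≤ hA.eigenvalues i
  have hall : ∀ s : Finset I, s.card ≤ (s.biUnion t).card := by
    intro s
    rcases s.eq_empty_or_nonempty with rfl | hs
    · simp
    obtain ⟨m, hm, hmax⟩ := s.exists_max_image (fun i => hA.eigenvalues (i : ι)) hs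
    have hsub : t m ⊆ s.biUnion t := Finset.subset_biUnion_of_mem t hm
    refine le_trans ?_ (Finset.card_le_card hsub)
    by_contra hlt
    push Not at hlt
    -- If Hall's condition failed for `s`, a nonzero combination of its eigenvectors would be killed
    -- by all functionals of level up to the largest eigenvalue in `s`. By `H` its energy would
    -- exceed that eigenvalue, which is impossible.
    obtain ⟨c, hc0, hcs, hc⟩ := exists_coeff_annihilated
      (s.map (Function.Embedding.subtype _)) (t m) (by simpa using hlt)
      (fun j i => l j (eigvec hA i))
    have hsupp : ∀ i, c i ≠ 0 → hA.eigenvalues i ≤ hA.eigenvalues m := by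
      intro i hi
      by_contra hcon
      apply hi
      apply hcs
      intro hmem
      obtain ⟨a, ha, rfl⟩ := Finset.mem_map.mp hmem
      exact hcon (hmax a ha)
    have hq : eigcomb hA c ⬝ᵥ A *ᵥ eigcomb hA c ≤
        hA.eigenvalues m * (eigcomb hA c ⬝ᵥ eigcomb hA c) := by
      rw [dotProduct_mulVec_eq_sum hA, dotProduct_self_eq_sum hA, Finset.mul_sum]
      refine Finset.sum_le_sum fun i _ => ?_
      rw [eigvec_dotProduct_eigcomb]
      by_cases hi : c i = 0
      · simp [hi]
      · exact mul_le_mul_of_nonneg_right (hsupp i hi) (sq_nonneg _)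
    have hnn : 0 ≤ eigcomb hA c ⬝ᵥ eigcomb hA c := by
      rw [dotProduct_self_eq_sum hA]; positivity
    have hmE : hA.eigenvalues m < E := (Finset.mem_filter.mp m.2).2
    refine absurd hq (not_le.mpr (H _ _ (eigcomb_ne_zero hA hc0)
      (hq.trans (mul_le_mul_of_nonneg_right hmE.le hnn)) ?_))
    intro j hj
    have := hc j (by simpa [t] using hj)
    simpa [eigcomb, map_sum] using this
  obtain ⟨f, hf, hft⟩ := (Finset.all_card_le_biUnion_card_iff_exists_injective t).mp hall
  rw [← Finset.sum_coe_sort]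
  calc ∑ i : I, Real.exp (-β * hA.eigenvalues i) ≤ ∑ i : I, Real.exp (-β * b (f i)) := by
        refine Finset.sum_le_sum fun i _ => Real.exp_le_exp.mpr ?_
        have : b (f i) ≤ hA.eigenvalues i := by simpa [t] using hft i
        nlinarith
    _ = ∑ j ∈ Finset.univ.image f, Real.exp (-β * b j) := by
        rw [Finset.sum_image fun a _ b _ h => hf h]
    _ ≤ ∑ j, Real.exp (-β * b j) :=
        Finset.sum_le_sum_of_subset_of_nonneg (Finset.subset_univ _)
          fun _ _ _ => (Real.exp_pos _).le

theorem trace_exp_le_of_functionals {A : Matrix ι ι ℝ} (hA : A.IsHermitian) (β : ℝ) (hβ : 0 ≤ β)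
    (l : J → (ι → ℝ) →ₗ[ℝ] ℝ) (b : J → ℝ)
    (H : ∀ (ψ : ι → ℝ) (e : ℝ), ψ ≠ 0 →
      (∀ j, b j ≤ e → l j ψ = 0) → e * (ψ ⬝ᵥ ψ) < ψ ⬝ᵥ A *ᵥ ψ) :
    ∑ i, Real.exp (-β * hA.eigenvalues i) ≤ ∑ j, Real.exp (-β * b j) := by
  -- This cut-off lies above the whole spectrum.
  have h := sum_exp_le_of_functionals hA (∑ i, |hA.eigenvalues i| + 1) β hβ l b
    (fun ψ e h0 _ h => H ψ e h0 h)
  rwa [Finset.filter_true_of_mem] at h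
  intro i _
  have := Finset.single_le_sum (f := fun i => |hA.eigenvalues i|) (fun i _ => abs_nonneg _)
    (Finset.mem_univ i)
  have := le_abs_self (hA.eigenvalues i)
  linarith

/-- A linear map that intertwines two symmetric matrices and is injective on low eigenspaces
compares truncated spectral sums. -/
theorem spectral_sum_le_of_intertwining {A : Matrix ι ι ℝ} {B : Matrix κ κ ℝ} (hA : A.IsHermitian)
    (hB : B.IsHermitian) (R : (ι → ℝ) →ₗ[ℝ] (κ → ℝ)) (hR : ∀ v, B *ᵥ R v = R (A *ᵥ v)) (E : ℝ)
    (hinj : ∀ (v : ι → ℝ) (e : ℝ), A *ᵥ v = e • v → v ≠ 0 → e < E → R v ≠ 0)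
    (φ : ℝ → ℝ) (hφ : ∀ x, 0 ≤ φ x) :
    ∑ i with hA.eigenvalues i < E, φ (hA.eigenvalues i) ≤
      ∑ j with hB.eigenvalues j < E, φ (hB.eigenvalues j) := by
  classical
  set I : Finset ι := Finset.univ.filter fun i => hA.eigenvalues i < E
  set K : Finset κ := Finset.univ.filter fun j => hB.eigenvalues j < E
  -- Multiplicities are compared one eigenvalue at a time: `R` maps the `e`-eigenspace of `A` into
  -- that of `B`, injectively when `e < E`.
  have key : ∀ e < E, (I.filter fun i => hA.eigenvalues i = e).card ≤
      (K.filter fun j => hB.eigenvalues j = e).card := by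
    intro e he
    by_contra hlt
    push Not at hlt
    obtain ⟨c, hc0, hcs, hc⟩ := exists_coeff_annihilated _ _ hlt
      (fun j i => eigvec hB j ⬝ᵥ R (eigvec hA i))
    have heig : A *ᵥ eigcomb hA c = e • eigcomb hA c := by
      simp only [eigcomb, mulVec_sum, mulVec_smul, Finset.smul_sum, mulVec_eigvec]
      refine Finset.sum_congr rfl fun i _ => ?_
      by_cases hi : c i = 0
      · simp [hi]
      · have : i ∈ I.filter fun i => hA.eigenvalues i = e := by
          by_contra h
          exact hi (hcs i h)
        rw [(Finset.mem_filter.mp this).2, smul_comm]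
    refine hinj _ e heig (eigcomb_ne_zero hA hc0) he ?_
    rw [eigvec_expansion hB (R (eigcomb hA c))]
    refine Finset.sum_eq_zero fun j _ => ?_
    have hz : eigvec hB j ⬝ᵥ R (eigcomb hA c) = 0 := by
      by_cases hj : hB.eigenvalues j = e
      · have := hc j (by simp [K, hj, he])
        simpa [eigcomb, map_sum, dotProduct_sum, dotProduct_smul] using this
      -- The image is an eigenvector of `B` for `e`, hence orthogonal to the eigenvectors of `B`
      -- with other eigenvalues.
      · have h1 := eigvec_dotProduct_mulVec hB j (R (eigcomb hA c))
        rw [hR, heig, map_smul, dotProduct_smul, smul_eq_mul] at h1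
        have h2 : (e - hB.eigenvalues j) * (eigvec hB j ⬝ᵥ R (eigcomb hA c)) = 0 := by linarith
        rcases mul_eq_zero.mp h2 with h | h
        · exact absurd (by linarith) hj
        · exact h
    rw [hz, zero_smul]
  set T : Finset ℝ := I.image hA.eigenvalues ∪ K.image hB.eigenvalues
  have hI : ∀ i ∈ I, hA.eigenvalues i ∈ T := fun i hi =>
    Finset.mem_union_left _ (Finset.mem_image_of_mem _ hi)
  have hK : ∀ j ∈ K, hB.eigenvalues j ∈ T := fun i hi =>
    Finset.mem_union_right _ (Finset.mem_image_of_mem _ hi)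
  rw [← Finset.sum_fiberwise_of_maps_to hI, ← Finset.sum_fiberwise_of_maps_to hK]
  refine Finset.sum_le_sum fun e he => ?_
  have heE : e < E := by
    rcases Finset.mem_union.mp he with h | h
    · obtain ⟨i, hi, rfl⟩ := Finset.mem_image.mp h
      exact (Finset.mem_filter.mp hi).2
    · obtain ⟨i, hi, rfl⟩ := Finset.mem_image.mp h
      exact (Finset.mem_filter.mp hi).2
  have h1 : ∑ i ∈ I with hA.eigenvalues i = e, φ (hA.eigenvalues i) =
      ∑ i ∈ I with hA.eigenvalues i = e, φ e :=
    Finset.sum_congr rfl fun i hi => congrArg φ (Finset.mem_filter.mp hi).2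
  have h2 : ∑ i ∈ K with hB.eigenvalues i = e, φ (hB.eigenvalues i) =
      ∑ i ∈ K with hB.eigenvalues i = e, φ e :=
    Finset.sum_congr rfl fun i hi => congrArg φ (Finset.mem_filter.mp hi).2
  rw [h1, h2, Finset.sum_const, Finset.sum_const, nsmul_eq_mul, nsmul_eq_mul]
  exact mul_le_mul_of_nonneg_right (by exact_mod_cast key e heE) (hφ e)

end Spectral

end

end Heisenberg

namespace Heisenberg

noncomputable section

open Matrix

/-! ### The Hamiltonian as a real matrix and its action on labelled particles. -/

section Real

variable {L N : ℕ}

/-- The raising operator as a real matrix. -/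
def raising (N : ℕ) : Matrix (Fin (N + 1)) (Fin (N + 1)) ℝ :=
  Matrix.of fun m n =>
    if (m : ℕ) = (n : ℕ) + 1 then Real.sqrt (((n : ℝ) + 1) * ((N : ℝ) - (n : ℝ))) else 0

/-- The third spin component as a real matrix. -/
def spinZ (N : ℕ) : Matrix (Fin (N + 1)) (Fin (N + 1)) ℝ :=
  Matrix.diagonal fun n => (n : ℝ) - (N : ℝ) / 2

/-- Real version of `siteOp`. -/
def onSite (x : Fin L) (A : Matrix (Fin (N + 1)) (Fin (N + 1)) ℝ) :
    Matrix (Fin L → Fin (N + 1)) (Fin L → Fin (N + 1)) ℝ :=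
  Matrix.of fun σ τ => if ∀ y, y ≠ x → σ y = τ y then A (σ x) (τ x) else 0

/-- The bond operator `S² - S⃗_x · S⃗_y` as a real matrix. -/
def bond (N : ℕ) (x y : Fin L) : Matrix (Fin L → Fin (N + 1)) (Fin L → Fin (N + 1)) ℝ :=
  ((N : ℝ) / 2) ^ 2 • 1 - ((1 / 2 : ℝ) • (onSite x (raising N) * onSite y (raising N)ᵀ +
    onSite x (raising N)ᵀ * onSite y (raising N)) + onSite x (spinZ N) * onSite y (spinZ N))

/-- The Hamiltonian as a real matrix. -/
def realHam (L N : ℕ) : Matrix (Fin L → Fin (N + 1)) (Fin L → Fin (N + 1)) ℝ :=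
  ∑ x : Fin L, ∑ y : Fin L, if (x : ℕ) + 1 = (y : ℕ) then bond N x y else 0

lemma siteOp_map (x : Fin L) (A : Matrix (Fin (N + 1)) (Fin (N + 1)) ℝ) :
    siteOp x (A.map Complex.ofRealHom) = (onSite x A).map Complex.ofRealHom := by
  ext σ τ
  simp only [siteOp, onSite, of_apply, map_apply]
  split_ifs <;> simp

lemma siteOp_add (x : Fin L) (A B : Matrix (Fin (N + 1)) (Fin (N + 1)) ℂ) :
    siteOp x (A + B) = siteOp x A + siteOp x B := by
  ext σ τ
  simp only [siteOp, of_apply, Matrix.add_apply]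
  split_ifs <;> simp

lemma siteOp_smul (x : Fin L) (c : ℂ) (A : Matrix (Fin (N + 1)) (Fin (N + 1)) ℂ) :
    siteOp x (c • A) = c • siteOp x A := by
  ext σ τ
  simp only [siteOp, of_apply, Matrix.smul_apply]
  split_ifs <;> simp

lemma siteOp_sub (x : Fin L) (A B : Matrix (Fin (N + 1)) (Fin (N + 1)) ℂ) :
    siteOp x (A - B) = siteOp x A - siteOp x B := by
  ext σ τ
  simp only [siteOp, of_apply, Matrix.sub_apply]
  split_ifs <;> simp

lemma spinPlus_eq_map : spinPlus N = (raising N).map Complex.ofRealHom := by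
  ext m n
  simp only [spinPlus, raising, of_apply, map_apply]
  split_ifs <;> simp

lemma spinPlus_conjTranspose :
    (spinPlus N).conjTranspose = (raising N)ᵀ.map Complex.ofRealHom := by
  rw [spinPlus_eq_map]
  ext m n
  simp [conjTranspose_apply]

/-- Since `(1/(2i))² = -1/4`, the products `S⁺S⁺` and `S⁻S⁻` cancel between the first two components
and only `(S⁺S⁻ + S⁻S⁺)/2` survives. This makes the Hamiltonian real, so real symmetric matrices
suffice from here on. -/
lemma spinDot_eq_map (x y : Fin L) :
    spinDot N x y = ((1 / 2 : ℝ) • (onSite x (raising N) * onSite y (raising N)ᵀ +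
      onSite x (raising N)ᵀ * onSite y (raising N)) +
      onSite x (spinZ N) * onSite y (spinZ N)).map Complex.ofRealHom := by
  have h3 : (Matrix.diagonal fun n : Fin (N + 1) => (n : ℂ) - (N : ℂ) / 2) =
      (spinZ N).map Complex.ofRealHom := by
    rw [spinZ, diagonal_map (map_zero _)]
    congr 1
    funext n
    simp
  have hi : (1 / (2 * Complex.I) : ℂ) * (1 / (2 * Complex.I)) = -(1 / 4) := by
    rw [div_mul_div_comm, show (2 * Complex.I) * (2 * Complex.I) = 4 * (Complex.I * Complex.I) by ring,
      Complex.I_mul_I]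
    norm_num
  simp only [spinDot, Fin.sum_univ_three, spin, cons_val_zero, cons_val_one, cons_val]
  rw [spinPlus_conjTranspose, spinPlus_eq_map, h3]
  simp only [siteOp_smul, siteOp_add, siteOp_sub, siteOp_map]
  rw [smul_mul_smul_comm, smul_mul_smul_comm, hi]
  simp only [Matrix.map_add _ (map_add Complex.ofRealHom), Matrix.map_mul]
  rw [Matrix.map_smul' Complex.ofRealHom _ _ (map_mul Complex.ofRealHom)]
  simp only [Matrix.map_add _ (map_add Complex.ofRealHom), Matrix.map_mul]
  generalize (onSite x (raising N)).map Complex.ofRealHom = X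
  generalize (onSite x (raising N)ᵀ).map Complex.ofRealHom = X'
  generalize (onSite y (raising N)).map Complex.ofRealHom = Y
  generalize (onSite y (raising N)ᵀ).map Complex.ofRealHom = Y'
  congr 1
  simp only [mul_add, add_mul, mul_sub, sub_mul, Complex.ofRealHom_eq_coe]
  push_cast
  module

lemma hamiltonian_eq_map : hamiltonian L N = (realHam L N).map Complex.ofRealHom := by
  have hm : ∀ A : Matrix (Fin L → Fin (N + 1)) (Fin L → Fin (N + 1)) ℝ,
      A.map Complex.ofRealHom = Complex.ofRealHom.mapMatrix A := fun _ => rfl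
  rw [hm, realHam, map_sum, hamiltonian]
  refine Finset.sum_congr rfl fun x _ => ?_
  rw [map_sum]
  refine Finset.sum_congr rfl fun y _ => ?_
  split_ifs with h
  · rw [bond, map_sub, spinDot_eq_map, hm]
    congr 1
    rw [← hm, Matrix.map_smul' Complex.ofRealHom _ _ (map_mul Complex.ofRealHom)]
    simp [Matrix.map_one]
  · simp

lemma onSite_mulVec (x : Fin L) (A : Matrix (Fin (N + 1)) (Fin (N + 1)) ℝ)
    (ψ : (Fin L → Fin (N + 1)) → ℝ) (σ : Fin L → Fin (N + 1)) :
    (onSite x A *ᵥ ψ) σ = ∑ p, A (σ x) p * ψ (Function.update σ x p) := by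
  simp only [mulVec, dotProduct, onSite, of_apply, ite_mul, zero_mul]
  rw [← Finset.sum_filter]
  symm
  refine Finset.sum_bij' (fun p _ => Function.update σ x p) (fun τ _ => τ x) ?_ ?_ ?_ ?_ ?_
  · intro p _
    simp only [Finset.mem_filter, Finset.mem_univ, true_and]
    intro y hy
    simp [hy]
  · simp
  · simp
  · intro τ hτ
    simp only [Finset.mem_filter, Finset.mem_univ, true_and] at hτ
    funext y
    by_cases hy : y = x
    · subst hy; simp
    · simp [hy, hτ y hy]
  · simp

lemma onSite_mul_mulVec {x y : Fin L} (hxy : x ≠ y) (A B : Matrix (Fin (N + 1)) (Fin (N + 1)) ℝ)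
    (ψ : (Fin L → Fin (N + 1)) → ℝ) (σ : Fin L → Fin (N + 1)) :
    ((onSite x A * onSite y B) *ᵥ ψ) σ = ∑ p, ∑ q, A (σ x) p * B (σ y) q *
      ψ (Function.update (Function.update σ x p) y q) := by
  rw [← mulVec_mulVec, onSite_mulVec]
  refine Finset.sum_congr rfl fun p _ => ?_
  rw [onSite_mulVec, Finset.mul_sum]
  refine Finset.sum_congr rfl fun q _ => ?_
  rw [Function.update_of_ne hxy.symm, mul_assoc]

lemma onSite_comm {x y : Fin L} (hxy : x ≠ y) (A B : Matrix (Fin (N + 1)) (Fin (N + 1)) ℝ) :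
    onSite x A * onSite y B = onSite y B * onSite x A := by
  apply Matrix.mulVec_injective
  funext ψ σ
  rw [onSite_mul_mulVec hxy, onSite_mul_mulVec hxy.symm, Finset.sum_comm]
  refine Finset.sum_congr rfl fun p _ => Finset.sum_congr rfl fun q _ => ?_
  rw [Function.update_comm hxy, mul_comm (A _ _)]

lemma onSite_transpose (x : Fin L) (A : Matrix (Fin (N + 1)) (Fin (N + 1)) ℝ) :
    (onSite x A)ᵀ = onSite x Aᵀ := by
  ext σ τ
  simp only [onSite, transpose_apply, of_apply]
  congr 1
  exact propext (forall₂_congr fun _ _ => eq_comm)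

lemma bond_transpose {x y : Fin L} (hxy : x ≠ y) : (bond N x y)ᵀ = bond N x y := by
  have hz : (spinZ N)ᵀ = spinZ N := diagonal_transpose _
  simp only [bond, transpose_sub, transpose_add, transpose_smul, transpose_one, transpose_mul,
    onSite_transpose, transpose_transpose, hz]
  rw [onSite_comm hxy.symm, onSite_comm hxy.symm, onSite_comm hxy.symm,
    add_comm (onSite x (raising N)ᵀ * _)]

lemma ne_of_adj {x y : Fin L} (h : (x : ℕ) + 1 = y) : x ≠ y := by
  rintro rfl
  omega

lemma realHam_isHermitian : (realHam L N).IsHermitian := by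
  rw [IsHermitian, conjTranspose_eq_transpose_of_trivial, realHam]
  simp only [transpose_sum]
  refine Finset.sum_congr rfl fun x _ => Finset.sum_congr rfl fun y _ => ?_
  split_ifs with h
  · exact bond_transpose (ne_of_adj h)
  · simp

lemma partitionFunction_eq_trace (β : ℝ) :
    partitionFunction L β N = (NormedSpace.exp ((-β) • realHam L N)).trace := by
  have h1 : (-(β : ℂ)) • hamiltonian L N =
      Complex.ofRealHom.mapMatrix ((-β) • realHam L N) := by
    rw [hamiltonian_eq_map, RingHom.mapMatrix_apply, Matrix.map_smul' Complex.ofRealHom _ _ (map_mul Complex.ofRealHom)]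
    simp
  have hc : Continuous (Complex.ofRealHom.mapMatrix :
      Matrix (Fin L → Fin (N + 1)) (Fin L → Fin (N + 1)) ℝ →+* _) :=
    continuous_id.matrix_map Complex.continuous_ofReal
  have h2 : NormedSpace.exp (Complex.ofRealHom.mapMatrix ((-β) • realHam L N)) =
      Complex.ofRealHom.mapMatrix (NormedSpace.exp ((-β) • realHam L N)) := by
    let _ : NormedRing (Matrix (Fin L → Fin (N + 1)) (Fin L → Fin (N + 1)) ℝ) :=
      Matrix.linftyOpNormedRing
    let _ : NormedAlgebra ℝ (Matrix (Fin L → Fin (N + 1)) (Fin L → Fin (N + 1)) ℝ) :=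
      Matrix.linftyOpNormedAlgebra
    let _ : NormedRing (Matrix (Fin L → Fin (N + 1)) (Fin L → Fin (N + 1)) ℂ) :=
      Matrix.linftyOpNormedRing
    let _ : NormedAlgebra ℚ (Matrix (Fin L → Fin (N + 1)) (Fin L → Fin (N + 1)) ℝ) :=
      NormedAlgebra.restrictScalars ℚ ℝ _
    exact (NormedSpace.map_exp _ hc _).symm
  rw [partitionFunction, h1, h2]
  simp [Matrix.trace]

lemma partitionFunction_eq_sum (β : ℝ) :
    partitionFunction L β N =
      ∑ σ, Real.exp (-β * (realHam_isHermitian (L := L) (N := N)).eigenvalues σ) := by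
  rw [partitionFunction_eq_trace, trace_exp_smul]

/-- The amplitude of `ψ` relative to the ground states, on `ℕ`-valued configurations. -/
def amp (ψ : (Fin L → Fin (N + 1)) → ℝ) (n : Fin L → ℕ) : ℝ :=
  if h : ∀ x, n x < N + 1 then ψ (fun x => ⟨n x, h x⟩) / Real.sqrt (∏ x, (N.choose (n x) : ℝ))
  else 0

lemma amp_of_le (ψ : (Fin L → Fin (N + 1)) → ℝ) {n : Fin L → ℕ} (h : ∀ x, n x < N + 1) :
    amp ψ n = ψ (fun x => ⟨n x, h x⟩) / Real.sqrt (∏ x, (N.choose (n x) : ℝ)) := dif_pos h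

lemma amp_add (ψ φ : (Fin L → Fin (N + 1)) → ℝ) (n : Fin L → ℕ) :
    amp (ψ + φ) n = amp ψ n + amp φ n := by
  unfold amp
  split_ifs
  · simp [add_div]
  · simp

lemma amp_smul (c : ℝ) (ψ : (Fin L → Fin (N + 1)) → ℝ) (n : Fin L → ℕ) :
    amp (c • ψ) n = c * amp ψ n := by
  unfold amp
  split_ifs
  · simp [mul_div_assoc]
  · simp

lemma amp_sub (ψ φ : (Fin L → Fin (N + 1)) → ℝ) (n : Fin L → ℕ) :
    amp (ψ - φ) n = amp ψ n - amp φ n := by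
  unfold amp
  split_ifs
  · simp [sub_div]
  · simp

lemma amp_sum {α : Type*} (s : Finset α) (ψ : α → (Fin L → Fin (N + 1)) → ℝ) (n : Fin L → ℕ) :
    amp (∑ a ∈ s, ψ a) n = ∑ a ∈ s, amp (ψ a) n := by
  unfold amp
  split_ifs
  · simp [Finset.sum_div]
  · simp

lemma choose_prod_update (n : Fin L → ℕ) (x : Fin L) (k : ℕ) (hx : n x = k + 1) (hk : k ≤ N) :
    (∏ y, (N.choose (n y) : ℝ)) * (k + 1) =
      (∏ y, (N.choose (Function.update n x k y) : ℝ)) * (N - k) := by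
  rw [← Finset.mul_prod_erase _ _ (Finset.mem_univ x),
    ← Finset.mul_prod_erase _ (fun y => (N.choose (Function.update n x k y) : ℝ))
      (Finset.mem_univ x)]
  have h1 : ∏ y ∈ Finset.univ.erase x, (N.choose (Function.update n x k y) : ℝ) =
      ∏ y ∈ Finset.univ.erase x, (N.choose (n y) : ℝ) := by
    refine Finset.prod_congr rfl fun y hy => ?_
    rw [Function.update_of_ne (Finset.ne_of_mem_erase hy)]
  have h2 := Nat.choose_succ_right_eq N k
  have h3 : ((N.choose (k + 1) : ℝ)) * (k + 1) = N.choose k * (N - k) := by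
    rw [← Nat.cast_sub hk]; exact_mod_cast h2
  rw [h1, hx, Function.update_self]
  linear_combination (∏ y ∈ Finset.univ.erase x, (N.choose (n y) : ℝ)) * h3

lemma choose_prod_pos {n : Fin L → ℕ} (h : ∀ x, n x < N + 1) :
    0 < ∏ x, (N.choose (n x) : ℝ) :=
  Finset.prod_pos fun x _ => by exact_mod_cast Nat.choose_pos (Nat.lt_succ_iff.mp (h x))

/-- Division by the square roots of the binomials conjugates away the square roots in the matrix
elements and leaves integers with a combinatorial meaning: here the number of particles at `x`, in
`amp_lowering` the number of free places. -/
lemma amp_raising (ψ : (Fin L → Fin (N + 1)) → ℝ) (x : Fin L) {n : Fin L → ℕ}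
    (h : ∀ y, n y < N + 1) :
    amp (onSite x (raising N) *ᵥ ψ) n = n x * amp ψ (Function.update n x (n x - 1)) := by
  rw [amp_of_le _ h, onSite_mulVec]
  rcases Nat.eq_zero_or_pos (n x) with h0 | hpos
  · simp [raising, h0]
  obtain ⟨k, hk⟩ := Nat.exists_eq_succ_of_ne_zero hpos.ne'
  have hkN : k < N := by have := h x; omega
  have h' : ∀ y, Function.update n x (n x - 1) y < N + 1 := by
    intro y
    by_cases hy : y = x
    · subst hy; simp; omega
    · simpa [hy] using h y
  rw [Finset.sum_eq_single (⟨k, by omega⟩ : Fin (N + 1)), amp_of_le _ h']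
  · have he : Function.update (fun y => (⟨n y, h y⟩ : Fin (N + 1))) x ⟨k, by omega⟩ =
        fun y => ⟨Function.update n x (n x - 1) y, h' y⟩ := by
      funext y
      by_cases hy : y = x
      · subst hy; simp [hk]
      · simp [hy]
    have hrel := choose_prod_update n x k hk hkN.le
    rw [he]
    have hn1 : n x - 1 = k := by omega
    simp only [hn1] at h' ⊢
    have hA := choose_prod_pos h
    have hB := choose_prod_pos h'
    set A := ∏ y, (N.choose (n y) : ℝ)
    set B := ∏ y, (N.choose (Function.update n x k y) : ℝ)
    have hr : raising N ⟨n x, h x⟩ ⟨k, by omega⟩ = Real.sqrt (((k : ℝ) + 1) * (N - k)) := by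
      simp [raising, hk]
    have hkc : (n x : ℝ) = k + 1 := by exact_mod_cast hk
    rw [hr, hkc]
    have hNk : (0 : ℝ) ≤ N - k := by
      have : (k : ℝ) < N := by exact_mod_cast hkN
      linarith
    have hsq : Real.sqrt (((k : ℝ) + 1) * (N - k)) * Real.sqrt B = (k + 1) * Real.sqrt A := by
      rw [← Real.sqrt_mul (by positivity), show ((k : ℝ) + 1) * (N - k) * B = (k + 1) ^ 2 * A by
        linear_combination (-(k + 1 : ℝ)) * hrel, Real.sqrt_mul (by positivity),
        Real.sqrt_sq (by positivity)]
    have hA' := Real.sqrt_pos.mpr hA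
    have hB' := Real.sqrt_pos.mpr hB
    field_simp
    linear_combination ψ (fun y => ⟨Function.update n x k y, h' y⟩) * hsq
  · intro p _ hp
    have : ¬ (n x = (p : ℕ) + 1) := fun hc => hp (Fin.ext (by simp; omega))
    simp [raising, this]
  · simp

lemma amp_lowering (ψ : (Fin L → Fin (N + 1)) → ℝ) (x : Fin L) {n : Fin L → ℕ}
    (h : ∀ y, n y < N + 1) :
    amp (onSite x (raising N)ᵀ *ᵥ ψ) n =
      ((N : ℝ) - n x) * amp ψ (Function.update n x (n x + 1)) := by
  rw [amp_of_le _ h, onSite_mulVec]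
  have hle : n x ≤ N := Nat.lt_succ_iff.mp (h x)
  rcases hle.eq_or_lt with h0 | hlt
  · have hc : (n x : ℝ) = N := by exact_mod_cast h0
    rw [hc, sub_self, zero_mul, Finset.sum_eq_zero, zero_div]
    intro p _
    have : ¬ ((p : ℕ) = N + 1) := by have := p.2; omega
    simp [raising, h0, this]
  have h' : ∀ y, Function.update n x (n x + 1) y < N + 1 := by
    intro y
    by_cases hy : y = x
    · subst hy; simp; omega
    · simpa [hy] using h y
  rw [Finset.sum_eq_single (⟨n x + 1, by omega⟩ : Fin (N + 1)), amp_of_le _ h']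
  · have he : Function.update (fun y => (⟨n y, h y⟩ : Fin (N + 1))) x ⟨n x + 1, by omega⟩ =
        fun y => ⟨Function.update n x (n x + 1) y, h' y⟩ := by
      funext y
      by_cases hy : y = x
      · subst hy; simp
      · simp [hy]
    have hrel := choose_prod_update (Function.update n x (n x + 1)) x (n x) (by simp) hle
    rw [Function.update_idem, Function.update_eq_self] at hrel
    rw [he]
    have hA := choose_prod_pos h
    have hB := choose_prod_pos h'
    set A := ∏ y, (N.choose (n y) : ℝ)
    set B := ∏ y, (N.choose (Function.update n x (n x + 1) y) : ℝ)
    have hr : (raising N)ᵀ ⟨n x, h x⟩ ⟨n x + 1, by omega⟩ =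
        Real.sqrt (((n x : ℝ) + 1) * (N - n x)) := by
      simp [raising]
    rw [hr]
    have hNk : (0 : ℝ) ≤ N - n x := by
      have : (n x : ℝ) < N := by exact_mod_cast hlt
      linarith
    have hsq : Real.sqrt (((n x : ℝ) + 1) * (N - n x)) * Real.sqrt B = (N - n x) * Real.sqrt A := by
      rw [← Real.sqrt_mul (by positivity),
        show ((n x : ℝ) + 1) * (N - n x) * B = (N - n x) ^ 2 * A by
        linear_combination (N - n x : ℝ) * hrel, Real.sqrt_mul (by positivity),
        Real.sqrt_sq hNk]
    have hA' := Real.sqrt_pos.mpr hA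
    have hB' := Real.sqrt_pos.mpr hB
    field_simp
    linear_combination ψ (fun y => ⟨Function.update n x (n x + 1) y, h' y⟩) * hsq
  · intro p _ hp
    have : ¬ ((p : ℕ) = n x + 1) := fun hc => hp (Fin.ext (by simp; omega))
    simp [raising, this]
  · simp

lemma amp_spinZ (ψ : (Fin L → Fin (N + 1)) → ℝ) (x : Fin L) {n : Fin L → ℕ}
    (h : ∀ y, n y < N + 1) :
    amp (onSite x (spinZ N) *ᵥ ψ) n = ((n x : ℝ) - N / 2) * amp ψ n := by
  rw [amp_of_le _ h, amp_of_le _ h, onSite_mulVec, Finset.sum_eq_single ⟨n x, h x⟩]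
  · have : Function.update (fun y => (⟨n y, h y⟩ : Fin (N + 1))) x ⟨n x, h x⟩ =
      fun y => ⟨n y, h y⟩ := Function.update_eq_self x _
    rw [this, spinZ, diagonal_apply_eq, mul_div_assoc]
  · intro p _ hp
    rw [spinZ, diagonal_apply_ne _ hp.symm, zero_mul]
  · simp

/-- The configuration obtained by moving one particle from `x` to `y`. -/
def move (n : Fin L → ℕ) (x y : Fin L) : Fin L → ℕ :=
  Function.update (Function.update n x (n x - 1)) y (n y + 1)

/-- Default values are harmless: when `n x = 0` the truncated `n x - 1` in `move` comes with the
factor `n x = 0`, and when `n y = N` the amplitude outside the allowed range comes with the factor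
`N - n y = 0`. -/
lemma amp_bond (ψ : (Fin L → Fin (N + 1)) → ℝ) {x y : Fin L} (hxy : x ≠ y) {n : Fin L → ℕ}
    (h : ∀ y, n y < N + 1) :
    amp (bond N x y *ᵥ ψ) n =
      (1 / 2) * ((n x : ℝ) * (N - n y) * (amp ψ n - amp ψ (move n x y)) +
        (n y : ℝ) * (N - n x) * (amp ψ n - amp ψ (move n y x))) := by
  have hle : ∀ y, (n y : ℕ) ≤ N := fun y => Nat.lt_succ_iff.mp (h y)
  have hd : ∀ (x y : Fin L), y ≠ x → amp (onSite x (raising N) *ᵥ (onSite y (raising N)ᵀ *ᵥ ψ)) n =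
      (n x : ℝ) * (N - n y) * amp ψ (move n x y) := by
    intro x y hyx
    have h' : ∀ z, Function.update n x (n x - 1) z < N + 1 := by
      intro z
      by_cases hz : z = x
      · subst hz; simp; have := h z; omega
      · simpa [hz] using h z
    rw [amp_raising _ _ h, amp_lowering _ _ h', Function.update_of_ne hyx, mul_assoc]
    rfl
  have hyx := hxy.symm
  rw [bond, onSite_comm hxy (raising N)ᵀ]
  simp only [sub_mulVec, add_mulVec, smul_mulVec, one_mulVec, amp_sub, amp_add, amp_smul,
    ← mulVec_mulVec, hd x y hyx, hd y x hxy, amp_spinZ _ _ h]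
  ring

/-- Occupation numbers of a labelled configuration of particles on `Fin L × Fin N`. -/
def occ {k : ℕ} (Z : Fin k → Fin L × Fin N) (x : Fin L) : ℕ :=
  (Finset.univ.filter fun l => (Z l).1 = x).card

lemma occ_eq_sum {k : ℕ} (Z : Fin k → Fin L × Fin N) (x : Fin L) :
    occ Z x = ∑ l, if (Z l).1 = x then 1 else 0 := by
  rw [occ, Finset.card_filter]

/-- The lift of `ψ` to functions of `k` labelled particles on `Fin L × Fin N`. -/
def lift (ψ : (Fin L → Fin (N + 1)) → ℝ) (k : ℕ) (Z : Fin k → Fin L × Fin N) : ℝ :=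
  if Function.Injective Z then amp ψ (occ Z) else 0

lemma occ_eq_card {k : ℕ} {Z : Fin k → Fin L × Fin N} (hZ : Function.Injective Z) (x : Fin L) :
    occ Z x = (Finset.univ.filter fun i : Fin N => ∃ l, Z l = (x, i)).card := by
  rw [occ]
  refine Finset.card_bij (fun l _ => (Z l).2) ?_ ?_ ?_
  · intro l hl
    simp only [Finset.mem_filter, Finset.mem_univ, true_and] at hl ⊢
    exact ⟨l, by rw [← hl]⟩
  · intro l hl m hm hlm
    simp only [Finset.mem_filter, Finset.mem_univ, true_and] at hl hm
    exact hZ (Prod.ext (hl.trans hm.symm) hlm)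
  · intro i hi
    simp only [Finset.mem_filter, Finset.mem_univ, true_and] at hi
    obtain ⟨l, hl⟩ := hi
    exact ⟨l, by simp [hl], by simp [hl]⟩

lemma occ_le {k : ℕ} {Z : Fin k → Fin L × Fin N} (hZ : Function.Injective Z) (x : Fin L) :
    occ Z x < N + 1 := by
  rw [occ_eq_card hZ, Nat.lt_succ_iff]
  exact (Finset.card_le_univ _).trans (by simp)

lemma occ_comp_perm {k : ℕ} (Z : Fin k → Fin L × Fin N) (π : Equiv.Perm (Fin k)) :
    occ (Z ∘ π) = occ Z := by
  funext x
  rw [occ_eq_sum, occ_eq_sum]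
  exact Equiv.sum_comp π fun l => if (Z l).1 = x then 1 else 0

lemma lift_comp_perm (ψ : (Fin L → Fin (N + 1)) → ℝ) {k : ℕ} (Z : Fin k → Fin L × Fin N)
    (π : Equiv.Perm (Fin k)) : lift ψ k (Z ∘ π) = lift ψ k Z := by
  simp only [lift, occ_comp_perm, EquivLike.injective_comp]

lemma occ_update {k : ℕ} (Z : Fin k → Fin L × Fin N) (l : Fin k) (b : Fin L × Fin N)
    (hb : (Z l).1 ≠ b.1) : occ (Function.update Z l b) = move (occ Z) (Z l).1 b.1 := by
  have key : ∀ x, occ (Function.update Z l b) x + (if (Z l).1 = x then 1 else 0) =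
      occ Z x + (if b.1 = x then 1 else 0) := by
    intro x
    rw [occ_eq_sum, occ_eq_sum, ← Finset.add_sum_erase _ _ (Finset.mem_univ l),
      ← Finset.add_sum_erase _ (fun m => if (Z m).1 = x then 1 else 0) (Finset.mem_univ l)]
    have : ∑ m ∈ Finset.univ.erase l, (if (Function.update Z l b m).1 = x then 1 else 0) =
        ∑ m ∈ Finset.univ.erase l, (if (Z m).1 = x then 1 else 0) := by
      refine Finset.sum_congr rfl fun m hm => ?_
      rw [Function.update_of_ne (Finset.ne_of_mem_erase hm)]
    rw [this, Function.update_self]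
    ring
  funext x
  have hx := key x
  by_cases h1 : x = b.1
  · subst h1
    simp only [hb, if_false, if_true, add_zero] at hx
    simp [move, hx]
  · by_cases h2 : x = (Z l).1
    · subst h2
      simp only [hb.symm, if_false, if_true, add_zero] at hx
      simp [move, h1]
      omega
    · simp only [Ne.symm h1, Ne.symm h2, if_false, add_zero] at hx
      simp [move, h1, h2, hx]

lemma swap_comp_eq_update {k : ℕ} {Z : Fin k → Fin L × Fin N} (hZ : Function.Injective Z)
    (l : Fin k) (b : Fin L × Fin N) (hb : ∀ m, Z m ≠ b) :
    Equiv.swap (Z l) b ∘ Z = Function.update Z l b := by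
  funext m
  by_cases hm : m = l
  · subst hm; simp
  · rw [Function.update_of_ne hm]
    exact Equiv.swap_apply_of_ne_of_ne (fun h => hm (hZ h)) (hb m)

lemma swap_comp_eq_comp_swap {k : ℕ} {Z : Fin k → Fin L × Fin N} (hZ : Function.Injective Z)
    (l m : Fin k) : Equiv.swap (Z l) (Z m) ∘ Z = Z ∘ Equiv.swap l m := by
  funext a
  exact (hZ.map_swap l m a).symm

lemma swap_comp_eq_self {k : ℕ} {Z : Fin k → Fin L × Fin N} (a b : Fin L × Fin N)
    (ha : ∀ m, Z m ≠ a) (hb : ∀ m, Z m ≠ b) : Equiv.swap a b ∘ Z = Z := by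
  funext m
  exact Equiv.swap_apply_of_ne_of_ne (ha m) (hb m)

/-- Exchanging two occupied points permutes labels, which `lift` ignores, and exchanging two empty
points changes nothing. Only exchanges of an occupied with an empty point contribute, and these move
one particle. -/
lemma lift_sub_lift_swap (ψ : (Fin L → Fin (N + 1)) → ℝ) {k : ℕ} {Z : Fin k → Fin L × Fin N}
    (hZ : Function.Injective Z) {a b : Fin L × Fin N} (hab : a.1 ≠ b.1) :
    lift ψ k Z - lift ψ k (Equiv.swap a b ∘ Z) =
      (if (∃ l, Z l = a) ∧ ¬ ∃ l, Z l = b then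
        amp ψ (occ Z) - amp ψ (move (occ Z) a.1 b.1) else 0) +
      (if (¬ ∃ l, Z l = a) ∧ ∃ l, Z l = b then
        amp ψ (occ Z) - amp ψ (move (occ Z) b.1 a.1) else 0) := by
  have hinj : Function.Injective (Equiv.swap a b ∘ Z) := (Equiv.swap a b).injective.comp hZ
  by_cases ha : ∃ l, Z l = a
  · obtain ⟨l, rfl⟩ := ha
    by_cases hb : ∃ m, Z m = b
    · obtain ⟨m, rfl⟩ := hb
      rw [swap_comp_eq_comp_swap hZ, lift_comp_perm]
      simp
    · have hb' : ∀ m, Z m ≠ b := fun m h => hb ⟨m, h⟩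
      rw [lift, lift, if_pos hZ, if_pos hinj, swap_comp_eq_update hZ l b hb', occ_update Z l b hab]
      simp [hb]
  · have ha' : ∀ m, Z m ≠ a := fun m h => ha ⟨m, h⟩
    by_cases hb : ∃ m, Z m = b
    · obtain ⟨m, rfl⟩ := hb
      rw [lift, lift, if_pos hZ, if_pos hinj, Equiv.swap_comm, swap_comp_eq_update hZ m a ha',
        occ_update Z m a hab.symm]
      simp [ha]
    · have hb' : ∀ m, Z m ≠ b := fun m h => hb ⟨m, h⟩
      rw [swap_comp_eq_self a b ha' hb']
      simp [ha, hb]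

lemma card_not_occ {k : ℕ} {Z : Fin k → Fin L × Fin N} (hZ : Function.Injective Z) (x : Fin L) :
    ((Finset.univ.filter fun i : Fin N => ¬ ∃ l, Z l = (x, i)).card : ℝ) = N - occ Z x := by
  have h := Finset.card_filter_add_card_filter_not (s := (Finset.univ : Finset (Fin N)))
    (fun i => ∃ l, Z l = (x, i))
  rw [← occ_eq_card hZ] at h
  have h' : (occ Z x : ℝ) + (Finset.univ.filter fun i : Fin N => ¬ ∃ l, Z l = (x, i)).card = N := by
    exact_mod_cast h.trans (by simp)
  linarith

/-- The bond operator acts on lifts as a sum of `1 - transposition`. -/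
theorem lift_bond (ψ : (Fin L → Fin (N + 1)) → ℝ) {x y : Fin L} (hxy : x ≠ y) {k : ℕ}
    (Z : Fin k → Fin L × Fin N) :
    lift (bond N x y *ᵥ ψ) k Z = (1 / 2) * ∑ i : Fin N, ∑ j : Fin N,
      (lift ψ k Z - lift ψ k (Equiv.swap (x, i) (y, j) ∘ Z)) := by
  by_cases hZ : Function.Injective Z
  · rw [lift, if_pos hZ, amp_bond ψ hxy (occ_le hZ)]
    congr 1
    -- Summed over the colours, the indicators count the pairs of an occupied point at one site and
    -- an empty point at the other; these numbers are the coefficients in `amp_bond`.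
    have : ∀ i j : Fin N, lift ψ k Z - lift ψ k (Equiv.swap (x, i) (y, j) ∘ Z) =
        (if ∃ l, Z l = (x, i) then (1 : ℝ) else 0) * (if ¬ ∃ l, Z l = (y, j) then 1 else 0) *
          (amp ψ (occ Z) - amp ψ (move (occ Z) x y)) +
        (if ¬ ∃ l, Z l = (x, i) then (1 : ℝ) else 0) * (if ∃ l, Z l = (y, j) then 1 else 0) *
          (amp ψ (occ Z) - amp ψ (move (occ Z) y x)) := by
      intro i j
      rw [lift_sub_lift_swap ψ hZ hxy]
      by_cases h1 : ∃ l, Z l = (x, i) <;> by_cases h2 : ∃ l, Z l = (y, j) <;> simp [h1, h2]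
    simp only [this, Finset.sum_add_distrib, ← Finset.sum_mul, ← Finset.mul_sum, Finset.sum_boole]
    rw [card_not_occ hZ, card_not_occ hZ, ← occ_eq_card hZ, ← occ_eq_card hZ]
    ring
  · have h : ∀ τ : Equiv.Perm (Fin L × Fin N), ¬ Function.Injective (τ ∘ Z) := fun τ h =>
      hZ (Function.Injective.of_comp h)
    simp [lift, hZ]

/-- The total lowering operator. -/
def lowering (L N : ℕ) : Matrix (Fin L → Fin (N + 1)) (Fin L → Fin (N + 1)) ℝ :=
  ∑ x, onSite x (raising N)ᵀ

lemma occ_cons {k : ℕ} (Z : Fin k → Fin L × Fin N) (z : Fin L × Fin N) :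
    occ (Fin.cons z Z : Fin (k + 1) → Fin L × Fin N) =
      Function.update (occ Z) z.1 (occ Z z.1 + 1) := by
  funext x
  rw [occ_eq_sum, Fin.sum_univ_succ]
  simp only [Fin.cons_zero, Fin.cons_succ]
  rw [← occ_eq_sum]
  by_cases hx : x = z.1
  · subst hx; simp [add_comm]
  · simp [hx, Ne.symm hx]

/-- Lowering removes one particle, so it sums out the position of the particle with label 0; the
factor `N - n x` of `amp_lowering` counts the empty colours at `x`. -/
theorem lift_lowering (ψ : (Fin L → Fin (N + 1)) → ℝ) (k : ℕ) (Z : Fin k → Fin L × Fin N) :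
    lift (lowering L N *ᵥ ψ) k Z = ∑ z, lift ψ (k + 1) (Fin.cons z Z) := by
  by_cases hZ : Function.Injective Z
  · rw [lift, if_pos hZ, lowering, Matrix.sum_mulVec, amp_sum, Fintype.sum_prod_type]
    refine Finset.sum_congr rfl fun x _ => ?_
    rw [amp_lowering _ _ (occ_le hZ), ← card_not_occ hZ, Finset.card_filter, Nat.cast_sum,
      Finset.sum_mul]
    refine Finset.sum_congr rfl fun i _ => ?_
    rw [lift, occ_cons]
    simp [hZ, Fin.cons_injective_iff]
  · have : ∀ z, ¬ Function.Injective (Fin.cons z Z : Fin (k + 1) → Fin L × Fin N) := by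
      intro z h
      exact hZ (Fin.cons_injective_iff.mp h).2
    simp [lift, hZ, this]

end Real

end

end Heisenberg

namespace Heisenberg

noncomputable section

open Matrix

/-! ### Sectors of fixed particle number and Dirichlet forms. -/

section Sectors

variable {L N : ℕ}

/-- Number of particles of a configuration. -/
def total (σ : Fin L → Fin (N + 1)) : ℕ := ∑ x, (σ x : ℕ)

lemma total_le (σ : Fin L → Fin (N + 1)) : total σ ≤ N * L := by
  calc total σ ≤ ∑ _x : Fin L, N := Finset.sum_le_sum fun x _ => Nat.lt_succ_iff.mp (σ x).2
    _ = N * L := by simp [mul_comm]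

lemma sum_occ {k : ℕ} (Z : Fin k → Fin L × Fin N) : ∑ x, occ Z x = k := by
  simp only [occ_eq_sum]
  rw [Finset.sum_comm]
  simp

lemma sum_update_succ (n : Fin L → ℕ) (x : Fin L) (a : ℕ) :
    ∑ y, Function.update n x a y + n x = ∑ y, n y + a := by
  rw [← Finset.add_sum_erase _ _ (Finset.mem_univ x), ← Finset.add_sum_erase _ n (Finset.mem_univ x),
    Function.update_self]
  have : ∑ y ∈ Finset.univ.erase x, Function.update n x a y = ∑ y ∈ Finset.univ.erase x, n y :=
    Finset.sum_congr rfl fun y hy => Function.update_of_ne (Finset.ne_of_mem_erase hy) _ _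
  omega

/-- The `ℕ`-valued configurations with `k` particles and at most `N` particles per site. -/
def natSector (L N k : ℕ) : Finset (Fin L → ℕ) :=
  (Fintype.piFinset fun _ => Finset.range (N + 1)).filter fun n => ∑ x, n x = k

lemma mem_natSector {k : ℕ} {n : Fin L → ℕ} :
    n ∈ natSector L N k ↔ (∀ x, n x < N + 1) ∧ ∑ x, n x = k := by
  simp [natSector]

lemma sum_natSector (k : ℕ) (F : (Fin L → ℕ) → ℝ) :
    ∑ n ∈ natSector L N k, F n =
      ∑ σ : Fin L → Fin (N + 1) with total σ = k, F fun x => (σ x : ℕ) := by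
  symm
  refine Finset.sum_bij (fun σ _ x => (σ x : ℕ)) ?_ ?_ ?_ ?_
  · intro σ hσ
    rw [mem_natSector]
    exact ⟨fun x => (σ x).2, (Finset.mem_filter.mp hσ).2⟩
  · intro σ _ τ _ h
    funext x
    exact Fin.ext (congrFun h x)
  · intro n hn
    rw [mem_natSector] at hn
    exact ⟨fun x => ⟨n x, hn.1 x⟩, Finset.mem_filter.mpr ⟨Finset.mem_univ _, hn.2⟩, rfl⟩
  · intros; rfl

/-- One particle is added at `x`, by the identity `(N - n) choose(N, n) = (n + 1) choose(N, n + 1)`.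
The shift is a bijection only between nonvanishing terms: those with `n x = N` on the left and with
`n x = 0` on the right drop out. -/
lemma sum_natSector_succ (k : ℕ) (x : Fin L) (F : (Fin L → ℕ) → ℝ) :
    ∑ n ∈ natSector L N k, (∏ y, (N.choose (n y) : ℝ)) *
        (((N : ℝ) - n x) * F (Function.update n x (n x + 1))) =
      ∑ n ∈ natSector L N (k + 1), (n x : ℝ) * ((∏ y, (N.choose (n y) : ℝ)) * F n) := by
  refine Finset.sum_bij_ne_zero (fun n _ _ => Function.update n x (n x + 1)) ?_ ?_ ?_ ?_
  · intro n hn h0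
    rw [mem_natSector] at hn ⊢
    refine ⟨fun y => ?_, ?_⟩
    · by_cases hy : y = x
      · subst hy
        have h1 : n y ≠ N := by
          rintro h
          apply h0
          simp [h]
        have := hn.1 y
        simp
        omega
      · simpa [hy] using hn.1 y
    · have := sum_update_succ n x (n x + 1)
      omega
  · intro n hn _ m hm _ h
    have hx := congrFun h x
    simp only [Function.update_self, add_left_inj] at hx
    funext y
    by_cases hy : y = x
    · subst hy; exact hx
    · simpa [hy] using congrFun h y
  · intro n hn h0
    have hpos : n x ≠ 0 := by
      rintro h
      apply h0
      simp [h]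
    rw [mem_natSector] at hn
    have h1 := sum_update_succ n x (n x - 1)
    have hmem : Function.update n x (n x - 1) ∈ natSector L N k := by
      rw [mem_natSector]
      refine ⟨fun y => ?_, by omega⟩
      by_cases hy : y = x
      · subst hy; have := hn.1 y; simp; omega
      · simpa [hy] using hn.1 y
    have heq : Function.update (Function.update n x (n x - 1)) x
        (Function.update n x (n x - 1) x + 1) = n := by
      rw [Function.update_self, Function.update_idem, Nat.sub_add_cancel (Nat.pos_of_ne_zero hpos),
        Function.update_eq_self]
    have hrel := choose_prod_update (N := N) n x (n x - 1) (by omega) (by have := hn.1 x; omega)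
    have hc : ((n x - 1 : ℕ) : ℝ) + 1 = n x := by
      exact_mod_cast Nat.sub_add_cancel (Nat.pos_of_ne_zero hpos)
    refine ⟨_, hmem, ?_, heq⟩
    rw [heq, Function.update_self, ← mul_assoc, ← hrel, hc]
    intro h
    apply h0
    linear_combination h
  · intro n hn h0
    rw [mem_natSector] at hn
    have hrel := choose_prod_update (N := N) (Function.update n x (n x + 1)) x (n x) (by simp)
      (Nat.lt_succ_iff.mp (hn.1 x))
    rw [Function.update_idem, Function.update_eq_self] at hrel
    rw [Function.update_self]
    push_cast
    linear_combination (-F (Function.update n x (n x + 1))) * hrel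

lemma sum_lift_cons (k : ℕ) (F : (Fin L → ℕ) → ℝ) :
    ∑ Z : Fin (k + 1) → Fin L × Fin N, (if Function.Injective Z then F (occ Z) else 0) =
      ∑ Z : Fin k → Fin L × Fin N, if Function.Injective Z then
        ∑ x, ((N : ℝ) - occ Z x) * F (Function.update (occ Z) x (occ Z x + 1)) else 0 := by
  rw [← (Fin.consEquiv fun _ => Fin L × Fin N).sum_comp, Fintype.sum_prod_type_right]
  refine Finset.sum_congr rfl fun Z _ => ?_
  by_cases hZ : Function.Injective Z
  · rw [if_pos hZ, Fintype.sum_prod_type]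
    refine Finset.sum_congr rfl fun x _ => ?_
    rw [← card_not_occ hZ, Finset.card_filter, Nat.cast_sum, Finset.sum_mul]
    refine Finset.sum_congr rfl fun i _ => ?_
    simp [Fin.consEquiv, hZ, Fin.cons_injective_iff, occ_cons]
  · rw [if_neg hZ]
    refine Finset.sum_eq_zero fun z _ => ?_
    simp [Fin.consEquiv, hZ, Fin.cons_injective_iff]

/-- Counting labelled configurations by their occupation numbers. -/
theorem sum_occ_eq (k : ℕ) (F : (Fin L → ℕ) → ℝ) :
    ∑ Z : Fin k → Fin L × Fin N, (if Function.Injective Z then F (occ Z) else 0) =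
      k.factorial * ∑ n ∈ natSector L N k, (∏ y, (N.choose (n y) : ℝ)) * F n := by
  induction k generalizing F with
  | zero =>
    have h0 : natSector L N 0 = {fun _ => 0} := by
      ext n
      rw [mem_natSector, Finset.mem_singleton]
      constructor
      · rintro ⟨_, h⟩
        funext x
        exact (Finset.sum_eq_zero_iff.mp h) x (Finset.mem_univ x)
      · rintro rfl
        simp
    have h1 : occ (default : Fin 0 → Fin L × Fin N) = fun _ => 0 := by
      funext x
      simp [occ]
    rw [h0, Fintype.sum_unique, h1]
    simp [Function.injective_of_subsingleton]
  | succ k ih =>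
    rw [sum_lift_cons, ih fun n => ∑ x, ((N : ℝ) - n x) * F (Function.update n x (n x + 1))]
    simp only [Finset.mul_sum]
    rw [Finset.sum_comm]
    have h1 : ∀ x : Fin L, ∑ n ∈ natSector L N k, (k.factorial : ℝ) *
        ((∏ y, (N.choose (n y) : ℝ)) * (((N : ℝ) - n x) * F (Function.update n x (n x + 1)))) =
        ∑ n ∈ natSector L N (k + 1),
          (k.factorial : ℝ) * ((n x : ℝ) * ((∏ y, (N.choose (n y) : ℝ)) * F n)) := by
      intro x
      rw [← Finset.mul_sum, sum_natSector_succ, Finset.mul_sum]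
    rw [Finset.sum_congr rfl fun x _ => h1 x, Finset.sum_comm]
    refine Finset.sum_congr rfl fun n hn => ?_
    -- The occupation numbers add up to `k + 1`, which turns `k!` into `(k + 1)!`.
    rw [← Finset.mul_sum, ← Finset.sum_mul, ← Nat.cast_sum, (mem_natSector.mp hn).2,
      Nat.factorial_succ]
    push_cast
    ring

/-- An occupation pattern comes from `k! ∏ choose(N, n x)` labelled configurations, and the
binomials cancel those in `amp`. So lifting a sector is an isometry up to the factor `k!`. -/
theorem sum_lift_mul_lift (ψ φ : (Fin L → Fin (N + 1)) → ℝ) (k : ℕ) :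
    ∑ Z, lift ψ k Z * lift φ k Z =
      k.factorial * ∑ σ : Fin L → Fin (N + 1) with total σ = k, ψ σ * φ σ := by
  have h1 : ∀ Z : Fin k → Fin L × Fin N, lift ψ k Z * lift φ k Z =
      if Function.Injective Z then (fun n => amp ψ n * amp φ n) (occ Z) else 0 := by
    intro Z
    unfold lift
    split_ifs <;> simp
  rw [Finset.sum_congr rfl fun Z _ => h1 Z, sum_occ_eq k fun n => amp ψ n * amp φ n, sum_natSector]
  congr 1
  refine Finset.sum_congr rfl fun σ _ => ?_
  have h : ∀ x, (σ x : ℕ) < N + 1 := fun x => (σ x).2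
  have hp := choose_prod_pos h
  rw [amp_of_le _ h, amp_of_le _ h, div_mul_div_comm, Real.mul_self_sqrt hp.le]
  simp only [Fin.eta]
  field_simp

/-- Dirichlet form of the transposition of `a` and `b`. -/
def hopEnergy {k : ℕ} (f : (Fin k → Fin L × Fin N) → ℝ) (a b : Fin L × Fin N) : ℝ :=
  ∑ Z, (f Z - f (Equiv.swap a b ∘ Z)) ^ 2

/-- Dirichlet form of all transpositions between two sites. -/
def layerEnergy {k : ℕ} (f : (Fin k → Fin L × Fin N) → ℝ) (x y : Fin L) : ℝ :=
  ∑ i, ∑ j, hopEnergy f (x, i) (y, j)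

/-- Dirichlet form of the chain. -/
def chainEnergy {k : ℕ} (f : (Fin k → Fin L × Fin N) → ℝ) : ℝ :=
  ∑ x : Fin L, ∑ y : Fin L, if (x : ℕ) + 1 = (y : ℕ) then layerEnergy f x y else 0

lemma hopEnergy_nonneg {k : ℕ} (f : (Fin k → Fin L × Fin N) → ℝ) (a b : Fin L × Fin N) :
    0 ≤ hopEnergy f a b := Finset.sum_nonneg fun _ _ => sq_nonneg _

lemma layerEnergy_nonneg {k : ℕ} (f : (Fin k → Fin L × Fin N) → ℝ) (x y : Fin L) :
    0 ≤ layerEnergy f x y :=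
  Finset.sum_nonneg fun _ _ => Finset.sum_nonneg fun _ _ => hopEnergy_nonneg f _ _

lemma sum_comp_perm {k : ℕ} (f : (Fin k → Fin L × Fin N) → ℝ) (π : Equiv.Perm (Fin L × Fin N)) :
    ∑ Z, f (π ∘ Z) = ∑ Z, f Z :=
  Equiv.sum_comp (Equiv.arrowCongr (Equiv.refl (Fin k)) π) f

lemma swap_comp_swap_comp {k : ℕ} (a b : Fin L × Fin N) (Z : Fin k → Fin L × Fin N) :
    Equiv.swap a b ∘ (Equiv.swap a b ∘ Z) = Z := by
  funext l
  simp

/-- A transposition is an involution preserving the sum over configurations, so the form can be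
symmetrised. -/
lemma sum_mul_sub_swap {k : ℕ} (f : (Fin k → Fin L × Fin N) → ℝ) (a b : Fin L × Fin N) :
    ∑ Z, f Z * (f Z - f (Equiv.swap a b ∘ Z)) = (1 / 2) * hopEnergy f a b := by
  have h := sum_comp_perm (fun Z => f Z * (f Z - f (Equiv.swap a b ∘ Z))) (Equiv.swap a b)
  simp only [swap_comp_swap_comp] at h
  have h2 : hopEnergy f a b = ∑ Z, f Z * (f Z - f (Equiv.swap a b ∘ Z)) +
      ∑ Z, f (Equiv.swap a b ∘ Z) * (f (Equiv.swap a b ∘ Z) - f Z) := by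
    rw [hopEnergy, ← Finset.sum_add_distrib]
    exact Finset.sum_congr rfl fun Z _ => by ring
  rw [h2, h]
  ring

lemma sum_lift_bond (ψ : (Fin L → Fin (N + 1)) → ℝ) (k : ℕ) {x y : Fin L} (hxy : x ≠ y) :
    ∑ Z, lift ψ k Z * lift (bond N x y *ᵥ ψ) k Z = (1 / 4) * layerEnergy (lift ψ k) x y := by
  simp only [lift_bond ψ hxy, layerEnergy, Finset.mul_sum]
  rw [Finset.sum_comm]
  refine Finset.sum_congr rfl fun i _ => ?_
  rw [Finset.sum_comm]
  refine Finset.sum_congr rfl fun j _ => ?_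
  have := sum_mul_sub_swap (lift ψ k) (x, i) (y, j)
  rw [show (1 / 4 : ℝ) * hopEnergy (lift ψ k) (x, i) (y, j) =
    (1 / 2) * ((1 / 2) * hopEnergy (lift ψ k) (x, i) (y, j)) by ring, ← this, Finset.mul_sum]
  exact Finset.sum_congr rfl fun Z _ => by ring

lemma lift_add (ψ φ : (Fin L → Fin (N + 1)) → ℝ) (k : ℕ) (Z : Fin k → Fin L × Fin N) :
    lift (ψ + φ) k Z = lift ψ k Z + lift φ k Z := by
  unfold lift
  split_ifs
  · exact amp_add _ _ _
  · simp

lemma lift_sub (ψ φ : (Fin L → Fin (N + 1)) → ℝ) (k : ℕ) (Z : Fin k → Fin L × Fin N) :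
    lift (ψ - φ) k Z = lift ψ k Z - lift φ k Z := by
  unfold lift
  split_ifs
  · exact amp_sub _ _ _
  · simp

lemma lift_smul (c : ℝ) (ψ : (Fin L → Fin (N + 1)) → ℝ) (k : ℕ) (Z : Fin k → Fin L × Fin N) :
    lift (c • ψ) k Z = c * lift ψ k Z := by
  unfold lift
  split_ifs
  · exact amp_smul _ _ _
  · simp

lemma lift_sum {α : Type*} (s : Finset α) (ψ : α → (Fin L → Fin (N + 1)) → ℝ) (k : ℕ)
    (Z : Fin k → Fin L × Fin N) : lift (∑ a ∈ s, ψ a) k Z = ∑ a ∈ s, lift (ψ a) k Z := by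
  unfold lift
  split_ifs
  · exact amp_sum _ _ _
  · simp

lemma lift_zero (k : ℕ) (Z : Fin k → Fin L × Fin N) :
    lift (0 : (Fin L → Fin (N + 1)) → ℝ) k Z = 0 := by
  have := lift_smul 0 (0 : (Fin L → Fin (N + 1)) → ℝ) k Z
  simpa using this

/-- The action of the Hamiltonian on functions of labelled particles. -/
def labelledHam {k : ℕ} (f : (Fin k → Fin L × Fin N) → ℝ) (Z : Fin k → Fin L × Fin N) : ℝ :=
  ∑ x : Fin L, ∑ y : Fin L, if (x : ℕ) + 1 = (y : ℕ) then
    (1 / 2) * ∑ i : Fin N, ∑ j : Fin N, (f Z - f (Equiv.swap (x, i) (y, j) ∘ Z)) else 0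

lemma lift_realHam (ψ : (Fin L → Fin (N + 1)) → ℝ) (k : ℕ) :
    lift (realHam L N *ᵥ ψ) k = labelledHam (lift ψ k) := by
  funext Z
  simp only [realHam, Matrix.sum_mulVec, lift_sum, labelledHam]
  refine Finset.sum_congr rfl fun x _ => Finset.sum_congr rfl fun y _ => ?_
  split_ifs with h
  · exact lift_bond ψ (ne_of_adj h) Z
  · rw [zero_mulVec, lift_zero]

lemma sum_lift_realHam (ψ : (Fin L → Fin (N + 1)) → ℝ) (k : ℕ) :
    ∑ Z, lift ψ k Z * lift (realHam L N *ᵥ ψ) k Z = (1 / 4) * chainEnergy (lift ψ k) := by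
  simp only [realHam, Matrix.sum_mulVec, lift_sum, chainEnergy, Finset.mul_sum]
  rw [Finset.sum_comm]
  refine Finset.sum_congr rfl fun x _ => ?_
  rw [Finset.sum_comm]
  refine Finset.sum_congr rfl fun y _ => ?_
  split_ifs with h
  · exact sum_lift_bond ψ k (ne_of_adj h)
  · simp [zero_mulVec, lift_zero]

lemma dotProduct_eq_sum_sectors (ψ φ : (Fin L → Fin (N + 1)) → ℝ) :
    ψ ⬝ᵥ φ = ∑ k ∈ Finset.range (N * L + 1),
      (1 / (k.factorial : ℝ)) * ∑ Z, lift ψ k Z * lift φ k Z := by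
  have hm : ∀ σ ∈ (Finset.univ : Finset (Fin L → Fin (N + 1))),
      total σ ∈ Finset.range (N * L + 1) := fun σ _ =>
    Finset.mem_range.mpr (Nat.lt_succ_iff.mpr (total_le σ))
  rw [dotProduct, ← Finset.sum_fiberwise_of_maps_to hm]
  refine Finset.sum_congr rfl fun k _ => ?_
  rw [sum_lift_mul_lift]
  have : (k.factorial : ℝ) ≠ 0 := by exact_mod_cast k.factorial_ne_zero
  field_simp

lemma bond_nonneg (ψ : (Fin L → Fin (N + 1)) → ℝ) {x y : Fin L} (hxy : x ≠ y) :
    0 ≤ ψ ⬝ᵥ bond N x y *ᵥ ψ := by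
  rw [dotProduct_eq_sum_sectors]
  refine Finset.sum_nonneg fun k _ => mul_nonneg (by positivity) ?_
  rw [sum_lift_bond ψ k hxy]
  exact mul_nonneg (by norm_num) (layerEnergy_nonneg _ _ _)

/-- Configurations with `k` particles. -/
abbrev Sector (L N k : ℕ) : Type := {σ : Fin L → Fin (N + 1) // total σ = k}

/-- The Hamiltonian in the sector with `k` particles. -/
def sectorHam (L N k : ℕ) : Matrix (Sector L N k) (Sector L N k) ℝ :=
  (realHam L N).submatrix Subtype.val Subtype.val

lemma sectorHam_isHermitian (L N k : ℕ) : (sectorHam L N k).IsHermitian :=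
  realHam_isHermitian.submatrix _

lemma amp_single_ne_zero {τ : Fin L → Fin (N + 1)} {n : Fin L → ℕ}
    (h : amp (Pi.single τ 1) n ≠ 0) : ∑ x, n x = total τ := by
  unfold amp at h
  split_ifs at h with hn
  · have : (fun x => (⟨n x, hn x⟩ : Fin (N + 1))) = τ := by
      by_contra hne
      apply h
      rw [Pi.single_eq_of_ne hne, zero_div]
    rw [← this, total]
  · exact absurd rfl h

lemma sum_move {n : Fin L → ℕ} {x y : Fin L} (hxy : x ≠ y) (hx : n x ≠ 0) :
    ∑ z, move n x y z = ∑ z, n z := by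
  have h1 := sum_update_succ n x (n x - 1)
  have h2 := sum_update_succ (Function.update n x (n x - 1)) y (n y + 1)
  rw [Function.update_of_ne hxy.symm] at h2
  unfold move
  omega

/-- `amp_bond`, applied to a basis vector, involves only configurations obtained by moving a
particle, and moves keep the particle number. -/
lemma bond_apply_eq_zero {x y : Fin L} (hxy : x ≠ y) {σ τ : Fin L → Fin (N + 1)}
    (h : total σ ≠ total τ) : bond N x y σ τ = 0 := by
  have hn : ∀ x, (σ x : ℕ) < N + 1 := fun x => (σ x).2
  have h1 := amp_bond (Pi.single τ 1) hxy hn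
  have h2 : amp (Pi.single τ 1) (fun x => (σ x : ℕ)) = 0 := by
    by_contra hc
    exact h (amp_single_ne_zero hc)
  have hmove : ∀ x y : Fin L, x ≠ y → ((σ x : ℕ) : ℝ) * (N - (σ y : ℕ)) *
      (0 - amp (Pi.single τ 1) (move (fun x => (σ x : ℕ)) x y)) = 0 := by
    intro x y hxy
    by_cases h0 : (σ x : ℕ) = 0
    · rw [h0]; simp
    · have : amp (Pi.single τ 1) (move (fun x => (σ x : ℕ)) x y) = 0 := by
        by_contra hc
        have := amp_single_ne_zero hc
        rw [sum_move hxy h0] at this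
        exact h this
      rw [this]; simp
  rw [h2, hmove x y hxy, hmove y x hxy.symm, amp_of_le _ hn, mulVec_single_one] at h1
  have hp := Real.sqrt_pos.mpr (choose_prod_pos hn)
  have h3 : (bond N x y).col τ (fun x => ⟨(σ x : ℕ), hn x⟩) = 0 := by
    rcases div_eq_zero_iff.mp (h1.trans (by ring)) with h3 | h3
    · exact h3
    · exact absurd h3 hp.ne'
  exact h3

lemma realHam_apply_eq_zero {σ τ : Fin L → Fin (N + 1)} (h : total σ ≠ total τ) :
    realHam L N σ τ = 0 := by
  simp only [realHam, Matrix.sum_apply]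
  refine Finset.sum_eq_zero fun x _ => Finset.sum_eq_zero fun y _ => ?_
  split_ifs with hxy
  · exact bond_apply_eq_zero (ne_of_adj hxy) h
  · rfl

lemma partitionFunction_eq_sum_sectors (β : ℝ) :
    partitionFunction L β N = ∑ k ∈ Finset.range (N * L + 1),
      ∑ i, Real.exp (-β * (sectorHam_isHermitian L N k).eigenvalues i) := by
  let t : (Fin L → Fin (N + 1)) → Fin (N * L + 1) := fun σ =>
    ⟨total σ, Nat.lt_succ_iff.mpr (total_le σ)⟩
  let B : ∀ k : Fin (N * L + 1), Matrix {σ // t σ = k} {σ // t σ = k} ℝ := fun k =>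
    (realHam L N).submatrix Subtype.val Subtype.val
  -- Ordering the configurations by particle number makes the Hamiltonian block diagonal, and so its
  -- exponential.
  have hB : (realHam L N).submatrix (Equiv.sigmaFiberEquiv t) (Equiv.sigmaFiberEquiv t) =
      blockDiagonal' B := by
    ext ⟨k, σ⟩ ⟨k', τ⟩
    rw [blockDiagonal'_apply]
    by_cases h : k = k'
    · subst h
      simp [B]
    · rw [dif_neg h]
      exact realHam_apply_eq_zero fun hc => h (σ.2.symm.trans ((Fin.ext hc).trans τ.2))
  have htr : ∀ {α γ : Type} [Fintype α] [DecidableEq α] [Fintype γ] [DecidableEq γ] (e : α ≃ γ)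
      (A : Matrix γ γ ℝ), (NormedSpace.exp A).trace = (NormedSpace.exp (A.submatrix e e)).trace := by
    intro α γ _ _ _ _ e A
    have hc : Continuous (Matrix.reindexAlgEquiv ℝ ℝ e.symm) :=
      continuous_id.matrix_submatrix _ _
    have : NormedSpace.exp (Matrix.reindexAlgEquiv ℝ ℝ e.symm A) =
        Matrix.reindexAlgEquiv ℝ ℝ e.symm (NormedSpace.exp A) := by
      let _ : NormedRing (Matrix γ γ ℝ) := Matrix.linftyOpNormedRing
      let _ : NormedAlgebra ℝ (Matrix γ γ ℝ) := Matrix.linftyOpNormedAlgebra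
      let _ : NormedAlgebra ℚ (Matrix γ γ ℝ) := NormedAlgebra.restrictScalars ℚ ℝ _
      let _ : NormedRing (Matrix α α ℝ) := Matrix.linftyOpNormedRing
      exact (NormedSpace.map_exp _ hc _).symm
    have h2 : A.submatrix e e = Matrix.reindexAlgEquiv ℝ ℝ e.symm A := rfl
    rw [h2, this]
    exact (Equiv.sum_comp e fun i => (NormedSpace.exp A) i i).symm
  rw [partitionFunction_eq_trace, htr (Equiv.sigmaFiberEquiv t), submatrix_smul, Pi.smul_apply,
    Pi.smul_apply, hB, ← blockDiagonal'_smul, exp_blockDiagonal', trace_blockDiagonal',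
    ← Fin.sum_univ_eq_sum_range
      (fun k => ∑ i, Real.exp (-β * (sectorHam_isHermitian L N k).eigenvalues i))]
  refine Finset.sum_congr rfl fun k _ => ?_
  rw [← trace_exp_smul]
  have hpi : NormedSpace.exp ((-β) • B) k = NormedSpace.exp (((-β) • B) k) := by
    let _ : ∀ k, NormedRing (Matrix {σ // t σ = k} {σ // t σ = k} ℝ) := fun _ =>
      Matrix.linftyOpNormedRing
    let _ : ∀ k, NormedAlgebra ℝ (Matrix {σ // t σ = k} {σ // t σ = k} ℝ) := fun _ =>
      Matrix.linftyOpNormedAlgebra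
    let _ : ∀ k, NormedAlgebra ℚ (Matrix {σ // t σ = k} {σ // t σ = k} ℝ) := fun _ =>
      NormedAlgebra.restrictScalars ℚ ℝ _
    exact Pi.coe_exp _ k
  rw [hpi]
  let e : Sector L N k ≃ {σ // t σ = k} := Equiv.subtypeEquivRight fun σ => by
    simp [t, Fin.ext_iff]
  rw [htr e]
  rfl

end Sectors

end

end Heisenberg

namespace Heisenberg

noncomputable section

open Matrix

/-! ### Subadditivity of `log Z` and the thermodynamic limit. -/

section Limit

variable {L M N : ℕ}

lemma update_append_left (σ : Fin L → Fin (N + 1)) (τ : Fin M → Fin (N + 1)) (x : Fin L)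
    (p : Fin (N + 1)) : Function.update (Fin.append σ τ) (Fin.castAdd M x) p =
      Fin.append (Function.update σ x p) τ := by
  funext y
  refine Fin.addCases (fun y => ?_) (fun y => ?_) y
  · by_cases h : y = x
    · subst h; simp
    · have : Fin.castAdd M y ≠ Fin.castAdd M x := fun hc => h (Fin.castAdd_injective L M hc)
      simp [h, this]
  · have : Fin.natAdd L y ≠ Fin.castAdd M x := fun hc => by
      have := congrArg Fin.val hc; simp at this; omega
    simp [this]

lemma update_append_right (σ : Fin L → Fin (N + 1)) (τ : Fin M → Fin (N + 1)) (x : Fin M)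
    (p : Fin (N + 1)) : Function.update (Fin.append σ τ) (Fin.natAdd L x) p =
      Fin.append σ (Function.update τ x p) := by
  funext y
  refine Fin.addCases (fun y => ?_) (fun y => ?_) y
  · have : Fin.castAdd M y ≠ Fin.natAdd L x := fun hc => by
      have := congrArg Fin.val hc; simp at this; omega
    simp [this]
  · by_cases h : y = x
    · subst h; simp
    · have : Fin.natAdd L y ≠ Fin.natAdd L x := fun hc => h (Fin.natAdd_injective M L hc)
      simp [h, this]

lemma onSite_append_left (x : Fin L) (A : Matrix (Fin (N + 1)) (Fin (N + 1)) ℝ)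
    (ψ : (Fin (L + M) → Fin (N + 1)) → ℝ) (τ : Fin M → Fin (N + 1)) :
    (fun σ => (onSite (Fin.castAdd M x) A *ᵥ ψ) (Fin.append σ τ)) =
      onSite x A *ᵥ fun σ => ψ (Fin.append σ τ) := by
  funext σ
  simp [onSite_mulVec, update_append_left]

lemma onSite_append_right (x : Fin M) (A : Matrix (Fin (N + 1)) (Fin (N + 1)) ℝ)
    (ψ : (Fin (L + M) → Fin (N + 1)) → ℝ) (σ : Fin L → Fin (N + 1)) :
    (fun τ => (onSite (Fin.natAdd L x) A *ᵥ ψ) (Fin.append σ τ)) =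
      onSite x A *ᵥ fun τ => ψ (Fin.append σ τ) := by
  funext τ
  simp [onSite_mulVec, update_append_right]

lemma bond_append_left (x y : Fin L) (ψ : (Fin (L + M) → Fin (N + 1)) → ℝ)
    (τ : Fin M → Fin (N + 1)) :
    (fun σ => (bond N (Fin.castAdd M x) (Fin.castAdd M y) *ᵥ ψ) (Fin.append σ τ)) =
      bond N x y *ᵥ fun σ => ψ (Fin.append σ τ) := by
  have h : ∀ A B : Matrix (Fin (N + 1)) (Fin (N + 1)) ℝ,
      (fun σ => ((onSite (Fin.castAdd M x) A * onSite (Fin.castAdd M y) B) *ᵥ ψ)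
        (Fin.append σ τ)) = (onSite x A * onSite y B) *ᵥ fun σ => ψ (Fin.append σ τ) := by
    intro A B
    rw [← mulVec_mulVec, ← mulVec_mulVec, onSite_append_left, onSite_append_left]
  simp only [bond, sub_mulVec, add_mulVec, smul_mulVec, one_mulVec, ← h]
  rfl

lemma bond_append_right (x y : Fin M) (ψ : (Fin (L + M) → Fin (N + 1)) → ℝ)
    (σ : Fin L → Fin (N + 1)) :
    (fun τ => (bond N (Fin.natAdd L x) (Fin.natAdd L y) *ᵥ ψ) (Fin.append σ τ)) =
      bond N x y *ᵥ fun τ => ψ (Fin.append σ τ) := by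
  have h : ∀ A B : Matrix (Fin (N + 1)) (Fin (N + 1)) ℝ,
      (fun τ => ((onSite (Fin.natAdd L x) A * onSite (Fin.natAdd L y) B) *ᵥ ψ)
        (Fin.append σ τ)) = (onSite x A * onSite y B) *ᵥ fun τ => ψ (Fin.append σ τ) := by
    intro A B
    rw [← mulVec_mulVec, ← mulVec_mulVec, onSite_append_right, onSite_append_right]
  simp only [bond, sub_mulVec, add_mulVec, smul_mulVec, one_mulVec, ← h]
  rfl

lemma sum_append (f : (Fin (L + M) → Fin (N + 1)) → ℝ) :
    ∑ ρ, f ρ = ∑ σ : Fin L → Fin (N + 1), ∑ τ : Fin M → Fin (N + 1), f (Fin.append σ τ) := by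
  rw [← (Fin.appendEquiv L M).sum_comp, Fintype.sum_prod_type]
  rfl

lemma realHam_form (ψ : (Fin L → Fin (N + 1)) → ℝ) :
    ψ ⬝ᵥ realHam L N *ᵥ ψ = ∑ x : Fin L, ∑ y : Fin L,
      if (x : ℕ) + 1 = (y : ℕ) then ψ ⬝ᵥ bond N x y *ᵥ ψ else 0 := by
  simp only [realHam, Matrix.sum_mulVec, dotProduct_sum]
  refine Finset.sum_congr rfl fun x _ => Finset.sum_congr rfl fun y _ => ?_
  split_ifs <;> simp

lemma realHam_nonneg (ψ : (Fin L → Fin (N + 1)) → ℝ) : 0 ≤ ψ ⬝ᵥ realHam L N *ᵥ ψ := by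
  rw [realHam_form]
  refine Finset.sum_nonneg fun x _ => Finset.sum_nonneg fun y _ => ?_
  split_ifs with h
  · exact bond_nonneg ψ (ne_of_adj h)
  · rfl

/-- The bond joining the two pieces is nonnegative and is discarded. -/
lemma realHam_append_le (ψ : (Fin (L + M) → Fin (N + 1)) → ℝ) :
    ∑ τ : Fin M → Fin (N + 1), (fun σ => ψ (Fin.append σ τ)) ⬝ᵥ
        realHam L N *ᵥ (fun σ => ψ (Fin.append σ τ)) +
      ∑ σ : Fin L → Fin (N + 1), (fun τ => ψ (Fin.append σ τ)) ⬝ᵥ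
        realHam M N *ᵥ (fun τ => ψ (Fin.append σ τ)) ≤ ψ ⬝ᵥ realHam (L + M) N *ᵥ ψ := by
  have hl : ∀ x y : Fin L, ψ ⬝ᵥ bond N (Fin.castAdd M x) (Fin.castAdd M y) *ᵥ ψ =
      ∑ τ : Fin M → Fin (N + 1), (fun σ => ψ (Fin.append σ τ)) ⬝ᵥ
        bond N x y *ᵥ (fun σ => ψ (Fin.append σ τ)) := by
    intro x y
    rw [dotProduct, sum_append, Finset.sum_comm]
    refine Finset.sum_congr rfl fun τ _ => ?_
    rw [← bond_append_left]
    rfl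
  have hr : ∀ x y : Fin M, ψ ⬝ᵥ bond N (Fin.natAdd L x) (Fin.natAdd L y) *ᵥ ψ =
      ∑ σ : Fin L → Fin (N + 1), (fun τ => ψ (Fin.append σ τ)) ⬝ᵥ
        bond N x y *ᵥ (fun τ => ψ (Fin.append σ τ)) := by
    intro x y
    rw [dotProduct, sum_append]
    refine Finset.sum_congr rfl fun τ _ => ?_
    rw [← bond_append_right]
    rfl
  have hnn : ∀ x y : Fin (L + M),
      0 ≤ if (x : ℕ) + 1 = (y : ℕ) then ψ ⬝ᵥ bond N x y *ᵥ ψ else 0 := by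
    intro x y
    split_ifs with h
    · exact bond_nonneg ψ (ne_of_adj h)
    · rfl
  have e1 : ∑ τ : Fin M → Fin (N + 1), (fun σ => ψ (Fin.append σ τ)) ⬝ᵥ
        realHam L N *ᵥ (fun σ => ψ (Fin.append σ τ)) = ∑ x : Fin L, ∑ y : Fin L,
      if (x : ℕ) + 1 = (y : ℕ) then
        ψ ⬝ᵥ bond N (Fin.castAdd M x) (Fin.castAdd M y) *ᵥ ψ else 0 := by
    simp only [realHam_form, hl]
    rw [Finset.sum_comm]
    refine Finset.sum_congr rfl fun x _ => ?_
    rw [Finset.sum_comm]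
    refine Finset.sum_congr rfl fun y _ => ?_
    split_ifs <;> simp
  have e2 : ∑ σ : Fin L → Fin (N + 1), (fun τ => ψ (Fin.append σ τ)) ⬝ᵥ
        realHam M N *ᵥ (fun τ => ψ (Fin.append σ τ)) = ∑ x : Fin M, ∑ y : Fin M,
      if (x : ℕ) + 1 = (y : ℕ) then
        ψ ⬝ᵥ bond N (Fin.natAdd L x) (Fin.natAdd L y) *ᵥ ψ else 0 := by
    simp only [realHam_form, hr]
    rw [Finset.sum_comm]
    refine Finset.sum_congr rfl fun x _ => ?_
    rw [Finset.sum_comm]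
    refine Finset.sum_congr rfl fun y _ => ?_
    split_ifs <;> simp
  rw [e1, e2, realHam_form, Fin.sum_univ_add]
  refine add_le_add (Finset.sum_le_sum fun x _ => ?_) (Finset.sum_le_sum fun x _ => ?_)
  · rw [Fin.sum_univ_add]
    refine le_trans (le_of_eq ?_) (le_add_of_nonneg_right (Finset.sum_nonneg fun y _ => hnn _ _))
    exact Finset.sum_congr rfl fun y _ => by simp
  · rw [Fin.sum_univ_add]
    refine le_trans (le_of_eq ?_) (le_add_of_nonneg_left (Finset.sum_nonneg fun y _ => hnn _ _))
    refine Finset.sum_congr rfl fun y _ => ?_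
    simp [add_assoc]

lemma dotProduct_self_pos {ι : Type*} [Fintype ι] {ψ : ι → ℝ} (h : ψ ≠ 0) : 0 < ψ ⬝ᵥ ψ :=
  lt_of_le_of_ne (Finset.sum_nonneg fun _ _ => mul_self_nonneg _)
    (Ne.symm fun hc => h (dotProduct_self_eq_zero.mp hc))

/-- The coefficients of a vector in the product eigenbasis of the two pieces serve as functionals,
with the sums of eigenvalues as levels. The form of the whole chain dominates the one that is
diagonal in this basis, and the exponentials of sums factorise. -/
lemma partitionFunction_add_le (L M N : ℕ) {β : ℝ} (hβ : 0 ≤ β) :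
    partitionFunction (L + M) β N ≤ partitionFunction L β N * partitionFunction M β N := by
  rw [partitionFunction_eq_sum, partitionFunction_eq_sum, partitionFunction_eq_sum,
    Finset.sum_mul_sum, ← Fintype.sum_prod_type']
  set hL := realHam_isHermitian (L := L) (N := N)
  set hM := realHam_isHermitian (L := M) (N := N)
  let c : (Fin L → Fin (N + 1)) → (Fin M → Fin (N + 1)) →
      ((Fin (L + M) → Fin (N + 1)) → ℝ) → ℝ := fun i j ψ =>
    ∑ σ, ∑ τ, eigvec hL i σ * eigvec hM j τ * ψ (Fin.append σ τ)
  let l : (Fin L → Fin (N + 1)) × (Fin M → Fin (N + 1)) →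
      ((Fin (L + M) → Fin (N + 1)) → ℝ) →ₗ[ℝ] ℝ := fun ij =>
    { toFun := c ij.1 ij.2
      map_add' := fun ψ φ => by
        simp only [c, Pi.add_apply, mul_add, Finset.sum_add_distrib]
      map_smul' := fun a ψ => by
        simp only [c, Pi.smul_apply, smul_eq_mul, Finset.mul_sum, RingHom.id_apply]
        exact Finset.sum_congr rfl fun _ _ => Finset.sum_congr rfl fun _ _ => by ring }
  have h := trace_exp_le_of_functionals (realHam_isHermitian (L := L + M) (N := N)) β hβ l
    (fun ij => hL.eigenvalues ij.1 + hM.eigenvalues ij.2) ?_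
  · refine h.trans (le_of_eq ?_)
    refine Finset.sum_congr rfl fun ij _ => ?_
    rw [← Real.exp_add]
    congr 1
    ring
  intro ψ e h0 hl
  have c1 : ∀ i j, eigvec hM j ⬝ᵥ (fun τ => eigvec hL i ⬝ᵥ fun σ => ψ (Fin.append σ τ)) =
      c i j ψ := by
    intro i j
    simp only [dotProduct, c, Finset.mul_sum]
    rw [Finset.sum_comm]
    exact Finset.sum_congr rfl fun _ _ => Finset.sum_congr rfl fun _ _ => by ring
  have c2 : ∀ i j, eigvec hL i ⬝ᵥ (fun σ => eigvec hM j ⬝ᵥ fun τ => ψ (Fin.append σ τ)) =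
      c i j ψ := by
    intro i j
    simp only [dotProduct, c, Finset.mul_sum]
    exact Finset.sum_congr rfl fun _ _ => Finset.sum_congr rfl fun _ _ => by ring
  have s1 : ∀ i, ∑ τ, (eigvec hL i ⬝ᵥ fun σ => ψ (Fin.append σ τ)) ^ 2 = ∑ j, c i j ψ ^ 2 := by
    intro i
    have := dotProduct_self_eq_sum hM (fun τ => eigvec hL i ⬝ᵥ fun σ => ψ (Fin.append σ τ))
    simp only [c1] at this
    rw [← this, dotProduct]
    exact Finset.sum_congr rfl fun _ _ => sq _
  have s2 : ∀ j, ∑ σ, (eigvec hM j ⬝ᵥ fun τ => ψ (Fin.append σ τ)) ^ 2 = ∑ i, c i j ψ ^ 2 := by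
    intro j
    have := dotProduct_self_eq_sum hL (fun σ => eigvec hM j ⬝ᵥ fun τ => ψ (Fin.append σ τ))
    simp only [c2] at this
    rw [← this, dotProduct]
    exact Finset.sum_congr rfl fun _ _ => sq _
  have hnorm : ψ ⬝ᵥ ψ = ∑ i, ∑ j, c i j ψ ^ 2 := by
    rw [dotProduct, sum_append, Finset.sum_comm]
    have : ∀ τ, ∑ σ, ψ (Fin.append σ τ) * ψ (Fin.append σ τ) =
        ∑ i, (eigvec hL i ⬝ᵥ fun σ => ψ (Fin.append σ τ)) ^ 2 := fun τ =>
      dotProduct_self_eq_sum hL fun σ => ψ (Fin.append σ τ)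
    rw [Finset.sum_congr rfl fun τ _ => this τ, Finset.sum_comm]
    exact Finset.sum_congr rfl fun i _ => s1 i
  have hq : ∑ i, ∑ j, (hL.eigenvalues i + hM.eigenvalues j) * c i j ψ ^ 2 ≤
      ψ ⬝ᵥ realHam (L + M) N *ᵥ ψ := by
    refine le_trans (le_of_eq ?_) (realHam_append_le ψ)
    simp only [dotProduct_mulVec_eq_sum hL, dotProduct_mulVec_eq_sum hM, add_mul,
      Finset.sum_add_distrib]
    congr 1
    · rw [Finset.sum_comm (s := Finset.univ (α := Fin M → Fin (N + 1)))]
      simp only [← Finset.mul_sum, s1]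
    · rw [Finset.sum_comm, Finset.sum_comm (s := Finset.univ (α := Fin L → Fin (N + 1)))
        (f := fun σ j => hM.eigenvalues j * (eigvec hM j ⬝ᵥ fun τ => ψ (Fin.append σ τ)) ^ 2)]
      simp only [← Finset.mul_sum, s2]
  refine lt_of_lt_of_le ?_ hq
  have hpos : 0 < ∑ i, ∑ j, c i j ψ ^ 2 := by
    rw [← hnorm]
    exact dotProduct_self_pos h0
  rw [hnorm]
  rw [← Fintype.sum_prod_type'] at hpos ⊢
  rw [← Fintype.sum_prod_type' (f := fun i j => (hL.eigenvalues i + hM.eigenvalues j) * c i j ψ ^ 2),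
    Finset.mul_sum]
  obtain ⟨ij, _, hij⟩ := Finset.exists_ne_zero_of_sum_ne_zero hpos.ne'
  have hlt : ∀ ij : (Fin L → Fin (N + 1)) × (Fin M → Fin (N + 1)), c ij.1 ij.2 ψ ^ 2 ≠ 0 →
      e < hL.eigenvalues ij.1 + hM.eigenvalues ij.2 := by
    intro ij h
    by_contra hc
    have : c ij.1 ij.2 ψ = 0 := hl ij (not_lt.mp hc)
    exact h (by rw [this]; simp)
  refine Finset.sum_lt_sum (fun ij _ => ?_) ⟨ij, Finset.mem_univ _, ?_⟩
  · by_cases h : c ij.1 ij.2 ψ ^ 2 = 0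
    · simp [h]
    · exact mul_le_mul_of_nonneg_right (hlt ij h).le (sq_nonneg _)
  · exact mul_lt_mul_of_pos_right (hlt ij hij) (lt_of_le_of_ne (sq_nonneg _) (Ne.symm hij))

lemma eigenvalues_nonneg (σ : Fin L → Fin (N + 1)) :
    0 ≤ (realHam_isHermitian (L := L) (N := N)).eigenvalues σ := by
  have h := realHam_nonneg (eigvec (realHam_isHermitian (L := L) (N := N)) σ)
  rw [mulVec_eigvec, dotProduct_smul, eigvec_dotProduct] at h
  simpa using h

lemma realHam_vacuum : realHam L N 0 0 = 0 := by
  simp only [realHam, Matrix.sum_apply]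
  refine Finset.sum_eq_zero fun x _ => Finset.sum_eq_zero fun y _ => ?_
  split_ifs with h
  · have h1 := amp_bond (Pi.single (0 : Fin L → Fin (N + 1)) 1) (ne_of_adj h) (n := fun _ => 0)
      (by simp)
    rw [amp_of_le _ (by simp), mulVec_single_one] at h1
    simp only [Nat.choose_zero_right, Nat.cast_one, Finset.prod_const_one, Real.sqrt_one, div_one,
      CharP.cast_eq_zero, zero_mul, add_zero, mul_zero] at h1
    exact h1
  · rfl

/-- The vacuum has energy zero, so some eigenvalue is not positive. -/
lemma one_le_partitionFunction (L N : ℕ) {β : ℝ} (hβ : 0 ≤ β) : 1 ≤ partitionFunction L β N := by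
  rw [partitionFunction_eq_sum]
  set hL := realHam_isHermitian (L := L) (N := N)
  have h0 : ∃ σ, hL.eigenvalues σ ≤ 0 := by
    by_contra hc
    push Not at hc
    let ψ : (Fin L → Fin (N + 1)) → ℝ := Pi.single 0 1
    have h1 : ψ ⬝ᵥ realHam L N *ᵥ ψ = 0 := by
      rw [mulVec_single_one, single_dotProduct, one_mul]
      exact realHam_vacuum
    have h2 : ψ ⬝ᵥ ψ = 1 := by simp [ψ]
    rw [dotProduct_mulVec_eq_sum hL, Finset.sum_eq_zero_iff_of_nonneg
      (fun σ _ => mul_nonneg (hc σ).le (sq_nonneg _))] at h1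
    rw [dotProduct_self_eq_sum hL, Finset.sum_eq_zero] at h2
    · exact one_ne_zero h2.symm
    · intro σ hσ
      exact (mul_eq_zero.mp (h1 σ hσ)).resolve_left (hc σ).ne'
  obtain ⟨σ, hσ⟩ := h0
  refine le_trans ?_ (Finset.single_le_sum (f := fun σ => Real.exp (-β * hL.eigenvalues σ))
    (fun i _ => (Real.exp_pos _).le) (Finset.mem_univ σ))
  exact Real.one_le_exp (by nlinarith)

lemma partitionFunction_le_pow (L N : ℕ) {β : ℝ} (hβ : 0 ≤ β) :
    partitionFunction L β N ≤ ((N : ℝ) + 1) ^ L := by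
  rw [partitionFunction_eq_sum]
  calc _ ≤ ∑ _σ : Fin L → Fin (N + 1), (1 : ℝ) := Finset.sum_le_sum fun σ _ => by
        rw [Real.exp_le_one_iff]
        nlinarith [eigenvalues_nonneg σ]
    _ = _ := by simp

lemma log_partitionFunction_nonneg (L N : ℕ) {β : ℝ} (hβ : 0 ≤ β) :
    0 ≤ Real.log (partitionFunction L β N) :=
  Real.log_nonneg (one_le_partitionFunction L N hβ)

lemma log_partitionFunction_le (L N : ℕ) {β : ℝ} (hβ : 0 ≤ β) :
    Real.log (partitionFunction L β N) ≤ L * Real.log ((N : ℝ) + 1) := by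
  rw [← Real.log_pow]
  exact Real.log_le_log (by linarith [one_le_partitionFunction L N hβ])
    (partitionFunction_le_pow L N hβ)

lemma subadditive_log_partitionFunction (N : ℕ) {β : ℝ} (hβ : 0 ≤ β) :
    Subadditive fun L => Real.log (partitionFunction L β N) := by
  intro L M
  have h1 := one_le_partitionFunction L N hβ
  have h2 := one_le_partitionFunction M N hβ
  have h3 := one_le_partitionFunction (L + M) N hβ
  rw [← Real.log_mul (by linarith) (by linarith)]
  exact Real.log_le_log (by linarith) (partitionFunction_add_le L M N hβ)

lemma log_partitionFunction_mul_le (q L N : ℕ) {β : ℝ} (hβ : 0 ≤ β) :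
    Real.log (partitionFunction (q * L) β N) ≤ q * Real.log (partitionFunction L β N) := by
  rcases q with _ | q
  · have := log_partitionFunction_le 0 N hβ
    simpa using this
  · have := (subadditive_log_partitionFunction N hβ).apply_mul_add_le q L L
    rw [Nat.succ_mul]
    push_cast
    linarith

lemma bddBelow_log_partitionFunction (N : ℕ) {β : ℝ} (hβ : 0 ≤ β) :
    BddBelow (Set.range fun L : ℕ => Real.log (partitionFunction L β N) / L) := by
  refine ⟨0, ?_⟩
  rintro _ ⟨L, rfl⟩
  exact div_nonneg (log_partitionFunction_nonneg L N hβ) (Nat.cast_nonneg L)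

lemma tendsto_finiteFreeEnergy_aux (N : ℕ) {β : ℝ} (hβ : 0 < β) :
    Filter.Tendsto (fun L : ℕ => finiteFreeEnergy L β N) Filter.atTop
      (nhds (-(1 / β) * (subadditive_log_partitionFunction N hβ.le).lim)) := by
  have h := (subadditive_log_partitionFunction N hβ.le).tendsto_lim
    (bddBelow_log_partitionFunction N hβ.le)
  refine (h.const_mul (-(1 / β))).congr fun L => ?_
  rw [finiteFreeEnergy, one_div, one_div, mul_inv]
  ring

theorem tendsto_finiteFreeEnergy (N : ℕ) {β : ℝ} (hβ : 0 < β) :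
    Filter.Tendsto (fun L : ℕ => finiteFreeEnergy L β N) Filter.atTop (nhds (freeEnergy β N)) := by
  rw [freeEnergy, (tendsto_finiteFreeEnergy_aux N hβ).limUnder_eq]
  exact tendsto_finiteFreeEnergy_aux N hβ

/-- The free energy is bounded below by its finite volume versions. -/
theorem le_freeEnergy (N : ℕ) {β : ℝ} (hβ : 0 < β) {L : ℕ} (hL : L ≠ 0) :
    -(1 / β) * (Real.log (partitionFunction L β N) / L) ≤ freeEnergy β N := by
  rw [freeEnergy, (tendsto_finiteFreeEnergy_aux N hβ).limUnder_eq]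
  -- For a subadditive sequence the limit of the averages is also their infimum, so every single `L`
  -- yields a bound.
  have h := (subadditive_log_partitionFunction N hβ.le).lim_le_div
    (bddBelow_log_partitionFunction N hβ.le) hL
  have hb : 0 < 1 / β := by positivity
  nlinarith

end Limit

end

end Heisenberg

namespace Heisenberg

noncomputable section

open Matrix

/-! ### Long exchanges composed of exchanges between neighbouring sites. -/

section Paths

variable {L N k : ℕ}

/-- Weighted Dirichlet form of the transposition of `a` and `b`. -/
def weightedHop (w f : (Fin k → Fin L × Fin N) → ℝ) (a b : Fin L × Fin N) : ℝ :=
  ∑ Z, (w Z * (f Z - f (Equiv.swap a b ∘ Z))) ^ 2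

/-- Weighted Dirichlet form of all transpositions between two sites. -/
def weightedLayer (w f : (Fin k → Fin L × Fin N) → ℝ) (x y : Fin L) : ℝ :=
  ∑ i, ∑ j, weightedHop w f (x, i) (y, j)

lemma weightedHop_nonneg (w f : (Fin k → Fin L × Fin N) → ℝ) (a b : Fin L × Fin N) :
    0 ≤ weightedHop w f a b := Finset.sum_nonneg fun _ _ => sq_nonneg _

lemma weightedLayer_nonneg (w f : (Fin k → Fin L × Fin N) → ℝ) (x y : Fin L) :
    0 ≤ weightedLayer w f x y :=
  Finset.sum_nonneg fun _ _ => Finset.sum_nonneg fun _ _ => weightedHop_nonneg w f _ _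

lemma weightedHop_comm (w f : (Fin k → Fin L × Fin N) → ℝ) (a b : Fin L × Fin N) :
    weightedHop w f a b = weightedHop w f b a := by
  simp only [weightedHop, Equiv.swap_comm a b]

lemma weightedLayer_comm (w f : (Fin k → Fin L × Fin N) → ℝ) (x y : Fin L) :
    weightedLayer w f x y = weightedLayer w f y x := by
  unfold weightedLayer
  rw [Finset.sum_comm]
  simp only [weightedHop_comm w f (y, _)]

lemma weightedHop_one (f : (Fin k → Fin L × Fin N) → ℝ) (a b : Fin L × Fin N) :
    weightedHop (fun _ => 1) f a b = hopEnergy f a b := by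
  simp [weightedHop, hopEnergy]

lemma weightedLayer_one (f : (Fin k → Fin L × Fin N) → ℝ) (x y : Fin L) :
    weightedLayer (fun _ => 1) f x y = layerEnergy f x y := by
  simp [weightedLayer, layerEnergy, weightedHop_one]

lemma norm_toLp_comp_perm (g : (Fin k → Fin L × Fin N) → ℝ) (π : Equiv.Perm (Fin L × Fin N)) :
    ‖WithLp.toLp 2 fun Z => g (π ∘ Z)‖ = ‖WithLp.toLp 2 g‖ := by
  rw [EuclideanSpace.norm_eq, EuclideanSpace.norm_eq]
  congr 1
  exact sum_comp_perm (fun Z => ‖g Z‖ ^ 2) π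

lemma sqrt_weightedHop (w f : (Fin k → Fin L × Fin N) → ℝ) (a b : Fin L × Fin N) :
    Real.sqrt (weightedHop w f a b) =
      ‖WithLp.toLp 2 fun Z => w Z * (f Z - f (Equiv.swap a b ∘ Z))‖ := by
  rw [EuclideanSpace.norm_eq]
  simp only [weightedHop, Real.norm_eq_abs, sq_abs]

/-- The conjugation `(a c) = (a b)(b c)(a b)` replaces one exchange by three. The weight is
invariant under each of them and composition with a permutation preserves the norm, so the triangle
inequality applies; `(a b)` occurs twice. Weights are needed because a particle will later be
pinned. -/
lemma sqrt_weightedHop_triangle (w f : (Fin k → Fin L × Fin N) → ℝ) {a b c : Fin L × Fin N}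
    (hbc : b ≠ c) (hac : a ≠ c)
    (h1 : ∀ Z, w (Equiv.swap a b ∘ Z) = w Z) (h2 : ∀ Z, w (Equiv.swap b c ∘ Z) = w Z) :
    Real.sqrt (weightedHop w f a c) ≤
      2 * Real.sqrt (weightedHop w f a b) + Real.sqrt (weightedHop w f b c) := by
  rw [sqrt_weightedHop, sqrt_weightedHop, sqrt_weightedHop]
  set A : (Fin k → Fin L × Fin N) → ℝ := fun Z => w Z * (f Z - f (Equiv.swap a b ∘ Z))
  set B : (Fin k → Fin L × Fin N) → ℝ := fun Z => w Z * (f Z - f (Equiv.swap b c ∘ Z))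
  have hτ : Equiv.swap a c = Equiv.swap a b * Equiv.swap b c * Equiv.swap a b := by
    rw [Equiv.swap_comm a b, Equiv.swap_comm b c, Equiv.swap_mul_swap_mul_swap hbc.symm hac.symm]
  have hsum : (fun Z => w Z * (f Z - f (Equiv.swap a c ∘ Z))) =
      A + (fun Z => B (Equiv.swap a b ∘ Z)) +
        fun Z => A ((Equiv.swap b c * Equiv.swap a b : Equiv.Perm _) ∘ Z) := by
    funext Z
    have e1 : w ((Equiv.swap b c * Equiv.swap a b : Equiv.Perm _) ∘ Z) = w Z := by
      rw [Equiv.Perm.coe_mul, Function.comp_assoc, h2, h1]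
    simp only [Pi.add_apply, A, B, e1, h1, hτ]
    simp only [Equiv.Perm.coe_mul, Function.comp_assoc]
    ring
  rw [hsum, WithLp.toLp_add, WithLp.toLp_add]
  refine (norm_add_le _ _).trans ?_
  have := norm_add_le (WithLp.toLp 2 A) (WithLp.toLp 2 fun Z => B (Equiv.swap a b ∘ Z))
  rw [norm_toLp_comp_perm] at this
  rw [norm_toLp_comp_perm]
  linarith

/-- The first step is split off at each stage of the induction, so only that step is doubled and the
constant 2 does not grow with the length. -/
lemma sqrt_weightedHop_path (w f : (Fin k → Fin L × Fin N) → ℝ) (m : ℕ) :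
    ∀ z : ℕ → Fin L × Fin N, (∀ s t, s ≤ m → t ≤ m → z s = z t → s = t) →
      (∀ s t, s ≤ m → t ≤ m → ∀ Z, w (Equiv.swap (z s) (z t) ∘ Z) = w Z) →
      Real.sqrt (weightedHop w f (z 0) (z m)) ≤
        2 * ∑ t ∈ Finset.range m, Real.sqrt (weightedHop w f (z t) (z (t + 1))) := by
  induction m with
  | zero =>
    intro z _ _
    simp [weightedHop]
  | succ m ih =>
    intro z hz hw
    have h1 := ih (fun t => z (t + 1))
      (fun s t hs ht h => by have := hz (s + 1) (t + 1) (by omega) (by omega) h; omega)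
      (fun s t hs ht => hw _ _ (by omega) (by omega))
    rw [Finset.sum_range_succ']
    by_cases hm : m = 0
    · subst hm
      simp only [Finset.range_zero, Finset.sum_empty, zero_add]
      linarith [Real.sqrt_nonneg (weightedHop w f (z 0) (z 1))]
    · have h2 := sqrt_weightedHop_triangle w f (a := z 0) (b := z 1) (c := z (m + 1))
        (fun h => by have := hz 1 (m + 1) (by omega) (by omega) h; omega)
        (fun h => by have := hz 0 (m + 1) (by omega) (by omega) h; omega)
        (hw 0 1 (by omega) (by omega)) (hw 1 (m + 1) (by omega) le_rfl)
      simp only [zero_add] at h1 ⊢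
      linarith

lemma weightedHop_path (w f : (Fin k → Fin L × Fin N) → ℝ) (m : ℕ) (z : ℕ → Fin L × Fin N)
    (hz : ∀ s t, s ≤ m → t ≤ m → z s = z t → s = t)
    (hw : ∀ s t, s ≤ m → t ≤ m → ∀ Z, w (Equiv.swap (z s) (z t) ∘ Z) = w Z) :
    weightedHop w f (z 0) (z m) ≤
      4 * m * ∑ t ∈ Finset.range m, weightedHop w f (z t) (z (t + 1)) := by
  have h := sqrt_weightedHop_path w f m z hz hw
  have h1 := pow_le_pow_left₀ (Real.sqrt_nonneg _) h 2
  rw [Real.sq_sqrt (weightedHop_nonneg _ _ _ _), mul_pow] at h1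
  have h2 := sq_sum_le_card_mul_sum_sq (s := Finset.range m)
    (f := fun t => Real.sqrt (weightedHop w f (z t) (z (t + 1))))
  simp only [Finset.card_range, Real.sq_sqrt (weightedHop_nonneg _ _ _ _)] at h2
  nlinarith

lemma weightedHop_conj {w f : (Fin k → Fin L × Fin N) → ℝ} (π : Equiv.Perm (Fin L × Fin N))
    (hf : ∀ Z, f (π ∘ Z) = f Z) (hw : ∀ Z, w (π ∘ Z) = w Z) (a b : Fin L × Fin N) :
    weightedHop w f (π a) (π b) = weightedHop w f a b := by
  unfold weightedHop
  rw [← sum_comp_perm _ π]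
  refine Finset.sum_congr rfl fun Z _ => ?_
  have : Equiv.swap (π a) (π b) ∘ (π ∘ Z) = π ∘ (Equiv.swap a b ∘ Z) := by
    funext l
    simp only [Function.comp_apply]
    rw [Equiv.swap_apply_apply]
    simp
  rw [this, hf, hf, hw]

/-- Invariance under permutations of the colours at each site. -/
def ColourInvariant (f : (Fin k → Fin L × Fin N) → ℝ) : Prop :=
  ∀ (x : Fin L) (i j : Fin N) (Z : Fin k → Fin L × Fin N), f (Equiv.swap (x, i) (x, j) ∘ Z) = f Z

lemma weightedHop_colour_right {w f : (Fin k → Fin L × Fin N) → ℝ} (hf : ColourInvariant f)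
    {y : Fin L} (hw : ∀ i j Z, w (Equiv.swap (y, i) (y, j) ∘ Z) = w Z) (a : Fin L × Fin N)
    (ha : a.1 ≠ y) (i j : Fin N) : weightedHop w f a (y, i) = weightedHop w f a (y, j) := by
  have h := weightedHop_conj (Equiv.swap (y, i) (y, j)) (hf y i j) (hw i j) a (y, i)
  rw [Equiv.swap_apply_left, Equiv.swap_apply_of_ne_of_ne (fun h => ha (by rw [h]))
    (fun h => ha (by rw [h]))] at h
  exact h.symm

/-- By colour invariance all `N²` exchanges between two sites have the same energy. -/
lemma weightedHop_eq_layer {w f : (Fin k → Fin L × Fin N) → ℝ} (hf : ColourInvariant f)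
    {x y : Fin L} (hxy : x ≠ y) (hwx : ∀ i j Z, w (Equiv.swap (x, i) (x, j) ∘ Z) = w Z)
    (hwy : ∀ i j Z, w (Equiv.swap (y, i) (y, j) ∘ Z) = w Z) (i j : Fin N) :
    weightedHop w f (x, i) (y, j) = (1 / (N : ℝ) ^ 2) * weightedLayer w f x y := by
  have h : ∀ i' j', weightedHop w f (x, i') (y, j') = weightedHop w f (x, i) (y, j) := by
    intro i' j'
    rw [weightedHop_colour_right hf hwy _ hxy j' j, weightedHop_comm,
      weightedHop_colour_right hf hwx _ hxy.symm i' i, weightedHop_comm]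
  have hN : (N : ℝ) ≠ 0 := by
    have := i.pos
    positivity
  simp only [weightedLayer, h, Finset.sum_const, Finset.card_univ, Fintype.card_fin, nsmul_eq_mul]
  field_simp

/-- Comparison of a long transposition with a path of short ones. -/
lemma weightedHop_layer_path {w f : (Fin k → Fin L × Fin N) → ℝ} (hf : ColourInvariant f)
    (P : Fin L × Fin N → Prop)
    (hw : ∀ a b, P a → P b → ∀ Z, w (Equiv.swap a b ∘ Z) = w Z)
    (m : ℕ) (hm : 1 ≤ m) (s : ℕ → Fin L) (hs : ∀ t t', t ≤ m → t' ≤ m → s t = s t' → t = t')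
    (i j : Fin N) (h0 : P (s 0, i)) (hP : ∀ t, 1 ≤ t → t ≤ m → ∀ c, P (s t, c)) :
    weightedHop w f (s 0, i) (s m, j) ≤ 4 * m * (weightedHop w f (s 0, i) (s 1, j) +
      ∑ t ∈ Finset.Ico 1 m, (1 / (N : ℝ) ^ 2) * weightedLayer w f (s t) (s (t + 1))) := by
  -- The colour is changed in the first step. In the starting layer only the point `(s 0, i)` is
  -- assumed to satisfy `P`, so the first exchange cannot be averaged over colours, whereas all
  -- later ones can.
  let z : ℕ → Fin L × Fin N := fun t => if t = 0 then (s 0, i) else (s t, j)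
  have hz1 : ∀ t, (z t).1 = s t := by
    intro t
    by_cases h : t = 0 <;> simp [z, h]
  have hPz : ∀ t, t ≤ m → P (z t) := by
    intro t ht
    by_cases h : t = 0
    · simpa [z, h] using h0
    · simpa [z, h] using hP t (by omega) ht j
  have h := weightedHop_path w f m z
    (fun t t' ht ht' h => hs t t' ht ht' (by rw [← hz1, ← hz1, h]))
    (fun t t' ht ht' => hw _ _ (hPz t ht) (hPz t' ht'))
  have hzm : z m = (s m, j) := by simp [z, show m ≠ 0 by omega]
  rw [hzm] at h
  refine h.trans (le_of_eq ?_)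
  congr 1
  rw [Finset.range_eq_Ico, ← Finset.sum_Ico_consecutive _ (Nat.zero_le 1) hm]
  congr 1
  · simp [z]
  · refine Finset.sum_congr rfl fun t ht => ?_
    rw [Finset.mem_Ico] at ht
    have h1 : z t = (s t, j) := by simp [z, show t ≠ 0 by omega]
    have h2 : z (t + 1) = (s (t + 1), j) := by simp [z]
    rw [h1, h2]
    refine weightedHop_eq_layer hf (fun h => by
      have := hs t (t + 1) (by omega) (by omega) h; omega) ?_ ?_ j j
    · exact fun i j => hw _ _ (hP t ht.1 (by omega) i) (hP t ht.1 (by omega) j)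
    · exact fun i j => hw _ _ (hP (t + 1) (by omega) (by omega) i)
        (hP (t + 1) (by omega) (by omega) j)

/-- A path without repeated sites uses each bond at most once. -/
lemma sum_path_le (F : Fin L → Fin L → ℝ) (hF : ∀ x y, 0 ≤ F x y) (R : Fin L → Fin L → Prop)
    [DecidableRel R] (m : ℕ) (s : ℕ → Fin L)
    (hs : ∀ t t', t ≤ m → t' ≤ m → s t = s t' → t = t') (hR : ∀ t, t < m → R (s t) (s (t + 1)))
    (S : Finset ℕ) (hS : ∀ t ∈ S, t < m) :
    ∑ t ∈ S, F (s t) (s (t + 1)) ≤ ∑ x, ∑ y, if R x y then F x y else 0 := by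
  rw [← Fintype.sum_prod_type']
  calc ∑ t ∈ S, F (s t) (s (t + 1)) =
        ∑ p ∈ S.image fun t => (s t, s (t + 1)), if R p.1 p.2 then F p.1 p.2 else 0 := by
        rw [Finset.sum_image]
        · exact Finset.sum_congr rfl fun t ht => by rw [if_pos (hR t (hS t ht))]
        · intro t ht t' ht' h
          exact hs t t' (hS t ht).le (hS t' ht').le (Prod.ext_iff.mp h).1
    _ ≤ _ := Finset.sum_le_sum_of_subset_of_nonneg (Finset.subset_univ _) fun p _ _ => by
        split_ifs
        · exact hF _ _
        · rfl

lemma lift_colourInvariant (ψ : (Fin L → Fin (N + 1)) → ℝ) : ColourInvariant (lift ψ k) := by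
  intro x i j Z
  have h1 : ∀ l, ((Equiv.swap (x, i) (x, j) ∘ Z) l).1 = (Z l).1 := by
    intro l
    rw [Function.comp_apply, Equiv.swap_apply_def]
    split_ifs with h h <;> simp [h]
  have h2 : occ (Equiv.swap (x, i) (x, j) ∘ Z) = occ Z := by
    funext y
    simp only [occ_eq_sum, h1]
  simp only [lift, h2, EquivLike.comp_injective]

lemma chainEnergy_nonneg (f : (Fin k → Fin L × Fin N) → ℝ) : 0 ≤ chainEnergy f := by
  refine Finset.sum_nonneg fun x _ => Finset.sum_nonneg fun y _ => ?_
  split_ifs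
  · exact layerEnergy_nonneg _ _ _
  · rfl

lemma hopEnergy_le_chainEnergy {f : (Fin k → Fin L × Fin N) → ℝ} (hf : ColourInvariant f)
    {a b : Fin L × Fin N} (hab : a.1 < b.1) :
    hopEnergy f a b ≤ 4 * L / (N : ℝ) ^ 2 * chainEnergy f := by
  obtain ⟨x, i⟩ := a
  obtain ⟨y, j⟩ := b
  simp only at hab
  have hxy : (x : ℕ) < y := hab
  set m : ℕ := (y : ℕ) - x
  let s : ℕ → Fin L := fun t => if h : (x : ℕ) + t < L then ⟨x + t, h⟩ else x
  have hsv : ∀ t, t ≤ m → ((s t : Fin L) : ℕ) = x + t := by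
    intro t ht
    have : (x : ℕ) + t < L := by have := y.2; omega
    simp [s, this]
  have hs : ∀ t t', t ≤ m → t' ≤ m → s t = s t' → t = t' := by
    intro t t' ht ht' h
    have := congrArg Fin.val h
    rw [hsv t ht, hsv t' ht'] at this
    omega
  have hs0 : s 0 = x := Fin.ext (hsv 0 (Nat.zero_le _))
  have hsm : s m = y := Fin.ext (by rw [hsv m le_rfl]; omega)
  have h := weightedHop_layer_path (w := fun _ => 1) hf (fun _ => True) (fun _ _ _ _ _ => rfl) m
    (by omega) s hs i j trivial (fun _ _ _ _ => trivial)
  have h01 : s 0 ≠ s 1 := fun h => by have := hs 0 1 (by omega) (by omega) h; omega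
  rw [weightedHop_eq_layer hf h01 (fun _ _ _ => rfl) (fun _ _ _ => rfl)] at h
  have hsum := sum_path_le (fun x y => layerEnergy f x y) (layerEnergy_nonneg f)
    (fun x y => (x : ℕ) + 1 = y) m s hs
    (fun t ht => by rw [hsv t ht.le, hsv (t + 1) ht]; omega) (Finset.range m)
    (fun t ht => Finset.mem_range.mp ht)
  rw [hs0, hsm, weightedHop_one] at h
  simp only [weightedLayer_one] at h
  refine h.trans ?_
  have he : 1 / (N : ℝ) ^ 2 * layerEnergy f x (s 1) +
      ∑ t ∈ Finset.Ico 1 m, 1 / (N : ℝ) ^ 2 * layerEnergy f (s t) (s (t + 1)) =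
      1 / (N : ℝ) ^ 2 * ∑ t ∈ Finset.range m, layerEnergy f (s t) (s (t + 1)) := by
    rw [Finset.range_eq_Ico, ← Finset.sum_Ico_consecutive _ (Nat.zero_le 1) (by omega), mul_add,
      Finset.mul_sum, Finset.mul_sum]
    simp [hs0]
  rw [he]
  have hmL : (m : ℝ) ≤ L := by
    have := y.2
    exact_mod_cast (show m ≤ L by omega)
  have hc : (∑ t ∈ Finset.range m, layerEnergy f (s t) (s (t + 1))) ≤ chainEnergy f := hsum
  have h0 : 0 ≤ ∑ t ∈ Finset.range m, layerEnergy f (s t) (s (t + 1)) :=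
    Finset.sum_nonneg fun _ _ => layerEnergy_nonneg _ _ _
  calc _ ≤ 4 * (L : ℝ) * (1 / (N : ℝ) ^ 2 * chainEnergy f) := by gcongr
    _ = _ := by ring

/-- The mean field exchange energy is compared with that of the chain: each of the `(L N)²` pairs
costs at most `4L/N²` times the energy of the chain, and pairs at the same site cost nothing. -/
lemma sum_hopEnergy_le {f : (Fin k → Fin L × Fin N) → ℝ} (hf : ColourInvariant f) :
    ∑ a, ∑ b, hopEnergy f a b ≤ 4 * (L : ℝ) ^ 3 * chainEnergy f := by
  have hc := chainEnergy_nonneg f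
  have h : ∀ a b : Fin L × Fin N, hopEnergy f a b ≤ 4 * L / (N : ℝ) ^ 2 * chainEnergy f := by
    intro a b
    rcases lt_trichotomy a.1 b.1 with h | h | h
    · exact hopEnergy_le_chainEnergy hf h
    · have : hopEnergy f a b = 0 := by
        refine Finset.sum_eq_zero fun Z _ => ?_
        have : f (Equiv.swap a b ∘ Z) = f Z := by
          have := hf a.1 a.2 b.2 Z
          rwa [Prod.mk.eta, h, Prod.mk.eta] at this
        rw [this]; simp
      rw [this]
      positivity
    · have h1 : hopEnergy f a b = hopEnergy f b a := by
        simp only [hopEnergy, Equiv.swap_comm a b]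
      rw [h1]
      exact hopEnergy_le_chainEnergy hf h
  calc ∑ a, ∑ b, hopEnergy f a b
      ≤ ∑ _a : Fin L × Fin N, ∑ _b : Fin L × Fin N, 4 * L / (N : ℝ) ^ 2 * chainEnergy f :=
        Finset.sum_le_sum fun a _ => Finset.sum_le_sum fun b _ => h a b
    _ ≤ 4 * (L : ℝ) ^ 3 * chainEnergy f := by
        simp only [Finset.sum_const, Finset.card_univ, Fintype.card_prod, Fintype.card_fin,
          nsmul_eq_mul, Nat.cast_mul]
        rcases Nat.eq_zero_or_pos N with h0 | h0
        · subst h0; simp; positivity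
        · have : (N : ℝ) ≠ 0 := by positivity
          apply le_of_eq
          field_simp

end Paths

end

end Heisenberg

namespace Heisenberg

noncomputable section

open Matrix

/-! ### Reduction to few particles by SU(2) symmetry and an energy cut-off. -/

section Truncation

variable {L N k : ℕ}

/-- Extension by zero of a vector in a sector. -/
def extend (v : Sector L N k → ℝ) (σ : Fin L → Fin (N + 1)) : ℝ :=
  if h : total σ = k then v ⟨σ, h⟩ else 0

lemma extend_coe (v : Sector L N k → ℝ) (σ : Sector L N k) : extend v σ = v σ := by
  simp [extend, σ.2]

lemma sum_mul_extend (g : (Fin L → Fin (N + 1)) → ℝ) (v : Sector L N k → ℝ) :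
    ∑ τ, g τ * extend v τ = ∑ τ : Sector L N k, g τ * v τ := by
  rw [← Finset.sum_filter_add_sum_filter_not Finset.univ fun τ => total τ = k]
  have h0 : ∑ τ : Fin L → Fin (N + 1) with ¬ total τ = k, g τ * extend v τ = 0 := by
    refine Finset.sum_eq_zero fun τ hτ => ?_
    have : ¬ total τ = k := by simpa using hτ
    simp [extend, this]
  rw [h0, add_zero, Finset.sum_subtype (p := fun τ => total τ = k) _ (by simp)]
  exact Finset.sum_congr rfl fun τ _ => by rw [extend_coe]

lemma realHam_mulVec_extend (v : Sector L N k → ℝ) :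
    realHam L N *ᵥ extend v = extend (sectorHam L N k *ᵥ v) := by
  funext σ
  rw [mulVec, dotProduct, sum_mul_extend]
  by_cases h : total σ = k
  · simp only [extend, h, dif_pos]
    rfl
  · simp only [extend, h, dif_neg, not_false_eq_true]
    refine Finset.sum_eq_zero fun τ _ => ?_
    rw [realHam_apply_eq_zero (fun hc => h (hc.trans τ.2)), zero_mul]

lemma extend_smul (c : ℝ) (v : Sector L N k → ℝ) : extend (c • v) = c • extend v := by
  funext σ
  simp only [extend, Pi.smul_apply, smul_eq_mul]
  split_ifs <;> simp

lemma sum_lift_extend (v w : Sector L N k → ℝ) :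
    ∑ Z, lift (extend v) k Z * lift (extend w) k Z = k.factorial * (v ⬝ᵥ w) := by
  rw [sum_lift_mul_lift, Finset.sum_subtype (p := fun τ => total τ = k) _ (by simp)]
  congr 1
  exact Finset.sum_congr rfl fun τ _ => by rw [extend_coe, extend_coe]

lemma sum_lift_extend_sq (v : Sector L N k → ℝ) :
    ∑ Z, lift (extend v) k Z ^ 2 = k.factorial * (v ⬝ᵥ v) := by
  rw [← sum_lift_extend]
  exact Finset.sum_congr rfl fun Z _ => sq _

lemma chainEnergy_lift_extend (v : Sector L N k → ℝ) :
    chainEnergy (lift (extend v) k) = 4 * k.factorial * (v ⬝ᵥ sectorHam L N k *ᵥ v) := by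
  have h := sum_lift_realHam (extend v) k
  rw [realHam_mulVec_extend, sum_lift_extend] at h
  linarith

lemma eigenvalues_sectorHam_nonneg (i : Sector L N k) :
    0 ≤ (sectorHam_isHermitian L N k).eigenvalues i := by
  have h := chainEnergy_lift_extend (eigvec (sectorHam_isHermitian L N k) i)
  rw [mulVec_eigvec, dotProduct_smul, eigvec_dotProduct] at h
  have h1 := chainEnergy_nonneg (lift (extend (eigvec (sectorHam_isHermitian L N k) i)) k)
  have h2 : (0 : ℝ) < k.factorial := by exact_mod_cast k.factorial_pos
  simp only [if_true, smul_eq_mul, mul_one] at h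
  rw [h] at h1
  by_contra hc
  push Not at hc
  nlinarith

lemma lift_congr {ψ φ : (Fin L → Fin (N + 1)) → ℝ} (h : ∀ σ, total σ = k → ψ σ = φ σ) :
    lift ψ k = lift φ k := by
  funext Z
  unfold lift
  split_ifs with hZ
  · rw [amp_of_le _ (occ_le hZ), amp_of_le _ (occ_le hZ), h]
    exact sum_occ Z
  · rfl

/-- Lifting is an isometry up to `k!`, hence injective on a sector. Identities between vectors can
therefore be checked on labelled particles. -/
lemma eq_of_lift_extend_eq {v w : Sector L N k → ℝ}
    (h : lift (extend v) k = lift (extend w) k) : v = w := by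
  have h1 := sum_lift_extend_sq (v - w)
  have h2 : lift (extend (v - w)) k = 0 := by
    have : extend (v - w) = extend v - extend w := by
      funext σ
      simp only [extend, Pi.sub_apply]
      split_ifs <;> simp
    funext Z
    rw [this, lift_sub, h]
    simp
  rw [h2] at h1
  simp only [Pi.zero_apply, ne_eq, OfNat.ofNat_ne_zero, not_false_eq_true, zero_pow,
    Finset.sum_const_zero, zero_eq_mul, Nat.cast_eq_zero, k.factorial_ne_zero, false_or] at h1
  exact sub_eq_zero.mp (dotProduct_self_eq_zero.mp h1)

/-- The lowering operator between neighbouring sectors. -/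
def lowerSector (L N k : ℕ) : (Sector L N (k + 1) → ℝ) →ₗ[ℝ] (Sector L N k → ℝ) where
  toFun v := fun σ => (lowering L N *ᵥ extend v) σ
  map_add' v w := by
    have : extend (v + w) = extend v + extend w := by
      funext σ
      simp only [extend, Pi.add_apply]
      split_ifs <;> simp
    funext σ
    simp [this, mulVec_add]
  map_smul' c v := by
    funext σ
    simp [extend_smul, mulVec_smul]

lemma lift_lowerSector (v : Sector L N (k + 1) → ℝ) (Z : Fin k → Fin L × Fin N) :
    lift (extend (lowerSector L N k v)) k Z = ∑ z, lift (extend v) (k + 1) (Fin.cons z Z) := by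
  rw [← lift_lowering]
  refine congrFun (lift_congr fun σ hσ => ?_) Z
  simp [extend, hσ, lowerSector]

lemma swap_comp_cons (π : Equiv.Perm (Fin L × Fin N)) (z : Fin L × Fin N)
    (Z : Fin k → Fin L × Fin N) :
    (Fin.cons (π z) (π ∘ Z) : Fin (k + 1) → Fin L × Fin N) =
      π ∘ (Fin.cons z Z : Fin (k + 1) → Fin L × Fin N) := by
  funext l
  refine Fin.cases ?_ (fun l => ?_) l <;> simp

lemma sum_cons_swap (f : (Fin (k + 1) → Fin L × Fin N) → ℝ) (π : Equiv.Perm (Fin L × Fin N))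
    (Z : Fin k → Fin L × Fin N) :
    ∑ z, f (Fin.cons z (π ∘ Z)) = ∑ z, f (π ∘ (Fin.cons z Z : Fin (k + 1) → Fin L × Fin N)) := by
  rw [← Equiv.sum_comp π]
  exact Finset.sum_congr rfl fun z _ => by rw [swap_comp_cons]

/-- A transposition also moves the particle that is summed out, but this only reindexes the sum. In
this language that is the SU(2) invariance of the Hamiltonian. -/
lemma labelledHam_sum_cons (f : (Fin (k + 1) → Fin L × Fin N) → ℝ) (Z : Fin k → Fin L × Fin N) :
    labelledHam (fun Z => ∑ z, f (Fin.cons z Z)) Z = ∑ z, labelledHam f (Fin.cons z Z) := by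
  simp only [labelledHam]
  refine Eq.trans ?_ Finset.sum_comm
  refine Finset.sum_congr rfl fun x _ => ?_
  refine Eq.trans ?_ Finset.sum_comm
  refine Finset.sum_congr rfl fun y _ => ?_
  split_ifs with h
  · rw [← Finset.mul_sum]
    congr 1
    refine Eq.trans ?_ Finset.sum_comm
    refine Finset.sum_congr rfl fun i _ => ?_
    refine Eq.trans ?_ Finset.sum_comm
    refine Finset.sum_congr rfl fun j _ => ?_
    rw [sum_cons_swap, Finset.sum_sub_distrib]
  · simp

lemma sectorHam_lowerSector (v : Sector L N (k + 1) → ℝ) :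
    sectorHam L N k *ᵥ lowerSector L N k v = lowerSector L N k (sectorHam L N (k + 1) *ᵥ v) := by
  apply eq_of_lift_extend_eq
  have h1 : lift (extend (lowerSector L N k v)) k =
      fun Z => ∑ z, lift (extend v) (k + 1) (Fin.cons z Z) := funext (lift_lowerSector v)
  funext Z
  rw [← realHam_mulVec_extend, lift_realHam, h1, labelledHam_sum_cons, lift_lowerSector]
  rw [← realHam_mulVec_extend, lift_realHam]

/-- The lowering operator sums out the particle with label 0; symmetry in the labels extends the
vanishing to every particle. -/
lemma sum_lift_update_eq_zero {v : Sector L N (k + 1) → ℝ} (hv : lowerSector L N k v = 0)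
    (Z : Fin (k + 1) → Fin L × Fin N) (l : Fin (k + 1)) :
    ∑ b, lift (extend v) (k + 1) (Function.update Z l b) = 0 := by
  have h0 : ∀ Z : Fin (k + 1) → Fin L × Fin N,
      ∑ b, lift (extend v) (k + 1) (Function.update Z 0 b) = 0 := by
    intro Z
    have h := lift_lowerSector v (Fin.tail Z)
    rw [hv] at h
    have hz : extend (0 : Sector L N k → ℝ) = 0 := by
      funext σ
      simp [extend]
    rw [hz, lift_zero] at h
    rw [h]
    refine Finset.sum_congr rfl fun b _ => ?_
    congr 1
    funext m
    refine Fin.cases ?_ (fun m => ?_) m <;> simp [Fin.tail]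
  rw [← h0 (Z ∘ Equiv.swap 0 l)]
  refine Finset.sum_congr rfl fun b _ => ?_
  rw [← lift_comp_perm _ _ (Equiv.swap 0 l)]
  congr 1
  funext m
  simp only [Function.comp_apply, Function.update_apply]
  congr 1
  rw [Equiv.swap_apply_eq_iff, Equiv.swap_apply_right]

/-- For a vector killed by lowering, the values of `f` after moving one particle to all the empty
points add up to `-f Z`. The cross terms in the squares then have the favourable sign, and a term `f
Z ^ 2` remains for each particle and each empty point. -/
lemma sum_hopEnergy_ge {v : Sector L N (k + 1) → ℝ} (hv : lowerSector L N k v = 0) :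
    ((k : ℝ) + 1) * (N * L - (k + 1)) * ∑ Z, lift (extend v) (k + 1) Z ^ 2 ≤
      ∑ a, ∑ b, hopEnergy (lift (extend v) (k + 1)) a b := by
  classical
  set f := lift (extend v) (k + 1)
  have hswap : ∑ a, ∑ b, hopEnergy f a b =
      ∑ Z, ∑ a, ∑ b, (f Z - f (Equiv.swap a b ∘ Z)) ^ 2 := by
    simp only [hopEnergy]
    rw [Finset.sum_comm' (t' := Finset.univ) (s' := fun _ => Finset.univ) (by simp)]
    rw [Finset.sum_congr rfl fun b _ => Finset.sum_comm, Finset.sum_comm]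
    exact Finset.sum_congr rfl fun Z _ => Finset.sum_comm
  rw [hswap, Finset.mul_sum]
  refine Finset.sum_le_sum fun Z _ => ?_
  by_cases hZ : Function.Injective Z
  swap
  · have : f Z = 0 := by simp [f, lift, hZ]
    rw [this]
    simp only [ne_eq, OfNat.ofNat_ne_zero, not_false_eq_true, zero_pow, mul_zero]
    exact Finset.sum_nonneg fun _ _ => Finset.sum_nonneg fun _ _ => sq_nonneg _
  have hl : ∀ l : Fin (k + 1), ((N : ℝ) * L - (k + 1)) * f Z ^ 2 ≤
      ∑ b, (f Z - f (Equiv.swap (Z l) b ∘ Z)) ^ 2 := by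
    intro l
    set S : Finset (Fin L × Fin N) := Finset.univ.image Z
    have hScard : ((Sᶜ).card : ℝ) = N * L - (k + 1) := by
      have h1 : S.card = k + 1 := by
        rw [Finset.card_image_of_injective _ hZ]; simp
      have h2 := Finset.card_add_card_compl S
      rw [h1, Fintype.card_prod, Fintype.card_fin, Fintype.card_fin] at h2
      have h3 : ((k : ℝ) + 1) + (Sᶜ).card = L * N := by exact_mod_cast h2
      linarith
    have hsum := sum_lift_update_eq_zero hv Z l
    rw [← Finset.sum_add_sum_compl S] at hsum
    -- Moving `l` onto another particle destroys injectivity, where `lift` is zero by definition;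
    -- only `b = Z l` is left.
    have hS : ∑ b ∈ S, f (Function.update Z l b) = f Z := by
      rw [Finset.sum_image fun _ _ _ _ h => hZ h, Finset.sum_eq_single l]
      · simp
      · intro m _ hm
        have : ¬ Function.Injective (Function.update Z l (Z m)) := by
          intro h
          exact hm (h (by simp [hm]))
        simp [f, lift, this]
      · simp
    have hupd : ∀ b ∈ Sᶜ, f (Equiv.swap (Z l) b ∘ Z) = f (Function.update Z l b) := by
      intro b hb
      rw [swap_comp_eq_update hZ l b]
      intro m hm
      exact Finset.mem_compl.mp hb (Finset.mem_image.mpr ⟨m, Finset.mem_univ _, hm⟩)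
    calc ((N : ℝ) * L - (k + 1)) * f Z ^ 2
        ≤ ((N : ℝ) * L - (k + 1)) * f Z ^ 2 - 2 * f Z * ∑ b ∈ Sᶜ, f (Function.update Z l b) := by
          have : ∑ b ∈ Sᶜ, f (Function.update Z l b) = - f Z := by
            rw [hS] at hsum
            linarith
          rw [this]
          nlinarith [sq_nonneg (f Z)]
      _ = ∑ b ∈ Sᶜ, (f Z ^ 2 - 2 * f Z * f (Function.update Z l b)) := by
          rw [Finset.sum_sub_distrib, Finset.sum_const, nsmul_eq_mul, hScard, Finset.mul_sum]
      _ ≤ ∑ b ∈ Sᶜ, (f Z - f (Equiv.swap (Z l) b ∘ Z)) ^ 2 := by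
          refine Finset.sum_le_sum fun b hb => ?_
          rw [hupd b hb]
          nlinarith [sq_nonneg (f (Function.update Z l b))]
      _ ≤ _ := Finset.sum_le_sum_of_subset_of_nonneg (Finset.subset_univ _)
          fun _ _ _ => sq_nonneg _
  calc ((k : ℝ) + 1) * (N * L - (k + 1)) * f Z ^ 2
      = ∑ _l : Fin (k + 1), ((N : ℝ) * L - (k + 1)) * f Z ^ 2 := by
        simp only [Finset.sum_const, Finset.card_univ, Fintype.card_fin, nsmul_eq_mul]
        push_cast
        ring
    _ ≤ ∑ l : Fin (k + 1), ∑ b, (f Z - f (Equiv.swap (Z l) b ∘ Z)) ^ 2 :=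
        Finset.sum_le_sum fun l _ => hl l
    _ = ∑ a ∈ Finset.univ.image Z, ∑ b, (f Z - f (Equiv.swap a b ∘ Z)) ^ 2 := by
        rw [Finset.sum_image fun _ _ _ _ h => hZ h]
    _ ≤ _ := Finset.sum_le_sum_of_subset_of_nonneg (Finset.subset_univ _)
        fun _ _ _ => Finset.sum_nonneg fun _ _ => sq_nonneg _

/-- Lowest weight vectors with `k + 1` particles have energy at least of order `k / L²`. -/
theorem gap_of_lowerSector_eq_zero {v : Sector L N (k + 1) → ℝ} {e : ℝ} (hv0 : v ≠ 0)
    (he : sectorHam L N (k + 1) *ᵥ v = e • v) (hv : lowerSector L N k v = 0)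
    (hk : 2 * (k + 1) ≤ N * L) : ((k : ℝ) + 1) * N / (32 * L ^ 2) ≤ e := by
  have h1 := sum_hopEnergy_ge hv
  have h2 := sum_hopEnergy_le (lift_colourInvariant (k := k + 1) (extend v))
  rw [chainEnergy_lift_extend, he, dotProduct_smul, smul_eq_mul] at h2
  rw [sum_lift_extend_sq] at h1
  have hp := dotProduct_self_pos hv0
  have hf : (0 : ℝ) < (k + 1).factorial := by exact_mod_cast (k + 1).factorial_pos
  have hL : (0 : ℝ) < L := by
    have : L ≠ 0 := by rintro rfl; omega
    positivity
  have hk' : 2 * ((k : ℝ) + 1) ≤ N * L := by exact_mod_cast hk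
  set A := ((k + 1).factorial : ℝ) * (v ⬝ᵥ v)
  have hA : 0 < A := mul_pos hf hp
  have h3 : ((k : ℝ) + 1) * (N * L - (k + 1)) * A ≤ 16 * L ^ 3 * e * A := by
    calc _ ≤ _ := h1.trans h2
      _ = _ := by ring
  have h4 := le_of_mul_le_mul_right h3 hA
  rw [div_le_iff₀ (by positivity)]
  -- Up to half filling at least `N * L / 2` points are empty.
  have h5 : ((k : ℝ) + 1) * (N * L / 2) ≤ 16 * L ^ 3 * e :=
    (mul_le_mul_of_nonneg_left (by linarith) (by positivity)).trans h4
  have h6 : (((k : ℝ) + 1) * N) * L ≤ (e * (32 * L ^ 2)) * L := by linarith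
  exact le_of_mul_le_mul_right h6 hL

/-- Contribution of the energies below `E` in the `k`-particle sector to the partition function. -/
def truncSum (L N k : ℕ) (β E : ℝ) : ℝ :=
  ∑ i with (sectorHam_isHermitian L N k).eigenvalues i < E,
    Real.exp (-β * (sectorHam_isHermitian L N k).eigenvalues i)

lemma truncSum_succ_le (β : ℝ) {E : ℝ} (hk : 2 * (k + 1) ≤ N * L)
    (hE : E ≤ ((k : ℝ) + 1) * N / (32 * L ^ 2)) :
    truncSum L N (k + 1) β E ≤ truncSum L N k β E :=
  spectral_sum_le_of_intertwining (sectorHam_isHermitian L N (k + 1)) (sectorHam_isHermitian L N k)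
    (lowerSector L N k) sectorHam_lowerSector E
    (fun _ _ he hv0 heE hv =>
      absurd (gap_of_lowerSector_eq_zero hv0 he hv hk) (not_le.mpr (heE.trans_le hE)))
    (fun x => Real.exp (-β * x)) (fun _ => (Real.exp_pos _).le)

lemma exists_truncSum_le (β E : ℝ) (k : ℕ) (hk : 2 * k ≤ N * L) :
    ∃ k' ≤ k, (k' = 0 ∨ (k' : ℝ) * N / (32 * L ^ 2) < E) ∧
      truncSum L N k β E ≤ truncSum L N k' β E := by
  induction k with
  | zero => exact ⟨0, le_rfl, Or.inl rfl, le_rfl⟩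
  | succ k ih =>
    -- While the gap for lowest weight vectors is at least `E`, lowering is injective on the
    -- eigenspaces below `E` and the particle number can be reduced by one.
    by_cases hE : E ≤ ((k : ℝ) + 1) * N / (32 * L ^ 2)
    · obtain ⟨k', hk', h1, h2⟩ := ih (by omega)
      exact ⟨k', by omega, h1, (truncSum_succ_le β hk hE).trans h2⟩
    · refine ⟨k + 1, le_rfl, Or.inr ?_, le_rfl⟩
      push_cast
      exact not_le.mp hE

/-- Particle-hole transformation. -/
def flip (L N : ℕ) : (Fin L → Fin (N + 1)) ≃ (Fin L → Fin (N + 1)) :=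
  Equiv.arrowCongr (Equiv.refl _) Fin.revPerm

lemma flip_apply (σ : Fin L → Fin (N + 1)) (x : Fin L) : flip L N σ x = (σ x).rev := rfl

lemma onSite_submatrix_flip (x : Fin L) (A : Matrix (Fin (N + 1)) (Fin (N + 1)) ℝ) :
    (onSite x A).submatrix (flip L N) (flip L N) = onSite x (A.submatrix Fin.rev Fin.rev) := by
  ext σ τ
  simp only [onSite, submatrix_apply, of_apply, flip_apply, Fin.rev_inj]

lemma raising_submatrix_rev : (raising N).submatrix Fin.rev Fin.rev = (raising N)ᵀ := by
  ext m n
  have hm := m.2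
  have hn := n.2
  simp only [raising, submatrix_apply, of_apply, transpose_apply, Fin.val_rev]
  by_cases h : (n : ℕ) = m + 1
  · rw [if_pos (by omega), if_pos h]
    congr 1
    rw [Nat.cast_sub (by omega), h]
    push_cast
    ring
  · rw [if_neg (by omega), if_neg h]

lemma spinZ_submatrix_rev : (spinZ N).submatrix Fin.rev Fin.rev = -spinZ N := by
  rw [spinZ, submatrix_diagonal _ _ Fin.rev_injective]
  ext m n
  rw [Matrix.neg_apply]
  by_cases h : m = n
  · subst h
    have hm := m.2
    simp only [diagonal_apply_eq, Function.comp_apply, Fin.val_rev]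
    rw [Nat.cast_sub (by omega)]
    push_cast
    ring
  · simp [diagonal_apply_ne _ h]

lemma onSite_neg (x : Fin L) (A : Matrix (Fin (N + 1)) (Fin (N + 1)) ℝ) :
    onSite x (-A) = -onSite x A := by
  ext σ τ
  simp only [onSite, of_apply, Matrix.neg_apply]
  split_ifs <;> simp

lemma bond_submatrix_flip (x y : Fin L) :
    (bond N x y).submatrix (flip L N) (flip L N) = bond N x y := by
  have hT : (raising N)ᵀ.submatrix Fin.rev Fin.rev = raising N := by
    rw [← transpose_submatrix, raising_submatrix_rev, transpose_transpose]
  have hmul : ∀ A B : Matrix (Fin L → Fin (N + 1)) (Fin L → Fin (N + 1)) ℝ,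
      (A * B).submatrix (flip L N) (flip L N) =
        A.submatrix (flip L N) (flip L N) * B.submatrix (flip L N) (flip L N) := fun A B =>
    (submatrix_mul_equiv A B _ (flip L N) _).symm
  simp only [bond, submatrix_sub, submatrix_add, submatrix_smul, Pi.sub_apply, Pi.add_apply,
    Pi.smul_apply, hmul, onSite_submatrix_flip, raising_submatrix_rev, hT, spinZ_submatrix_rev,
    onSite_neg, neg_mul_neg, submatrix_one_equiv]
  rw [add_comm (onSite x (raising N)ᵀ * _)]

lemma realHam_flip (σ τ : Fin L → Fin (N + 1)) :
    realHam L N (flip L N σ) (flip L N τ) = realHam L N σ τ := by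
  simp only [realHam, Matrix.sum_apply]
  refine Finset.sum_congr rfl fun x _ => Finset.sum_congr rfl fun y _ => ?_
  split_ifs
  · exact congrFun (congrFun (bond_submatrix_flip x y) σ) τ
  · rfl

lemma total_flip (σ : Fin L → Fin (N + 1)) : total (flip L N σ) + total σ = N * L := by
  rw [total, total, ← Finset.sum_add_distrib]
  have : ∀ x, ((flip L N σ x : Fin (N + 1)) : ℕ) + σ x = N := by
    intro x
    have := (σ x).2
    rw [flip_apply, Fin.val_rev]
    omega
  simp [this, mul_comm]

/-- Particle-hole transformation between sectors. -/
def flipSector (hk : k ≤ N * L) : Sector L N (N * L - k) ≃ Sector L N k :=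
  (flip L N).subtypeEquiv fun σ => by
    have := total_flip σ
    have := total_le σ
    omega

/-- Only used to bring sectors beyond half filling, where the gap estimate is not available, below
it. -/
lemma truncSum_le_flip (β E : ℝ) (hk : k ≤ N * L) :
    truncSum L N k β E ≤ truncSum L N (N * L - k) β E := by
  refine spectral_sum_le_of_intertwining (sectorHam_isHermitian L N k)
    (sectorHam_isHermitian L N (N * L - k)) (LinearMap.funLeft ℝ ℝ (flipSector hk)) ?_ E ?_
    (fun x => Real.exp (-β * x)) (fun _ => (Real.exp_pos _).le)
  · intro v
    funext σ
    simp only [mulVec, dotProduct, LinearMap.funLeft_apply]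
    rw [← (flipSector hk).sum_comp]
    refine Finset.sum_congr rfl fun τ _ => ?_
    congr 1
    exact (realHam_flip (σ : Fin L → Fin (N + 1)) τ).symm
  · intro v _ _ hv _ h
    apply hv
    funext σ
    simpa using congrFun h ((flipSector hk).symm σ)

/-- The partition function is controlled by the low-energy part of sectors with few particles. -/
theorem partitionFunction_le_of_truncSum {β E B : ℝ} (hβ : 0 ≤ β)
    (hB : ∀ k, 2 * k ≤ N * L → (k = 0 ∨ (k : ℝ) * N / (32 * L ^ 2) < E) → truncSum L N k β E ≤ B) :
    partitionFunction L β N ≤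
      Real.exp (-(β * E / 2)) * partitionFunction L (β / 2) N + (N * L + 1) * B := by
  have hsec : ∀ k ∈ Finset.range (N * L + 1), truncSum L N k β E ≤ B := by
    intro k hk
    have hk' : k ≤ N * L := Nat.lt_succ_iff.mp (Finset.mem_range.mp hk)
    have main : ∀ k, 2 * k ≤ N * L → truncSum L N k β E ≤ B := by
      intro k hk
      obtain ⟨k', hk', h1, h2⟩ := exists_truncSum_le β E k hk
      exact h2.trans (hB k' (by omega) h1)
    by_cases h : 2 * k ≤ N * L
    · exact main k h
    · exact (truncSum_le_flip β E hk').trans (main _ (by omega))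
  rw [partitionFunction_eq_sum_sectors, partitionFunction_eq_sum_sectors, Finset.mul_sum]
  -- For an eigenvalue `λ ≥ E` one has `exp(-βλ) ≤ exp(-βE/2) exp(-βλ/2)`: high energies are paid
  -- for by the partition function at `β / 2`.
  have hsplit : ∀ k, ∑ i, Real.exp (-β * (sectorHam_isHermitian L N k).eigenvalues i) ≤
      Real.exp (-(β * E / 2)) *
        ∑ i, Real.exp (-(β / 2) * (sectorHam_isHermitian L N k).eigenvalues i) +
      truncSum L N k β E := by
    intro k
    rw [← Finset.sum_filter_add_sum_filter_not Finset.univ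
      fun i => (sectorHam_isHermitian L N k).eigenvalues i < E, add_comm]
    refine add_le_add ?_ le_rfl
    rw [Finset.mul_sum]
    refine le_trans (Finset.sum_le_sum fun i hi => ?_)
      (Finset.sum_le_sum_of_subset_of_nonneg (Finset.subset_univ _)
        fun _ _ _ => mul_nonneg (Real.exp_pos _).le (Real.exp_pos _).le)
    have : E ≤ (sectorHam_isHermitian L N k).eigenvalues i := by simpa using hi
    rw [← Real.exp_add]
    apply Real.exp_le_exp.mpr
    nlinarith
  calc _ ≤ ∑ k ∈ Finset.range (N * L + 1), (Real.exp (-(β * E / 2)) *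
        ∑ i, Real.exp (-(β / 2) * (sectorHam_isHermitian L N k).eigenvalues i) + B) :=
        Finset.sum_le_sum fun k hk => (hsplit k).trans (by linarith [hsec k hk])
    _ = _ := by
        rw [Finset.sum_add_distrib, Finset.sum_const, Finset.card_range, nsmul_eq_mul]
        push_cast
        ring

end Truncation

end

end Heisenberg

namespace Heisenberg

noncomputable section

open Matrix

/-! ### Configurations with colliding particles are rare. -/

section Collisions

variable {L N k : ℕ}

/-- The weight of the configurations in which the site `z` is occupied. -/
def visits (w f : (Fin k → Fin L × Fin N) → ℝ) (z : Fin L × Fin N) : ℝ :=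
  ∑ Z, if ∃ m, Z m = z then (w Z * f Z) ^ 2 else 0

lemma visits_nonneg (w f : (Fin k → Fin L × Fin N) → ℝ) (z : Fin L × Fin N) :
    0 ≤ visits w f z :=
  Finset.sum_nonneg fun _ _ => by split_ifs <;> positivity

/-- The exchange of `z` and `z'` turns occupation of `z` into occupation of `z'`; then `p² ≤ 2q² +
2(p - q)²`. -/
lemma visits_le_swap {w f : (Fin k → Fin L × Fin N) → ℝ} {z z' : Fin L × Fin N}
    (hw : ∀ Z, w (Equiv.swap z z' ∘ Z) = w Z) :
    visits w f z ≤ 2 * visits w f z' + 2 * weightedHop w f z z' := by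
  have h : visits w f z' =
      ∑ Z, if ∃ m, Z m = z then (w Z * f (Equiv.swap z z' ∘ Z)) ^ 2 else 0 := by
    unfold visits
    rw [← sum_comp_perm _ (Equiv.swap z z')]
    refine Finset.sum_congr rfl fun Z _ => ?_
    rw [hw]
    have : (∃ m, (Equiv.swap z z' ∘ Z) m = z') ↔ ∃ m, Z m = z := by
      refine exists_congr fun m => ?_
      rw [Function.comp_apply, Equiv.swap_apply_eq_iff, Equiv.swap_apply_right]
    simp only [this]
  rw [h, weightedHop, visits, Finset.mul_sum, Finset.mul_sum, ← Finset.sum_add_distrib]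
  refine Finset.sum_le_sum fun Z _ => ?_
  split_ifs
  · nlinarith [sq_nonneg (w Z * f Z - 2 * (w Z * f (Equiv.swap z z' ∘ Z)))]
  · positivity

lemma sum_visits_le (w f : (Fin k → Fin L × Fin N) → ℝ) :
    ∑ z, visits w f z ≤ k * ∑ Z, (w Z * f Z) ^ 2 := by
  unfold visits
  rw [Finset.sum_comm, Finset.mul_sum]
  refine Finset.sum_le_sum fun Z _ => ?_
  calc ∑ z, (if ∃ m, Z m = z then (w Z * f Z) ^ 2 else 0)
      ≤ ∑ z, ∑ m, if Z m = z then (w Z * f Z) ^ 2 else 0 := by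
        refine Finset.sum_le_sum fun z _ => ?_
        split_ifs with h
        · obtain ⟨m, hm⟩ := h
          refine le_trans (le_of_eq ?_) (Finset.single_le_sum
            (f := fun m => if Z m = z then (w Z * f Z) ^ 2 else 0) (fun m _ => ?_)
            (Finset.mem_univ m))
          · simp [hm]
          · split_ifs <;> positivity
        · exact Finset.sum_nonneg fun m _ => by split_ifs <;> positivity
    _ = k * (w Z * f Z) ^ 2 := by
        rw [Finset.sum_comm]
        simp

/-- Two sites of the chain are neighbours. -/
def Adjacent (x y : Fin L) : Prop := (x : ℕ) + 1 = y ∨ (y : ℕ) + 1 = x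

instance : DecidableRel (Adjacent (L := L)) := fun x y =>
  inferInstanceAs (Decidable ((x : ℕ) + 1 = y ∨ (y : ℕ) + 1 = x))

/-- Weighted Dirichlet form of the chain, where every bond is counted in both directions. -/
def weightedChain (w f : (Fin k → Fin L × Fin N) → ℝ) : ℝ :=
  ∑ x, ∑ y, if Adjacent x y then weightedLayer w f x y else 0

lemma weightedChain_one (f : (Fin k → Fin L × Fin N) → ℝ) :
    weightedChain (fun _ => 1) f = 2 * chainEnergy f := by
  have h : weightedChain (fun _ => 1) f = chainEnergy f +
      ∑ x : Fin L, ∑ y : Fin L, if (y : ℕ) + 1 = (x : ℕ) then layerEnergy f x y else 0 := by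
    unfold weightedChain chainEnergy
    rw [← Finset.sum_add_distrib]
    refine Finset.sum_congr rfl fun x _ => ?_
    rw [← Finset.sum_add_distrib]
    refine Finset.sum_congr rfl fun y _ => ?_
    rw [weightedLayer_one]
    unfold Adjacent
    by_cases h1 : (x : ℕ) + 1 = y
    · have h2 : ¬ (y : ℕ) + 1 = x := by omega
      simp [h1, h2]
    · simp [h1]
  rw [h, Finset.sum_comm, two_mul]
  congr 1
  refine Finset.sum_congr rfl fun x _ => Finset.sum_congr rfl fun y _ => ?_
  rw [← weightedLayer_one, weightedLayer_comm, weightedLayer_one]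

/-- A one-dimensional Sobolev estimate: the occupation of the first layer is compared with its
average over all points of the next `R` layers. The average is controlled by the total number `k` of
particles, the comparison by the Dirichlet form along the path. `P` excludes points whose exchange
would change the weight. -/
lemma sum_visits_layer_le {w f : (Fin k → Fin L × Fin N) → ℝ} (hf : ColourInvariant f)
    (hN : 1 ≤ N) (P : Fin L × Fin N → Prop) [DecidablePred P]
    (hw : ∀ a b, P a → P b → ∀ Z, w (Equiv.swap a b ∘ Z) = w Z)
    {R : ℕ} (hR : 1 ≤ R) (s : ℕ → Fin L) (hs : ∀ t t', t ≤ R → t' ≤ R → s t = s t' → t = t')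
    (hadj : ∀ t, t < R → Adjacent (s t) (s (t + 1)))
    (hP : ∀ t, 1 ≤ t → t ≤ R → ∀ c, P (s t, c)) :
    ∑ i, (if P (s 0, i) then visits w f (s 0, i) else 0) ≤
      2 * k / R * ∑ Z, (w Z * f Z) ^ 2 + 8 * R / N * weightedChain w f := by
  have hNpos : (0 : ℝ) < N := by exact_mod_cast hN
  have hRpos : (0 : ℝ) < R := by exact_mod_cast hR
  have hpair : ∀ i m j, m ∈ Finset.Icc 1 R →
      (if P (s 0, i) then visits w f (s 0, i) else 0) ≤ 2 * visits w f (s m, j) +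
        8 * R * (weightedHop w f (s 0, i) (s 1, j) +
          ∑ t ∈ Finset.Ico 1 m, (1 / (N : ℝ) ^ 2) * weightedLayer w f (s t) (s (t + 1))) := by
    intro i m j hm
    obtain ⟨hm1, hmR⟩ := Finset.mem_Icc.mp hm
    have hnn : 0 ≤ weightedHop w f (s 0, i) (s 1, j) +
          ∑ t ∈ Finset.Ico 1 m, (1 / (N : ℝ) ^ 2) * weightedLayer w f (s t) (s (t + 1)) :=
      add_nonneg (weightedHop_nonneg _ _ _ _) (Finset.sum_nonneg fun t _ =>
        mul_nonneg (by positivity) (weightedLayer_nonneg _ _ _ _))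
    split_ifs with h0
    · have h1 := visits_le_swap (f := f) (hw _ _ h0 (hP m hm1 hmR j))
      have h2 := weightedHop_layer_path hf P hw m hm1 s
        (fun t t' ht ht' => hs t t' (ht.trans hmR) (ht'.trans hmR)) i j h0
        (fun t ht ht' => hP t ht (ht'.trans hmR))
      have h3 : (m : ℝ) ≤ R := by exact_mod_cast hmR
      nlinarith [mul_le_mul_of_nonneg_right h3 hnn]
    · have := visits_nonneg w f (s m, j)
      positivity
  have hsum := Finset.sum_le_sum fun (m : ℕ) (hm : m ∈ Finset.Icc 1 R) =>
    Finset.sum_le_sum fun (j : Fin N) (_ : j ∈ Finset.univ) =>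
      Finset.sum_le_sum fun (i : Fin N) (_ : i ∈ Finset.univ) => hpair i m j hm
  have hlayers : ∀ m ∈ Finset.Icc 1 R, weightedLayer w f (s 0) (s 1) +
      ∑ t ∈ Finset.Ico 1 m, weightedLayer w f (s t) (s (t + 1)) ≤ weightedChain w f := by
    intro m hm
    obtain ⟨hm1, hmR⟩ := Finset.mem_Icc.mp hm
    have h1 : weightedLayer w f (s 0) (s 1) +
        ∑ t ∈ Finset.Ico 1 m, weightedLayer w f (s t) (s (t + 1)) =
        ∑ t ∈ Finset.range m, weightedLayer w f (s t) (s (t + 1)) := by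
      rw [Finset.range_eq_Ico, Finset.sum_eq_sum_Ico_succ_bot (show 0 < m by omega)]
    rw [h1]
    exact sum_path_le _ (weightedLayer_nonneg w f) Adjacent R s hs hadj _
      fun t ht => (Finset.mem_range.mp ht).trans_le hmR
  have hl : ∑ m ∈ Finset.Icc 1 R, ∑ _j : Fin N, ∑ i,
      (if P (s 0, i) then visits w f (s 0, i) else 0) =
      R * N * ∑ i, (if P (s 0, i) then visits w f (s 0, i) else 0) := by
    simp [mul_assoc]
  have hr : ∑ m ∈ Finset.Icc 1 R, ∑ j, ∑ i, (2 * visits w f (s m, j) +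
      8 * R * (weightedHop w f (s 0, i) (s 1, j) +
        ∑ t ∈ Finset.Ico 1 m, (1 / (N : ℝ) ^ 2) * weightedLayer w f (s t) (s (t + 1)))) =
      2 * N * ∑ m ∈ Finset.Icc 1 R, ∑ j, visits w f (s m, j) +
      8 * R * ∑ m ∈ Finset.Icc 1 R, (weightedLayer w f (s 0) (s 1) +
        ∑ t ∈ Finset.Ico 1 m, weightedLayer w f (s t) (s (t + 1))) := by
    rw [Finset.mul_sum, Finset.mul_sum, ← Finset.sum_add_distrib]
    refine Finset.sum_congr rfl fun m _ => ?_
    have hW : weightedLayer w f (s 0) (s 1) =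
        ∑ j, ∑ i, weightedHop w f (s 0, i) (s 1, j) := Finset.sum_comm
    simp only [Finset.sum_add_distrib, mul_add, ← Finset.mul_sum, hW, Finset.sum_const,
      Finset.card_univ, Fintype.card_fin, nsmul_eq_mul]
    field_simp
  have hv : ∑ m ∈ Finset.Icc 1 R, ∑ j, visits w f (s m, j) ≤ k * ∑ Z, (w Z * f Z) ^ 2 := by
    refine le_trans ?_ (sum_visits_le w f)
    rw [Fintype.sum_prod_type]
    rw [← Finset.sum_image (s := Finset.Icc 1 R) (g := s)
      (f := fun x => ∑ j, visits w f (x, j))]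
    · exact Finset.sum_le_sum_of_subset_of_nonneg (Finset.subset_univ _)
        fun x _ _ => Finset.sum_nonneg fun j _ => visits_nonneg _ _ _
    · intro t ht t' ht' h
      exact hs t t' (Finset.mem_Icc.mp ht).2 (Finset.mem_Icc.mp ht').2 h
  have hc := Finset.sum_le_sum hlayers
  rw [Finset.sum_const, Nat.card_Icc, nsmul_eq_mul, Nat.add_sub_cancel] at hc
  rw [hl, hr] at hsum
  have hfin : R * N * ∑ i, (if P (s 0, i) then visits w f (s 0, i) else 0) ≤
      R * N * (2 * k / R * ∑ Z, (w Z * f Z) ^ 2 + 8 * R / N * weightedChain w f) := by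
    calc _ ≤ _ := hsum
      _ ≤ 2 * N * (k * ∑ Z, (w Z * f Z) ^ 2) + 8 * R * (R * weightedChain w f) := by gcongr
      _ = _ := by field_simp
  exact le_of_mul_le_mul_left hfin (by positivity)

/-- Two particles are at the same or at neighbouring sites of the chain. -/
def Colliding (Z : Fin k → Fin L × Fin N) : Prop :=
  ∃ l m, l ≠ m ∧ ((Z l).1 : ℕ) ≤ (Z m).1 ∧ ((Z m).1 : ℕ) ≤ (Z l).1 + 1

instance : DecidablePred (Colliding (L := L) (N := N) (k := k)) := fun Z =>
  inferInstanceAs (Decidable (∃ l m, l ≠ m ∧ ((Z l).1 : ℕ) ≤ (Z m).1 ∧ ((Z m).1 : ℕ) ≤ (Z l).1 + 1))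

/-- The path of sites starting `c` sites away from `x` and leading away from `x` towards the more
distant end of the chain. -/
def escape (x : Fin L) (c t : ℕ) : Fin L :=
  -- The minimum only keeps the value in range; it is inactive for the parameters in use, see
  -- `escape_val`.
  if 2 * (x : ℕ) < L then ⟨min (x + c + t) (L - 1), by have := x.2; omega⟩
  else ⟨x - c - t, by have := x.2; omega⟩

lemma escape_val {x : Fin L} {c t R : ℕ} (hc : c < 2) (hR : 2 * R + 3 ≤ L) (ht : t ≤ R) :
    ((escape x c t : Fin L) : ℕ) = if 2 * (x : ℕ) < L then (x : ℕ) + c + t else x - c - t := by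
  have := x.2
  unfold escape
  split_ifs with h
  · simp only
    omega
  · rfl

/-- A collision is recorded by pinning one particle `l` at its point `u` and by a second occupied
point, either at the same site or one step from it in the direction of escape. -/
lemma sum_colliding_le_sum_visits {f : (Fin k → Fin L × Fin N) → ℝ}
    (hinj : ∀ Z, ¬ Function.Injective Z → f Z = 0) {R : ℕ} (hR : 2 * R + 3 ≤ L) :
    ∑ Z with Colliding Z, f Z ^ 2 ≤
      ∑ q : (Fin k × (Fin L × Fin N)) × Fin 2, ∑ i,
        if (escape q.1.2.1 q.2 0, i) ≠ q.1.2 then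
          visits (fun Z => if Z q.1.1 = q.1.2 then 1 else 0) f (escape q.1.2.1 q.2 0, i)
        else 0 := by
  have h : ∀ (q : (Fin k × (Fin L × Fin N)) × Fin 2) (i : Fin N),
      (if (escape q.1.2.1 q.2 0, i) ≠ q.1.2 then
        visits (fun Z => if Z q.1.1 = q.1.2 then 1 else 0) f (escape q.1.2.1 q.2 0, i)
      else 0) = ∑ Z : Fin k → Fin L × Fin N, if (escape q.1.2.1 q.2 0, i) ≠ q.1.2 ∧
        (∃ m, Z m = (escape q.1.2.1 q.2 0, i)) ∧ Z q.1.1 = q.1.2 then f Z ^ 2 else 0 := by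
    intro q i
    by_cases h1 : (escape q.1.2.1 q.2 0, i) ≠ q.1.2
    · simp only [h1, ne_eq, not_false_eq_true, if_true, visits, true_and]
      refine Finset.sum_congr rfl fun Z _ => ?_
      by_cases h2 : ∃ m, Z m = (escape q.1.2.1 q.2 0, i) <;> by_cases h3 : Z q.1.1 = q.1.2 <;>
        simp [h2, h3]
    · simp [h1]
  simp only [h]
  rw [← Fintype.sum_prod_type', Finset.sum_comm, Finset.sum_filter]
  refine Finset.sum_le_sum fun Z _ => ?_
  have hnn : ∀ q ∈ (Finset.univ : Finset (((Fin k × (Fin L × Fin N)) × Fin 2) × Fin N)),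
      0 ≤ if (escape q.1.1.2.1 q.1.2 0, q.2) ≠ q.1.1.2 ∧
        (∃ m, Z m = (escape q.1.1.2.1 q.1.2 0, q.2)) ∧ Z q.1.1.1 = q.1.1.2
        then f Z ^ 2 else 0 := by
    intro q _
    split_ifs <;> positivity
  split_ifs with hZ
  · by_cases hi : Function.Injective Z
    · have key : ∀ (l m : Fin k) (c : Fin 2), l ≠ m → escape (Z l).1 c 0 = (Z m).1 →
          f Z ^ 2 ≤ ∑ q : ((Fin k × (Fin L × Fin N)) × Fin 2) × Fin N,
          if (escape q.1.1.2.1 q.1.2 0, q.2) ≠ q.1.1.2 ∧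
            (∃ m, Z m = (escape q.1.1.2.1 q.1.2 0, q.2)) ∧ Z q.1.1.1 = q.1.1.2
            then f Z ^ 2 else 0 := by
        intro l m c hlm he
        refine le_trans (le_of_eq ?_) (Finset.single_le_sum hnn
          (Finset.mem_univ (((l, Z l), c), (Z m).2)))
        simp only [he]
        have h1 : Z m ≠ Z l := fun h => hlm (hi h).symm
        simp [h1]
      obtain ⟨l, m, hlm, h1, h2⟩ := hZ
      have hb := (Z m).1.2
      -- In the left half the left particle is pinned and the other one can escape to the right.
      -- Otherwise the right particle is pinned and the other one escapes to the left.
      by_cases hhalf : 2 * ((Z l).1 : ℕ) < L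
      · refine key l m ⟨(Z m).1 - (Z l).1, by omega⟩ hlm (Fin.ext ?_)
        rw [escape_val (by simp only; omega) hR (Nat.zero_le R), if_pos hhalf]
        simp only
        omega
      · refine key m l ⟨(Z m).1 - (Z l).1, by omega⟩ hlm.symm (Fin.ext ?_)
        rw [escape_val (by simp only; omega) hR (Nat.zero_le R), if_neg (by omega)]
        simp only
        omega
    · rw [hinj Z hi]
      simp
  · exact Finset.sum_nonneg hnn

/-- Configurations with colliding particles carry little weight. -/
theorem sum_colliding_le {f : (Fin k → Fin L × Fin N) → ℝ} (hf : ColourInvariant f)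
    (hinj : ∀ Z, ¬ Function.Injective Z → f Z = 0) (hN : 1 ≤ N) {R : ℕ} (hR1 : 1 ≤ R)
    (hR : 2 * R + 3 ≤ L) :
    ∑ Z with Colliding Z, f Z ^ 2 ≤
      4 * (k : ℝ) ^ 2 / R * ∑ Z, f Z ^ 2 + 32 * R * k / N * chainEnergy f := by
  refine (sum_colliding_le_sum_visits hinj hR).trans ?_
  have hstep : ∀ q : (Fin k × (Fin L × Fin N)) × Fin 2,
      (∑ i, if (escape q.1.2.1 q.2 0, i) ≠ q.1.2 then
        visits (fun Z => if Z q.1.1 = q.1.2 then 1 else 0) f (escape q.1.2.1 q.2 0, i)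
      else 0) ≤ 2 * k / R * ∑ Z, ((if Z q.1.1 = q.1.2 then 1 else 0) * f Z) ^ 2 +
        8 * R / N * weightedChain (fun Z => if Z q.1.1 = q.1.2 then 1 else 0) f := by
    rintro ⟨⟨l, u⟩, c⟩
    have hv : ∀ t, t ≤ R → ((escape u.1 c t : Fin L) : ℕ) =
        if 2 * (u.1 : ℕ) < L then (u.1 : ℕ) + c + t else u.1 - c - t :=
      fun t ht => escape_val c.2 hR ht
    have hu := u.1.2
    have hc := c.2
    -- The weight fixes particle `l` at `u`, so it is invariant under exchanges avoiding `u`. After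
    -- its start the path never meets the site of `u`.
    refine sum_visits_layer_le hf hN (fun a => a ≠ u) ?_ hR1 (escape u.1 c) ?_ ?_ ?_
    · intro a b ha hb Z
      simp only [Function.comp_apply, Equiv.swap_apply_eq_iff,
        Equiv.swap_apply_of_ne_of_ne (Ne.symm ha) (Ne.symm hb)]
    · intro t t' ht ht' h
      have h' := congrArg Fin.val h
      rw [hv t ht, hv t' ht'] at h'
      split_ifs at h' <;> omega
    · intro t ht
      unfold Adjacent
      rw [hv t ht.le, hv (t + 1) ht]
      split_ifs <;> omega
    · intro t ht1 ht c' h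
      have h' := congrArg (fun a : Fin L × Fin N => (a.1 : ℕ)) h
      simp only at h'
      rw [hv t ht] at h'
      split_ifs at h' <;> omega
  refine (Finset.sum_le_sum fun q _ => hstep q).trans (le_of_eq ?_)
  -- For each label the pinning indicators add up to 1 over the points `u`, so the sum costs only a
  -- factor `k`.
  have hcount : ∀ g : (Fin k → Fin L × Fin N) → ℝ,
      ∑ q : Fin k × (Fin L × Fin N), ∑ Z, ((if Z q.1 = q.2 then 1 else 0) * g Z) ^ 2 =
        k * ∑ Z, g Z ^ 2 := by
    intro g
    rw [Finset.sum_comm, Finset.mul_sum]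
    refine Finset.sum_congr rfl fun Z _ => ?_
    rw [Fintype.sum_prod_type]
    simp
  have hchain : ∑ q : Fin k × (Fin L × Fin N),
      weightedChain (fun Z => if Z q.1 = q.2 then 1 else 0) f = k * (2 * chainEnergy f) := by
    rw [← weightedChain_one]
    unfold weightedChain
    rw [Finset.sum_comm, Finset.mul_sum]
    refine Finset.sum_congr rfl fun x _ => ?_
    rw [Finset.sum_comm, Finset.mul_sum]
    refine Finset.sum_congr rfl fun y _ => ?_
    split_ifs
    · unfold weightedLayer
      rw [Finset.sum_comm, Finset.mul_sum]
      refine Finset.sum_congr rfl fun i _ => ?_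
      rw [Finset.sum_comm, Finset.mul_sum]
      refine Finset.sum_congr rfl fun j _ => ?_
      unfold weightedHop
      rw [hcount]
      simp
    · simp
  rw [Finset.sum_add_distrib, ← Finset.mul_sum, ← Finset.mul_sum, Fintype.sum_prod_type_right,
    Fintype.sum_prod_type_right, Finset.sum_congr rfl fun c _ => hcount f,
    Finset.sum_congr rfl fun c _ => hchain]
  simp only [Finset.sum_const, Finset.card_univ, Fintype.card_fin, nsmul_eq_mul]
  push_cast
  ring

end Collisions

end

end Heisenberg

namespace Heisenberg

noncomputable section

open Matrix

/-! ### Spectrum of the Neumann Laplacian of a path. -/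

section PathModes

variable {n : ℕ}

/-- The Laplacian of the path with `n` sites. -/
def pathLap (g : Fin n → ℝ) (x : Fin n) : ℝ := ∑ z, if Adjacent x z then g x - g z else 0

lemma adjacent_comm (x y : Fin n) : Adjacent x y ↔ Adjacent y x := by
  unfold Adjacent
  exact or_comm

/-- The `p`-th eigenvalue of the Laplacian of the path with `n` sites. -/
def pathFreq (n p : ℕ) : ℝ := 2 - 2 * Real.cos (Real.pi * p / n)

/-- The `p`-th eigenfunction of the Laplacian of the path with `n` sites. -/
def pathMode (n p : ℕ) (x : ℝ) : ℝ := Real.cos (Real.pi * p / n * (x + 1 / 2))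

lemma pathMode_add_pathMode (p : ℕ) (x : ℝ) :
    pathMode n p (x - 1) + pathMode n p (x + 1) = (2 - pathFreq n p) * pathMode n p x := by
  unfold pathMode pathFreq
  set θ := Real.pi * p / n
  have h1 : θ * (x - 1 + 1 / 2) = θ * (x + 1 / 2) - θ := by ring
  have h2 : θ * (x + 1 + 1 / 2) = θ * (x + 1 / 2) + θ := by ring
  rw [h1, h2, Real.cos_sub, Real.cos_add]
  ring

/-- The cosine is even about `-1/2`, and in `pathMode_right` about `n - 1/2`. A missing neighbour at
an end can therefore be replaced by a fictitious one with the same value, and the bulk recursion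
holds at all sites. -/
lemma pathMode_left (p : ℕ) : pathMode n p (0 - 1) = pathMode n p 0 := by
  unfold pathMode
  rw [← Real.cos_neg]
  congr 1
  ring

lemma pathMode_right (hn : n ≠ 0) (p : ℕ) :
    pathMode n p (((n : ℝ) - 1) + 1) = pathMode n p ((n : ℝ) - 1) := by
  have hn' : (n : ℝ) ≠ 0 := by exact_mod_cast hn
  unfold pathMode
  set θ := Real.pi * p / n with hθ
  have h : θ * ((n : ℝ) - 1 + 1 + 1 / 2) = (p : ℝ) * (2 * Real.pi) - θ * ((n : ℝ) - 1 + 1 / 2) := by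
    rw [hθ]
    field_simp
    ring
  rw [h, Real.cos_nat_mul_two_pi_sub]

lemma sum_adjacent (g : Fin n → ℝ) (F : ℝ → ℝ) (hF : ∀ z : Fin n, g z = F (z : ℕ)) (x : Fin n)
    (hl : F (0 - 1) = F 0) (hr : F (((n : ℝ) - 1) + 1) = F ((n : ℝ) - 1)) :
    ∑ z, (if Adjacent x z then g x - g z else 0) =
      (F (x : ℕ) - F ((x : ℕ) - 1)) + (F (x : ℕ) - F ((x : ℕ) + 1)) := by
  have hx := x.2
  have hsplit : ∀ z : Fin n, (if Adjacent x z then g x - g z else 0) =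
      (if (z : ℕ) + 1 = x then g x - g z else 0) + if (x : ℕ) + 1 = z then g x - g z else 0 := by
    intro z
    unfold Adjacent
    by_cases h1 : (x : ℕ) + 1 = z
    · have h2 : ¬ (z : ℕ) + 1 = x := by omega
      simp [h1, h2]
    · simp [h1]
  simp only [hsplit, Finset.sum_add_distrib]
  congr 1
  · by_cases h0 : (x : ℕ) = 0
    · rw [Finset.sum_eq_zero, h0, Nat.cast_zero, hl, sub_self]
      intro z _
      rw [if_neg (by omega)]
    · rw [Finset.sum_eq_single (⟨x - 1, by omega⟩ : Fin n), if_pos (by simp only; omega), hF, hF]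
      · simp only
        rw [Nat.cast_sub (by omega), Nat.cast_one]
      · intro z _ hz
        rw [if_neg fun h => hz (Fin.ext (by simp only; omega))]
      · simp
  · by_cases h0 : (x : ℕ) + 1 = n
    · rw [Finset.sum_eq_zero]
      · have : ((x : ℕ) : ℝ) = (n : ℝ) - 1 := by
          have h0' : ((x : ℕ) : ℝ) + 1 = n := by exact_mod_cast h0
          linarith
        rw [this, hr, sub_self]
      · intro z _
        rw [if_neg (by have := z.2; omega)]
    · rw [Finset.sum_eq_single (⟨x + 1, by omega⟩ : Fin n), if_pos rfl, hF, hF]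
      · simp
      · intro z _ hz
        rw [if_neg fun h => hz (Fin.ext (by simp only; omega))]
      · simp

lemma pathLap_pathMode (p : ℕ) (x : Fin n) :
    pathLap (fun z : Fin n => pathMode n p (z : ℕ)) x = pathFreq n p * pathMode n p (x : ℕ) := by
  have hn : n ≠ 0 := by have := x.2; omega
  unfold pathLap
  rw [sum_adjacent _ (pathMode n p) (fun _ => rfl) x (pathMode_left p) (pathMode_right hn p)]
  have := pathMode_add_pathMode (n := n) p (x : ℕ)
  linarith

lemma sum_adjacent_antisymm (H : Fin n → Fin n → ℝ) (hH : ∀ x z, H z x = - H x z) :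
    ∑ x, ∑ z, (if Adjacent x z then H x z else 0) = 0 := by
  have h : ∑ x, ∑ z, (if Adjacent x z then H x z else 0) =
      - ∑ x, ∑ z, (if Adjacent x z then H x z else 0) := by
    conv_lhs => rw [Finset.sum_comm]
    rw [← Finset.sum_neg_distrib]
    refine Finset.sum_congr rfl fun x _ => ?_
    rw [← Finset.sum_neg_distrib]
    refine Finset.sum_congr rfl fun z _ => ?_
    simp only [adjacent_comm z x, hH x z]
    split_ifs <;> simp
  linarith

lemma sum_mul_pathLap (f g : Fin n → ℝ) : ∑ x, f x * pathLap g x = ∑ x, pathLap f x * g x := by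
  rw [← sub_eq_zero, ← Finset.sum_sub_distrib]
  rw [← sum_adjacent_antisymm (fun x z => f z * g x - f x * g z) (by intros; ring)]
  refine Finset.sum_congr rfl fun x _ => ?_
  unfold pathLap
  rw [Finset.mul_sum, Finset.sum_mul, ← Finset.sum_sub_distrib]
  refine Finset.sum_congr rfl fun z _ => ?_
  split_ifs <;> ring

lemma pathFreq_injective {p q : ℕ} (hp : p < n) (hq : q < n) (h : pathFreq n p = pathFreq n q) :
    p = q := by
  have hn : (0 : ℝ) < n := by exact_mod_cast (Nat.zero_le p).trans_lt hp
  have hmem : ∀ r : ℕ, r < n → Real.pi * r / n ∈ Set.Icc 0 Real.pi := by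
    intro r hr
    refine ⟨by positivity, ?_⟩
    rw [div_le_iff₀ hn]
    have : (r : ℝ) ≤ n := by exact_mod_cast hr.le
    exact mul_le_mul_of_nonneg_left this Real.pi_pos.le
  unfold pathFreq at h
  have h1 := Real.injOn_cos (hmem p hp) (hmem q hq) (by linarith)
  rw [div_left_inj' hn.ne'] at h1
  exact_mod_cast mul_left_cancel₀ Real.pi_ne_zero h1

/-- The Laplacian of a path is diagonalised by an orthogonal matrix. -/
lemma exists_pathBasis (n : ℕ) : ∃ U : Matrix (Fin n) (Fin n) ℝ, Uᵀ * U = 1 ∧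
    ∀ p x, pathLap (U p) x = pathFreq n p * U p x := by
  let u : Fin n → Fin n → ℝ := fun p x => pathMode n p (x : ℕ)
  let c : Fin n → ℝ := fun p => (Real.sqrt (∑ x, u p x ^ 2))⁻¹
  have hpos : ∀ p, 0 < ∑ x, u p x ^ 2 := by
    intro p
    have hn : (0 : ℝ) < n := by exact_mod_cast (Nat.zero_le _).trans_lt p.2
    -- A mode does not vanish identically: at `x = 0` its argument is `πp/(2n) < π/2`.
    refine Finset.sum_pos' (fun x _ => sq_nonneg _)
      ⟨⟨0, (Nat.zero_le _).trans_lt p.2⟩, Finset.mem_univ _, pow_pos ?_ 2⟩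
    refine Real.cos_pos_of_mem_Ioo ⟨?_, ?_⟩
    · have : 0 ≤ Real.pi * (p : ℕ) / n * (((0 : ℕ) : ℝ) + 1 / 2) := by positivity
      linarith [Real.pi_pos]
    · have h1 : ((p : ℕ) : ℝ) / n < 1 := by
        rw [div_lt_one hn]
        exact_mod_cast p.2
      have h2 : Real.pi * (p : ℕ) / n * (((0 : ℕ) : ℝ) + 1 / 2) =
          (Real.pi / 2) * (((p : ℕ) : ℝ) / n) := by
        push_cast
        ring
      rw [h2]
      nlinarith [Real.pi_pos]
  have heig : ∀ p x, pathLap (u p) x = pathFreq n p * u p x := fun p x => pathLap_pathMode p x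
  have horth : ∀ p q, p ≠ q → ∑ x, u p x * u q x = 0 := by
    intro p q hpq
    have h := sum_mul_pathLap (u p) (u q)
    have h1 : ∑ x, u p x * pathLap (u q) x = pathFreq n q * ∑ x, u p x * u q x := by
      rw [Finset.mul_sum]
      exact Finset.sum_congr rfl fun x _ => by rw [heig]; ring
    have h2 : ∑ x, pathLap (u p) x * u q x = pathFreq n p * ∑ x, u p x * u q x := by
      rw [Finset.mul_sum]
      exact Finset.sum_congr rfl fun x _ => by rw [heig]; ring
    rw [h1, h2, ← sub_eq_zero, ← sub_mul] at h
    rcases mul_eq_zero.mp h with h | h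
    · exact absurd (Fin.ext (pathFreq_injective q.2 p.2 (sub_eq_zero.mp h))).symm hpq
    · exact h
  refine ⟨Matrix.of fun p x => c p * u p x, ?_, ?_⟩
  · rw [Matrix.mul_eq_one_comm_of_equiv (Equiv.refl _)]
    ext p q
    rw [Matrix.mul_apply]
    have h : ∑ x, (Matrix.of fun p x => c p * u p x) p x * (Matrix.of fun p x => c p * u p x)ᵀ x q =
        c p * c q * ∑ x, u p x * u q x := by
      rw [Finset.mul_sum]
      refine Finset.sum_congr rfl fun x _ => ?_
      simp only [Matrix.transpose_apply, Matrix.of_apply]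
      ring
    rw [h]
    by_cases hpq : p = q
    · subst hpq
      have hs := Real.mul_self_sqrt (hpos p).le
      have hs0 : Real.sqrt (∑ x, u p x ^ 2) ≠ 0 := (Real.sqrt_pos.mpr (hpos p)).ne'
      have : ∑ x, u p x * u p x = ∑ x, u p x ^ 2 := Finset.sum_congr rfl fun x _ => (sq _).symm
      rw [this, Matrix.one_apply_eq]
      simp only [c]
      nth_rewrite 3 [← hs]
      field_simp
    · rw [horth p q hpq, Matrix.one_apply_ne hpq, mul_zero]
  · intro p x
    have : pathLap (fun x => c p * u p x) x = c p * pathLap (u p) x := by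
      unfold pathLap
      rw [Finset.mul_sum]
      refine Finset.sum_congr rfl fun z _ => ?_
      split_ifs <;> ring
    change pathLap (fun x => c p * u p x) x = pathFreq n p * (c p * u p x)
    rw [this, heig]
    ring

/-- An orthogonal matrix diagonalising the Laplacian of the path with `n` sites. -/
def pathBasis (n : ℕ) : Matrix (Fin n) (Fin n) ℝ := (exists_pathBasis n).choose

lemma pathBasis_orthogonal (n : ℕ) : (pathBasis n)ᵀ * pathBasis n = 1 :=
  (exists_pathBasis n).choose_spec.1

lemma pathLap_pathBasis (p x : Fin n) :
    pathLap (pathBasis n p) x = pathFreq n p * pathBasis n p x :=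
  (exists_pathBasis n).choose_spec.2 p x

end PathModes

/-! ### The Dirichlet form of several particles on a path in product modes. -/

section Cube

variable {n k : ℕ}

/-- The coefficients of a function on the cube with respect to the product basis. -/
def cubeCoeff (G : (Fin k → Fin n) → ℝ) (P : Fin k → Fin n) : ℝ :=
  ∑ y, (∏ i, pathBasis n (P i) (y i)) * G y

lemma sum_cubeCoeff_mul (F G : (Fin k → Fin n) → ℝ) :
    ∑ P, cubeCoeff F P * cubeCoeff G P = ∑ y, F y * G y := by
  have h : ∀ y y' : Fin k → Fin n,
      ∑ P : Fin k → Fin n, ∏ i, (pathBasis n (P i) (y i) * pathBasis n (P i) (y' i)) =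
        if y = y' then 1 else 0 := by
    intro y y'
    rw [← Fintype.prod_sum fun i p => pathBasis n p (y i) * pathBasis n p (y' i)]
    have h1 : ∀ i, ∑ p, pathBasis n p (y i) * pathBasis n p (y' i) =
        if y i = y' i then 1 else 0 := by
      intro i
      have := congrFun (congrFun (pathBasis_orthogonal n) (y i)) (y' i)
      rw [Matrix.mul_apply, Matrix.one_apply] at this
      exact this
    simp only [h1]
    by_cases hy : y = y'
    · simp [hy]
    · obtain ⟨i, hi⟩ := Function.ne_iff.mp hy
      rw [if_neg hy]
      exact Finset.prod_eq_zero (Finset.mem_univ i) (if_neg hi)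
  calc ∑ P, cubeCoeff F P * cubeCoeff G P
      = ∑ P : Fin k → Fin n, ∑ y, ∑ y', (F y * G y') *
          ∏ i, (pathBasis n (P i) (y i) * pathBasis n (P i) (y' i)) := by
        refine Finset.sum_congr rfl fun P _ => ?_
        unfold cubeCoeff
        rw [Finset.sum_mul_sum]
        refine Finset.sum_congr rfl fun y _ => Finset.sum_congr rfl fun y' _ => ?_
        rw [Finset.prod_mul_distrib]
        ring
    _ = ∑ y, ∑ y', (F y * G y') * if y = y' then 1 else 0 := by
        rw [Finset.sum_comm]
        refine Finset.sum_congr rfl fun y _ => ?_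
        rw [Finset.sum_comm]
        refine Finset.sum_congr rfl fun y' _ => ?_
        rw [← Finset.mul_sum, h]
    _ = ∑ y, F y * G y := by simp

/-- The Laplacian in the direction of the coordinate `i`. -/
def dirLap (i : Fin k) (G : (Fin k → Fin n) → ℝ) (y : Fin k → Fin n) : ℝ :=
  ∑ z, if Adjacent (y i) z then G y - G (Function.update y i z) else 0

/-- The Dirichlet form of the cube. -/
def cubeEnergy (G : (Fin k → Fin n) → ℝ) : ℝ :=
  ∑ i, ∑ y : Fin k → Fin n, ∑ z : Fin n, if (y i : ℕ) + 1 = z then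
    (G (Function.update y i z) - G y) ^ 2 else 0

/-- Exchange of a site of the cube with its neighbour in the direction of `i`. -/
def updateEquiv (i : Fin k) : (Fin k → Fin n) × Fin n ≃ (Fin k → Fin n) × Fin n :=
  Function.Involutive.toPerm (fun q => (Function.update q.1 i q.2, q.1 i)) fun q => by simp

lemma sum_update_comm (i : Fin k) (H : (Fin k → Fin n) → Fin n → ℝ) :
    ∑ y, ∑ z, H y z = ∑ y : Fin k → Fin n, ∑ z, H (Function.update y i z) (y i) := by
  rw [← Fintype.sum_prod_type', ← Fintype.sum_prod_type']
  exact ((updateEquiv i).sum_comp fun q => H q.1 q.2).symm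

lemma sum_mul_dirLap_comm (i : Fin k) (F G : (Fin k → Fin n) → ℝ) :
    ∑ y, F y * dirLap i G y = ∑ y, dirLap i F y * G y := by
  have h : ∀ F G : (Fin k → Fin n) → ℝ, ∑ y, F y * dirLap i G y =
      ∑ y, ∑ z, (if Adjacent (y i) z then F y * G y else 0) -
        ∑ y, ∑ z, if Adjacent (y i) z then F y * G (Function.update y i z) else 0 := by
    intro F G
    rw [← Finset.sum_sub_distrib]
    refine Finset.sum_congr rfl fun y _ => ?_
    rw [dirLap, Finset.mul_sum, ← Finset.sum_sub_distrib]
    refine Finset.sum_congr rfl fun z _ => ?_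
    split_ifs <;> ring
  have h' : ∑ y, dirLap i F y * G y = ∑ y, G y * dirLap i F y :=
    Finset.sum_congr rfl fun y _ => mul_comm _ _
  rw [h', h, h, sum_update_comm i fun y z => if Adjacent (y i) z then
    F y * G (Function.update y i z) else 0]
  simp only [Function.update_self, Function.update_idem, Function.update_eq_self, mul_comm (G _),
    adjacent_comm (n := n)]

lemma sum_mul_dirLap_self (i : Fin k) (G : (Fin k → Fin n) → ℝ) :
    ∑ y, G y * dirLap i G y = ∑ y : Fin k → Fin n, ∑ z : Fin n, if (y i : ℕ) + 1 = z then
      (G (Function.update y i z) - G y) ^ 2 else 0 := by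
  have h1 : ∑ y, G y * dirLap i G y =
      ∑ y, ∑ z : Fin n, ((if (y i : ℕ) + 1 = z then G y * (G y - G (Function.update y i z)) else 0) +
        if (z : ℕ) + 1 = y i then G y * (G y - G (Function.update y i z)) else 0) := by
    refine Finset.sum_congr rfl fun y _ => ?_
    rw [dirLap, Finset.mul_sum]
    refine Finset.sum_congr rfl fun z _ => ?_
    unfold Adjacent
    by_cases h1 : (y i : ℕ) + 1 = z
    · have h2 : ¬ (z : ℕ) + 1 = y i := by omega
      simp [h1, h2]
    · simp [h1]
  rw [h1]
  simp only [Finset.sum_add_distrib]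
  rw [sum_update_comm i fun y z => if (z : ℕ) + 1 = y i then
    G y * (G y - G (Function.update y i z)) else 0, ← Finset.sum_add_distrib]
  refine Finset.sum_congr rfl fun y _ => ?_
  rw [← Finset.sum_add_distrib]
  refine Finset.sum_congr rfl fun z _ => ?_
  simp only [Function.update_self, Function.update_idem, Function.update_eq_self]
  split_ifs <;> ring

lemma cubeCoeff_dirLap (i : Fin k) (G : (Fin k → Fin n) → ℝ) (P : Fin k → Fin n) :
    cubeCoeff (dirLap i G) P = pathFreq n (P i) * cubeCoeff G P := by
  unfold cubeCoeff
  rw [sum_mul_dirLap_comm, Finset.mul_sum]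
  refine Finset.sum_congr rfl fun y _ => ?_
  rw [← mul_assoc]
  congr 1
  have h : ∀ z, ∏ j, pathBasis n (P j) (Function.update y i z j) =
      pathBasis n (P i) z * ∏ j ∈ Finset.univ.erase i, pathBasis n (P j) (y j) := by
    intro z
    rw [← Finset.mul_prod_erase _ _ (Finset.mem_univ i), Function.update_self]
    congr 1
    refine Finset.prod_congr rfl fun j hj => ?_
    rw [Function.update_of_ne (Finset.ne_of_mem_erase hj)]
  have h0 := h (y i)
  rw [Function.update_eq_self] at h0
  have hp := pathLap_pathBasis (P i) (y i)
  unfold dirLap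
  simp only [h, h0]
  rw [← mul_assoc, ← hp, pathLap, Finset.sum_mul]
  refine Finset.sum_congr rfl fun z _ => ?_
  split_ifs <;> ring

lemma cubeEnergy_eq_sum (G : (Fin k → Fin n) → ℝ) :
    cubeEnergy G = ∑ P, (∑ i, pathFreq n (P i)) * cubeCoeff G P ^ 2 := by
  unfold cubeEnergy
  simp only [← sum_mul_dirLap_self, ← sum_cubeCoeff_mul G, cubeCoeff_dirLap]
  rw [Finset.sum_comm]
  refine Finset.sum_congr rfl fun P _ => ?_
  rw [Finset.sum_mul]
  refine Finset.sum_congr rfl fun i _ => ?_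
  ring

lemma sum_sq_eq_sum_cubeCoeff (G : (Fin k → Fin n) → ℝ) :
    ∑ y, G y ^ 2 = ∑ P, cubeCoeff G P ^ 2 := by
  simp only [sq]
  exact (sum_cubeCoeff_mul G G).symm

lemma cubeEnergy_nonneg (G : (Fin k → Fin n) → ℝ) : 0 ≤ cubeEnergy G :=
  Finset.sum_nonneg fun _ _ => Finset.sum_nonneg fun _ _ => Finset.sum_nonneg fun _ _ => by
    split_ifs <;> positivity

lemma cubeCoeff_comp_perm {G : (Fin k → Fin n) → ℝ}
    (hG : ∀ (π : Equiv.Perm (Fin k)) y, G (y ∘ π) = G y) (π : Equiv.Perm (Fin k))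
    (P : Fin k → Fin n) : cubeCoeff G (P ∘ π) = cubeCoeff G P := by
  unfold cubeCoeff
  rw [← (Equiv.arrowCongr π.symm (Equiv.refl (Fin n))).sum_comp]
  refine Finset.sum_congr rfl fun y _ => ?_
  have h : (Equiv.arrowCongr π.symm (Equiv.refl (Fin n))) y = y ∘ π := by
    funext i
    simp
  rw [h, hG]
  congr 1
  exact Equiv.prod_comp π fun i => pathBasis n (P i) (y i)

lemma cubeCoeff_add (F G : (Fin k → Fin n) → ℝ) (P : Fin k → Fin n) :
    cubeCoeff (F + G) P = cubeCoeff F P + cubeCoeff G P := by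
  simp [cubeCoeff, mul_add, Finset.sum_add_distrib]

lemma cubeCoeff_smul (c : ℝ) (G : (Fin k → Fin n) → ℝ) (P : Fin k → Fin n) :
    cubeCoeff (c • G) P = c * cubeCoeff G P := by
  simp only [cubeCoeff, Pi.smul_apply, smul_eq_mul, Finset.mul_sum]
  exact Finset.sum_congr rfl fun y _ => by ring

lemma exists_perm_of_card_eq {α : Type*} [DecidableEq α] {P Q : Fin k → α}
    (h : ∀ a, (Finset.univ.filter fun i => P i = a).card =
      (Finset.univ.filter fun i => Q i = a).card) :
    ∃ π : Equiv.Perm (Fin k), Q ∘ π = P := by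
  have e : ∀ a, Nonempty ({i // P i = a} ≃ {i // Q i = a}) := fun a =>
    Fintype.card_eq.mp (by rw [Fintype.card_subtype, Fintype.card_subtype, h])
  refine ⟨Equiv.ofFiberEquiv fun a => (e a).some, ?_⟩
  funext i
  exact Equiv.ofFiberEquiv_map _ i

end Cube

/-! ### Occupation numbers of the modes and comparison with free bosons. -/

section Bosons

variable {m k : ℕ}

/-- The number of particles in the `p`-th excited mode. -/
def modeCount (P : Fin k → Fin (m + 1)) (p : Fin m) : Fin (k + 1) :=
  ⟨(Finset.univ.filter fun i => P i = p.succ).card,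
    Nat.lt_succ_iff.mpr ((Finset.card_le_univ _).trans_eq (Fintype.card_fin k))⟩

/-- The zero mode need not be counted: its occupation is determined by the total number `k`. -/
lemma exists_perm_of_modeCount_eq {P Q : Fin k → Fin (m + 1)} (h : modeCount P = modeCount Q) :
    ∃ π : Equiv.Perm (Fin k), Q ∘ π = P := by
  have hs : ∀ p : Fin m, (Finset.univ.filter fun i => P i = p.succ).card =
      (Finset.univ.filter fun i => Q i = p.succ).card := fun p =>
    congrArg Fin.val (congrFun h p)
  have hsum : ∀ P : Fin k → Fin (m + 1), (Finset.univ.filter fun i => P i = 0).card +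
      ∑ p : Fin m, (Finset.univ.filter fun i => P i = p.succ).card = k := by
    intro P
    rw [← Fin.sum_univ_succ fun a => (Finset.univ.filter fun i => P i = a).card,
      ← Finset.card_eq_sum_card_fiberwise (fun i _ => Finset.mem_coe.mpr (Finset.mem_univ (P i)))]
    simp
  refine exists_perm_of_card_eq fun a => ?_
  refine Fin.cases ?_ (fun p => hs p) a
  have h1 := hsum P
  have h2 := hsum Q
  rw [Finset.sum_congr rfl fun p _ => hs p] at h1
  omega

lemma pathFreq_zero (n : ℕ) : pathFreq n 0 = 0 := by simp [pathFreq]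

lemma sum_pathFreq_eq (P : Fin k → Fin (m + 1)) :
    ∑ i, pathFreq (m + 1) (P i) = ∑ p : Fin m, (modeCount P p : ℕ) * pathFreq (m + 1) (p + 1) := by
  have h1 : ∀ i, pathFreq (m + 1) (P i) =
      ∑ a : Fin (m + 1), if P i = a then pathFreq (m + 1) a else 0 := by
    intro i
    simp
  simp only [h1]
  rw [Finset.sum_comm, Fin.sum_univ_succ]
  have h0 : ∑ i, (if P i = 0 then pathFreq (m + 1) ((0 : Fin (m + 1)) : ℕ) else 0) = 0 := by
    simp [pathFreq_zero]
  rw [h0, zero_add]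
  refine Finset.sum_congr rfl fun p _ => ?_
  rw [← Finset.sum_filter, Finset.sum_const, nsmul_eq_mul]
  simp [modeCount]

lemma pathFreq_pos {n p : ℕ} (hp : 1 ≤ p) (hpn : p < n) : 0 < pathFreq n p := by
  have h0 : (0 : ℝ) < n := by exact_mod_cast (Nat.zero_le p).trans_lt hpn
  have h1 : Real.pi * p / n ∈ Set.Icc 0 Real.pi := by
    refine ⟨by positivity, ?_⟩
    rw [div_le_iff₀ h0]
    have : (p : ℝ) ≤ n := by exact_mod_cast hpn.le
    exact mul_le_mul_of_nonneg_left this Real.pi_pos.le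
  have h2 : 0 < Real.pi * p / n := by
    have : (0 : ℝ) < p := by exact_mod_cast hp
    positivity
  have := Real.strictAntiOn_cos ⟨le_rfl, Real.pi_pos.le⟩ h1 h2
  rw [Real.cos_zero] at this
  unfold pathFreq
  linarith

/-- With independent occupation numbers the sum factorises into truncated geometric series. -/
lemma sum_exp_modeCount_le {c : ℝ} (hc : 0 < c) :
    ∑ j : Fin m → Fin (k + 1),
      Real.exp (-c * ∑ p : Fin m, (j p : ℕ) * pathFreq (m + 1) (p + 1)) ≤
      ∏ p : Fin m, (1 - Real.exp (-c * pathFreq (m + 1) (p + 1)))⁻¹ := by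
  have h : ∀ j : Fin m → Fin (k + 1),
      Real.exp (-c * ∑ p : Fin m, (j p : ℕ) * pathFreq (m + 1) (p + 1)) =
      ∏ p : Fin m, Real.exp (-c * pathFreq (m + 1) (p + 1)) ^ (j p : ℕ) := by
    intro j
    rw [Finset.mul_sum, Real.exp_sum]
    refine Finset.prod_congr rfl fun p _ => ?_
    rw [← Real.exp_nat_mul]
    congr 1
    ring
  simp only [h]
  rw [← Fintype.prod_sum fun (p : Fin m) (a : Fin (k + 1)) =>
    Real.exp (-c * pathFreq (m + 1) (p + 1)) ^ (a : ℕ)]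
  refine Finset.prod_le_prod (fun p _ => Finset.sum_nonneg fun a _ => by positivity) fun p _ => ?_
  have h1 : Real.exp (-c * pathFreq (m + 1) (p + 1)) < 1 := by
    rw [Real.exp_lt_one_iff]
    have := pathFreq_pos (n := m + 1) (p := p + 1) (by omega) (by omega)
    nlinarith
  have h2 := (Real.exp_pos (-c * pathFreq (m + 1) (p + 1))).le
  rw [Fin.sum_univ_eq_sum_range fun a => Real.exp (-c * pathFreq (m + 1) (p + 1)) ^ a,
    ← tsum_geometric_of_lt_one h2 h1]
  exact (summable_geometric_of_lt_one h2 h1).sum_le_tsum _ fun i _ => by positivity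

/-- Comparison of the low-lying spectrum of a symmetric matrix with free bosons on a path. -/
theorem sum_exp_le_of_bosons {ι : Type*} [Fintype ι] [DecidableEq ι] {A : Matrix ι ι ℝ}
    (hA : A.IsHermitian) {E β a c : ℝ} (hβ : 0 < β) (ha : 0 < a) (hc : 0 < c)
    (T : (ι → ℝ) →ₗ[ℝ] ((Fin k → Fin (m + 1)) → ℝ))
    (hsymm : ∀ ψ (π : Equiv.Perm (Fin k)) y, T ψ (y ∘ π) = T ψ y)
    (hT : ∀ ψ, ψ ≠ 0 → ψ ⬝ᵥ A *ᵥ ψ ≤ E * (ψ ⬝ᵥ ψ) →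
      ψ ⬝ᵥ ψ ≤ c * ∑ y, T ψ y ^ 2 ∧ c * a * cubeEnergy (T ψ) ≤ ψ ⬝ᵥ A *ᵥ ψ) :
    ∑ i with hA.eigenvalues i < E, Real.exp (-β * hA.eigenvalues i) ≤
      ∏ p : Fin m, (1 - Real.exp (-(β * a) * pathFreq (m + 1) (p + 1)))⁻¹ := by
  classical
  let l : (Fin m → Fin (k + 1)) → (ι → ℝ) →ₗ[ℝ] ℝ := fun j =>
    -- By symmetry a coefficient depends only on the occupation numbers, so one representative
    -- suffices. Numbers adding up to more than `k` are not realised; they get the zero functional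
    -- and merely enlarge the bound.
    if h : ∃ P : Fin k → Fin (m + 1), modeCount P = j then
      { toFun := fun ψ => cubeCoeff (T ψ) h.choose
        map_add' := fun ψ φ => by rw [map_add, cubeCoeff_add]
        map_smul' := fun r ψ => by rw [map_smul, cubeCoeff_smul]; rfl }
    else 0
  have hl : ∀ ψ P, l (modeCount P) ψ = cubeCoeff (T ψ) P := by
    intro ψ P
    have h : ∃ Q : Fin k → Fin (m + 1), modeCount Q = modeCount P := ⟨P, rfl⟩
    have h1 : l (modeCount P) ψ = cubeCoeff (T ψ) h.choose := by
      simp only [l, dif_pos h]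
      rfl
    obtain ⟨π, hπ⟩ := exists_perm_of_modeCount_eq h.choose_spec
    rw [h1, ← hπ, cubeCoeff_comp_perm (hsymm ψ)]
  refine (sum_exp_le_of_functionals hA E β hβ.le l
    (fun j => a * ∑ p : Fin m, (j p : ℕ) * pathFreq (m + 1) (p + 1)) ?_).trans ?_
  · intro ψ e hψ hE hvan
    obtain ⟨h1, h2⟩ := hT ψ hψ hE
    have hpos : 0 < ψ ⬝ᵥ ψ := dotProduct_self_pos hψ
    have hz : ∀ P, a * ∑ i, pathFreq (m + 1) (P i) ≤ e → cubeCoeff (T ψ) P = 0 := by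
      intro P hP
      rw [← hl]
      refine hvan _ ?_
      rw [← sum_pathFreq_eq]
      exact hP
    rw [sum_sq_eq_sum_cubeCoeff] at h1
    rw [cubeEnergy_eq_sum] at h2
    have hne : ∃ P, cubeCoeff (T ψ) P ≠ 0 := by
      by_contra! h0
      simp only [h0] at h1
      simp at h1
      linarith
    obtain ⟨P₀, hP₀⟩ := hne
    have hlt : e * ∑ P, cubeCoeff (T ψ) P ^ 2 <
        a * ∑ P, (∑ i, pathFreq (m + 1) (P i)) * cubeCoeff (T ψ) P ^ 2 := by
      rw [Finset.mul_sum, Finset.mul_sum]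
      refine Finset.sum_lt_sum (fun P _ => ?_) ⟨P₀, Finset.mem_univ _, ?_⟩
      · by_cases hP : a * ∑ i, pathFreq (m + 1) (P i) ≤ e
        · rw [hz P hP]
          simp
        · rw [← mul_assoc]
          exact mul_le_mul_of_nonneg_right (not_le.mp hP).le (sq_nonneg _)
      · have hP : ¬ a * ∑ i, pathFreq (m + 1) (P₀ i) ≤ e := fun h => hP₀ (hz P₀ h)
        rw [← mul_assoc]
        exact mul_lt_mul_of_pos_right (not_le.mp hP) (by positivity)
    -- For negative `e` the comparison of norms goes the wrong way, but then nonnegativity of the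
    -- Dirichlet form is enough.
    rcases lt_or_ge e 0 with he | he
    · have h3 := cubeEnergy_nonneg (T ψ)
      rw [cubeEnergy_eq_sum] at h3
      have h4 : 0 ≤ c * a * ∑ P, (∑ i, pathFreq (m + 1) (P i)) * cubeCoeff (T ψ) P ^ 2 := by
        positivity
      nlinarith
    · calc e * (ψ ⬝ᵥ ψ) ≤ e * (c * ∑ P, cubeCoeff (T ψ) P ^ 2) :=
            mul_le_mul_of_nonneg_left h1 he
        _ = c * (e * ∑ P, cubeCoeff (T ψ) P ^ 2) := by ring
        _ < c * (a * ∑ P, (∑ i, pathFreq (m + 1) (P i)) * cubeCoeff (T ψ) P ^ 2) :=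
            mul_lt_mul_of_pos_left hlt hc
        _ ≤ _ := by rw [← mul_assoc]; exact h2
  · have h := sum_exp_modeCount_le (m := m) (k := k) (mul_pos hβ ha)
    refine le_trans (le_of_eq ?_) h
    refine Finset.sum_congr rfl fun j _ => ?_
    congr 1
    ring

end Bosons

end

end Heisenberg

namespace Heisenberg

noncomputable section

open Matrix

/-! ### Single jumps inside the Dirichlet form of the chain. -/

section Comparison

variable {L N k : ℕ}

lemma sum_comp_le_sum {α β : Type*} [Fintype β] (s : Finset α) (Ψ : α → β)
    (hΨ : Set.InjOn Ψ s) {g : β → ℝ} (hg : ∀ b, 0 ≤ g b) : ∑ a ∈ s, g (Ψ a) ≤ ∑ b, g b := by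
  classical
  rw [← Finset.sum_image (f := g) hΨ]
  exact Finset.sum_le_sum_of_subset_of_nonneg (Finset.subset_univ _) fun b _ _ => hg b

lemma sum_le_sum_comp {α β : Type*} [Fintype β] (s : Finset α) (Ψ : β → α)
    (hΨ : ∀ a ∈ s, ∃ b, Ψ b = a) {g : α → ℝ} (hg : ∀ a, 0 ≤ g a) :
    ∑ a ∈ s, g a ≤ ∑ b, g (Ψ b) := by
  classical
  rcases s.eq_empty_or_nonempty with rfl | ⟨a₀, ha₀⟩
  · simpa using Finset.sum_nonneg fun b _ => hg (Ψ b)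
  obtain ⟨b₀, _⟩ := hΨ a₀ ha₀
  have : Nonempty β := ⟨b₀⟩
  choose! q hq using hΨ
  have hinj : Set.InjOn q s := fun a ha b hb h => by rw [← hq a ha, ← hq b hb, h]
  calc ∑ a ∈ s, g a = ∑ a ∈ s, g (Ψ (q a)) := Finset.sum_congr rfl fun a ha => by rw [hq a ha]
    _ ≤ ∑ b, g (Ψ b) := sum_comp_le_sum s q hinj fun b => hg (Ψ b)

lemma lift_congr_sites (ψ : (Fin L → Fin (N + 1)) → ℝ) {Z Z' : Fin k → Fin L × Fin N}
    (hZ : Function.Injective Z) (hZ' : Function.Injective Z') (h : ∀ a, (Z a).1 = (Z' a).1) :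
    lift ψ k Z = lift ψ k Z' := by
  have : occ Z = occ Z' := by
    funext x
    simp only [occ, h]
  rw [lift, lift, if_pos hZ, if_pos hZ', this]

/-- A configuration with `a` occupied and `b` empty and its image under the exchange give the same
square in `hopEnergy`; only the first of them is counted on the left, hence the factor 2. -/
lemma le_hopEnergy (f : (Fin k → Fin L × Fin N) → ℝ) (a b : Fin L × Fin N) :
    2 * ∑ Z, ∑ l, (if Function.Injective Z ∧ Z l = a ∧ ∀ m, Z m ≠ b then
      (f Z - f (Function.update Z l b)) ^ 2 else 0) ≤ hopEnergy f a b := by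
  let I : (Fin k → Fin L × Fin N) → ℝ := fun Z =>
    if Function.Injective Z ∧ (∃ l, Z l = a) ∧ ∀ m, Z m ≠ b then
      (f Z - f (Equiv.swap a b ∘ Z)) ^ 2 else 0
  have h1 : ∀ Z, ∑ l, (if Function.Injective Z ∧ Z l = a ∧ ∀ m, Z m ≠ b then
      (f Z - f (Function.update Z l b)) ^ 2 else 0) = I Z := by
    intro Z
    simp only [I]
    by_cases hZ : Function.Injective Z ∧ (∃ l, Z l = a) ∧ ∀ m, Z m ≠ b
    · rw [if_pos hZ]
      obtain ⟨hi, ⟨l, hl⟩, hb⟩ := hZ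
      rw [Finset.sum_eq_single l]
      · rw [if_pos ⟨hi, hl, hb⟩, ← swap_comp_eq_update hi l b hb, hl]
      · intro m _ hm
        rw [if_neg fun h => hm (hi (h.2.1.trans hl.symm))]
      · simp
    · rw [if_neg hZ]
      refine Finset.sum_eq_zero fun l _ => if_neg fun h => hZ ⟨h.1, ⟨l, h.2.1⟩, h.2.2⟩
  simp only [h1]
  have h2 : ∀ Z, I Z + I (Equiv.swap a b ∘ Z) ≤ (f Z - f (Equiv.swap a b ∘ Z)) ^ 2 := by
    intro Z
    have hsw : (f (Equiv.swap a b ∘ Z) - f Z) ^ 2 = (f Z - f (Equiv.swap a b ∘ Z)) ^ 2 := by ring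
    have hn := sq_nonneg (f Z - f (Equiv.swap a b ∘ Z))
    simp only [I, swap_comp_swap_comp, hsw]
    by_cases h : (∃ l, Z l = a) ∧ ∀ m, Z m ≠ b
    · obtain ⟨⟨l, hl⟩, hb⟩ := h
      have h3 : ¬ (∃ l, (Equiv.swap a b ∘ Z) l = a) := by
        rintro ⟨m, hm⟩
        rw [Function.comp_apply, Equiv.swap_apply_eq_iff, Equiv.swap_apply_left] at hm
        exact hb m hm
      simp only [h3, false_and, and_false, if_false, add_zero]
      split_ifs <;> linarith
    · simp only [h, and_false, if_false, zero_add]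
      split_ifs <;> linarith
  have h3 : 2 * ∑ Z, I Z = ∑ Z, (I Z + I (Equiv.swap a b ∘ Z)) := by
    rw [Finset.sum_add_distrib, sum_comp_perm I, two_mul]
  rw [h3]
  exact Finset.sum_le_sum fun Z _ => h2 Z

/-- The contribution to the Dirichlet form of the chain of one particle jumping to the right. -/
def jump (f : (Fin k → Fin L × Fin N) → ℝ) (l : Fin k)
    (q : (Fin k → Fin L × Fin N) × (Fin L × Fin N)) : ℝ :=
  if Function.Injective q.1 ∧ ((q.1 l).1 : ℕ) + 1 = q.2.1 ∧ ∀ m, q.1 m ≠ q.2 then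
    (f q.1 - f (Function.update q.1 l q.2)) ^ 2 else 0

lemma jump_nonneg (f : (Fin k → Fin L × Fin N) → ℝ) (l : Fin k)
    (q : (Fin k → Fin L × Fin N) × (Fin L × Fin N)) : 0 ≤ jump f l q := by
  unfold jump
  split_ifs <;> positivity

lemma sum_jump_le (f : (Fin k → Fin L × Fin N) → ℝ) :
    2 * ∑ l, ∑ q, jump f l q ≤ chainEnergy f := by
  have h : chainEnergy f = ∑ a : Fin L × Fin N, ∑ b : Fin L × Fin N,
      if (a.1 : ℕ) + 1 = b.1 then hopEnergy f a b else 0 := by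
    unfold chainEnergy layerEnergy
    rw [Fintype.sum_prod_type]
    refine Finset.sum_congr rfl fun x _ => ?_
    simp only [Fintype.sum_prod_type (γ := ℝ)]
    rw [Finset.sum_comm]
    refine Finset.sum_congr rfl fun y _ => ?_
    split_ifs <;> simp
  rw [h]
  calc 2 * ∑ l, ∑ q, jump f l q
      = ∑ a : Fin L × Fin N, ∑ b : Fin L × Fin N, if (a.1 : ℕ) + 1 = b.1 then
          2 * ∑ Z, ∑ l, (if Function.Injective Z ∧ Z l = a ∧ ∀ m, Z m ≠ b then
            (f Z - f (Function.update Z l b)) ^ 2 else 0) else 0 := by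
        have h1 : ∀ a b : Fin L × Fin N, (if (a.1 : ℕ) + 1 = b.1 then
            2 * ∑ Z, ∑ l, (if Function.Injective Z ∧ Z l = a ∧ ∀ m, Z m ≠ b then
              (f Z - f (Function.update Z l b)) ^ 2 else 0) else 0) =
            2 * ∑ l, ∑ Z, if Z l = a then jump f l (Z, b) else 0 := by
          intro a b
          rw [Finset.sum_comm]
          split_ifs with hab
          · congr 1
            refine Finset.sum_congr rfl fun l _ => Finset.sum_congr rfl fun Z _ => ?_
            unfold jump
            by_cases hZ : Z l = a
            · simp [hZ, hab]
            · simp [hZ]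
          · symm
            rw [mul_eq_zero]
            right
            refine Finset.sum_eq_zero fun l _ => Finset.sum_eq_zero fun Z _ => ?_
            unfold jump
            by_cases hZ : Z l = a
            · simp [hZ, hab]
            · simp [hZ]
        simp only [h1, ← Finset.mul_sum]
        congr 1
        have h2 : ∑ l, ∑ q, jump f l q = ∑ b, ∑ l, ∑ Z, jump f l (Z, b) := by
          exact (Finset.sum_congr rfl fun l _ => Fintype.sum_prod_type_right _).trans
            Finset.sum_comm
        symm
        rw [Finset.sum_comm, h2]
        refine Finset.sum_congr rfl fun b _ => ?_
        rw [Finset.sum_comm]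
        refine Finset.sum_congr rfl fun l _ => ?_
        rw [Finset.sum_comm]
        refine Finset.sum_congr rfl fun Z _ => ?_
        simp
    _ ≤ _ := by
        refine Finset.sum_le_sum fun a _ => Finset.sum_le_sum fun b _ => ?_
        split_ifs
        · exact le_hopEnergy f a b
        · exact le_rfl

/-- Evaluation of the lift of a vector of a sector along a family of configurations. -/
def liftAlong {α : Type*} (s : α → Fin k → Fin L × Fin N) :
    (Sector L N k → ℝ) →ₗ[ℝ] (α → ℝ) where
  toFun v y := lift (extend v) k (s y)
  map_add' v w := by
    have : extend (v + w) = extend v + extend w := by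
      funext σ
      simp only [extend, Pi.add_apply]
      split_ifs <;> simp
    funext y
    rw [this, lift_add]
    rfl
  map_smul' r v := by
    funext y
    rw [extend_smul, lift_smul]
    rfl

lemma liftAlong_apply {α : Type*} (s : α → Fin k → Fin L × Fin N) (v : Sector L N k → ℝ) (y : α) :
    liftAlong s v y = lift (extend v) k (s y) := rfl

lemma lift_of_not_injective (ψ : (Fin L → Fin (N + 1)) → ℝ) {Z : Fin k → Fin L × Fin N}
    (hZ : ¬ Function.Injective Z) : lift ψ k Z = 0 := if_neg hZ

end Comparison

/-! ### Small spin: bosons obtained by deleting one site per particle. -/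

section HardCore

variable {L N k : ℕ}

/-- Replaces bosons at the positions `y`, which are sorted by the permutation `ρ`, by particles
with hard core. -/
def spread (hk : k ≤ L) (ρ : Equiv.Perm (Fin k)) (y : Fin k → Fin (L - k + 1)) (a : Fin k) : Fin L :=
  ⟨y a + ρ.symm a, by have := (y a).2; have := (ρ.symm a).2; omega⟩

lemma spread_comp_strictMono (hk : k ≤ L) {ρ : Equiv.Perm (Fin k)} {y : Fin k → Fin (L - k + 1)}
    (h : Monotone (y ∘ ρ)) : StrictMono (spread hk ρ y ∘ ρ) := by
  intro r s hrs
  have h1 : (y (ρ r) : ℕ) ≤ y (ρ s) := h hrs.le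
  have h2 : (r : ℕ) < s := hrs
  simp only [spread, Function.comp_apply, Equiv.symm_apply_apply, Fin.mk_lt_mk]
  omega

lemma spread_injective (hk : k ≤ L) {ρ : Equiv.Perm (Fin k)} {y : Fin k → Fin (L - k + 1)}
    (h : Monotone (y ∘ ρ)) : Function.Injective (spread hk ρ y) :=
  (EquivLike.injective_comp ρ _).mp (spread_comp_strictMono hk h).injective

lemma injective_of_sites {x : Fin k → Fin L} (hx : Function.Injective x) (c : Fin k → Fin N) :
    Function.Injective fun a => (x a, c a) := fun _ _ h => hx (congrArg Prod.fst h)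

/-- Two permutations sorting `y` differ only among coinciding positions. The resulting sets of sites
agree, and `lift` sees neither labels nor colours, so tie-breaking is immaterial. -/
lemma lift_spread (hk : k ≤ L) (ψ : (Fin L → Fin (N + 1)) → ℝ) {ρ σ : Equiv.Perm (Fin k)}
    {y : Fin k → Fin (L - k + 1)} (hρ : Monotone (y ∘ ρ)) (hσ : Monotone (y ∘ σ))
    (c d : Fin k → Fin N) :
    lift ψ k (fun a => (spread hk ρ y a, c a)) = lift ψ k (fun a => (spread hk σ y a, d a)) := by
  rw [← lift_comp_perm ψ _ ρ, ← lift_comp_perm ψ (fun a => (spread hk σ y a, d a)) σ]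
  refine lift_congr_sites ψ ?_ ?_ fun r => ?_
  · exact (EquivLike.injective_comp ρ _).mpr (injective_of_sites (spread_injective hk hρ) c)
  · exact (EquivLike.injective_comp σ _).mpr (injective_of_sites (spread_injective hk hσ) d)
  · have h := congrFun (Tuple.unique_monotone hρ hσ) r
    simp only [Function.comp_apply] at h
    simp [spread, h]

lemma spread_left_injective (hk : k ≤ L) {ρ σ : Equiv.Perm (Fin k)} {y z : Fin k → Fin (L - k + 1)}
    (hρ : Monotone (y ∘ ρ)) (hσ : Monotone (z ∘ σ)) (h : spread hk ρ y = spread hk σ z) :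
    ρ = σ ∧ y = z := by
  have h1 := (spread_comp_strictMono hk hρ).monotone
  have h2 := (spread_comp_strictMono hk hσ).monotone
  rw [← h] at h2
  have h3 := Tuple.unique_monotone h1 h2
  have h4 : ρ = σ := Equiv.ext fun r => spread_injective hk hρ (congrFun h3 r)
  refine ⟨h4, funext fun a => Fin.ext ?_⟩
  subst h4
  have := congrArg Fin.val (congrFun h a)
  simp only [spread] at this
  omega

/-- The configuration of hard core particles replacing bosons at the positions `y`. -/
def spreadConfig (hk : k ≤ L) (hN : 1 ≤ N) (y : Fin k → Fin (L - k + 1)) : Fin k → Fin L × Fin N :=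
  fun a => (spread hk (Tuple.sort y) y a, ⟨0, hN⟩)

lemma lift_spreadConfig (hk : k ≤ L) (hN : 1 ≤ N) (ψ : (Fin L → Fin (N + 1)) → ℝ)
    {ρ : Equiv.Perm (Fin k)} {y : Fin k → Fin (L - k + 1)} (hρ : Monotone (y ∘ ρ))
    (c : Fin k → Fin N) :
    lift ψ k (fun a => (spread hk ρ y a, c a)) = lift ψ k (spreadConfig hk hN y) :=
  lift_spread hk ψ hρ (Tuple.monotone_sort y) _ _

lemma lift_spreadConfig_comp_perm (hk : k ≤ L) (hN : 1 ≤ N) (ψ : (Fin L → Fin (N + 1)) → ℝ)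
    (π : Equiv.Perm (Fin k)) (y : Fin k → Fin (L - k + 1)) :
    lift ψ k (spreadConfig hk hN (y ∘ π)) = lift ψ k (spreadConfig hk hN y) := by
  have hm : Monotone (y ∘ (Tuple.sort (y ∘ π)).trans π) := Tuple.monotone_sort (y ∘ π)
  rw [← lift_spreadConfig hk hN ψ hm fun _ => ⟨0, hN⟩, ← lift_comp_perm ψ (fun a =>
    (spread hk ((Tuple.sort (y ∘ π)).trans π) y a, (⟨0, hN⟩ : Fin N))) π]
  congr 1
  funext a
  simp [spreadConfig, spread]

/-- Sorts the positions `y`, and the positions after the jump of the particle `l` to the right. -/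
def jumpSort (l : Fin k) {n : ℕ} (y : Fin k → Fin n) : Equiv.Perm (Fin k) :=
  -- Doubling the positions makes room for a tie-break that puts `l` last at its position. Its step
  -- to the right then preserves the order, so one permutation sorts the positions before and after
  -- the jump.
  Tuple.sort fun j => 2 * (y j : ℕ) + if j = l then 1 else 0

lemma monotone_comp_jumpSort (l : Fin k) {n : ℕ} (y : Fin k → Fin n) :
    Monotone (y ∘ jumpSort l y) := by
  intro r s hrs
  have h := Tuple.monotone_sort (fun j => 2 * (y j : ℕ) + if j = l then 1 else 0) hrs
  change 2 * (y (jumpSort l y r) : ℕ) + _ ≤ 2 * (y (jumpSort l y s) : ℕ) + _ at h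
  change (y (jumpSort l y r) : ℕ) ≤ (y (jumpSort l y s) : ℕ)
  split_ifs at h <;> omega

lemma monotone_update_comp_jumpSort (l : Fin k) {n : ℕ} (y : Fin k → Fin n) {z : Fin n}
    (hz : (y l : ℕ) + 1 = z) : Monotone (Function.update y l z ∘ jumpSort l y) := by
  intro r s hrs
  have h := Tuple.monotone_sort (fun j => 2 * (y j : ℕ) + if j = l then 1 else 0) hrs
  change 2 * (y (jumpSort l y r) : ℕ) + (if jumpSort l y r = l then 1 else 0) ≤
    2 * (y (jumpSort l y s) : ℕ) + (if jumpSort l y s = l then 1 else 0) at h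
  change (Function.update y l z (jumpSort l y r) : ℕ) ≤ (Function.update y l z (jumpSort l y s) : ℕ)
  by_cases hr : jumpSort l y r = l <;> by_cases hs : jumpSort l y s = l
  · rw [hr, hs]
  · rw [hr, Function.update_self, Function.update_of_ne hs]
    rw [hr] at h
    simp only [hs, if_true, if_false] at h
    omega
  · rw [hs, Function.update_self, Function.update_of_ne hr]
    rw [hs] at h
    simp only [hr, if_true, if_false] at h
    omega
  · rw [Function.update_of_ne hr, Function.update_of_ne hs]
    simp only [hr, hs, if_false] at h
    omega

lemma mul_cubeEnergy_spread_le (hk : k ≤ L) (hN : 1 ≤ N) (ψ : (Fin L → Fin (N + 1)) → ℝ) :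
    2 * (N : ℝ) ^ (k + 1) * cubeEnergy (fun y => lift ψ k (spreadConfig hk hN y)) ≤
      chainEnergy (lift ψ k) := by
  refine le_trans ?_ (sum_jump_le (lift ψ k))
  rw [mul_assoc, cubeEnergy, Finset.mul_sum]
  refine mul_le_mul_of_nonneg_left (Finset.sum_le_sum fun l _ => ?_) (by norm_num)
  let Q := ((Fin k → Fin (L - k + 1)) × Fin (L - k + 1)) × ((Fin k → Fin N) × Fin N)
  let x : Q → Fin k → Fin L := fun q => spread hk (jumpSort l q.1.1) q.1.1
  -- An edge of the cube together with `k + 1` colours, of the particles and of the target,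
  -- determines a jump of the chain, and different data give different jumps: this is the factor `N
  -- ^ (k + 1)`. Ranks do not change, so the hard core particle moves by exactly one site.
  let Ψ : Q → (Fin k → Fin L × Fin N) × (Fin L × Fin N) := fun q =>
    (fun a => (x q a, q.2.1 a),
      (⟨q.1.2 + (jumpSort l q.1.1).symm l, by
        have := q.1.2.2; have := ((jumpSort l q.1.1).symm l).2; omega⟩, q.2.2))
  let S : Finset Q := Finset.univ.filter fun q => (q.1.1 l : ℕ) + 1 = q.1.2
  have hΨ : Set.InjOn Ψ S := by
    rintro ⟨⟨y, z⟩, c, j⟩ hq ⟨⟨y', z'⟩, c', j'⟩ hq' h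
    have hz : (y l : ℕ) + 1 = z := (Finset.mem_filter.mp hq).2
    have hz' : (y' l : ℕ) + 1 = z' := (Finset.mem_filter.mp hq').2
    have h1 := congrArg Prod.fst h
    have h2 : spread hk (jumpSort l y) y = spread hk (jumpSort l y') y' :=
      funext fun a => congrArg Prod.fst (congrFun h1 a)
    have h3 : c = c' := funext fun a => congrArg Prod.snd (congrFun h1 a)
    have h4 : j = j' := congrArg (fun q => q.2.2) h
    obtain ⟨_, h5⟩ := spread_left_injective hk (monotone_comp_jumpSort l y)
      (monotone_comp_jumpSort l y') h2
    subst h5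
    have h6 : z = z' := Fin.ext (by omega)
    rw [h3, h4, h6]
  have hval : ∀ q ∈ S, jump (lift ψ k) l (Ψ q) =
      (lift ψ k (spreadConfig hk hN (Function.update q.1.1 l q.1.2)) -
        lift ψ k (spreadConfig hk hN q.1.1)) ^ 2 := by
    rintro ⟨⟨y, z⟩, c, j⟩ hq
    have hz : (y l : ℕ) + 1 = z := (Finset.mem_filter.mp hq).2
    have hm := monotone_comp_jumpSort l y
    have hm' := monotone_update_comp_jumpSort l y hz
    have hu : ∀ a, spread hk (jumpSort l y) (Function.update y l z) a =
        if a = l then (Ψ ((y, z), c, j)).2.1 else spread hk (jumpSort l y) y a := by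
      intro a
      by_cases ha : a = l
      · subst ha
        simp [spread, Ψ]
      · simp [spread, ha]
    have hupd : Function.update (Ψ ((y, z), c, j)).1 l (Ψ ((y, z), c, j)).2 =
        fun a => (spread hk (jumpSort l y) (Function.update y l z) a, Function.update c l j a) := by
      funext a
      rw [hu]
      by_cases ha : a = l
      · subst ha
        simp [Ψ]
      · simp [Ψ, x, ha]
    have hi : Function.Injective (Ψ ((y, z), c, j)).1 :=
      injective_of_sites (spread_injective hk hm) c
    have hnot : ∀ m, (Ψ ((y, z), c, j)).1 m ≠ (Ψ ((y, z), c, j)).2 := by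
      intro m hme
      have h1 : spread hk (jumpSort l y) y m = (Ψ ((y, z), c, j)).2.1 := congrArg Prod.fst hme
      by_cases hml : m = l
      · subst hml
        have := congrArg Fin.val h1
        simp only [spread, Ψ] at this
        omega
      · refine hml (spread_injective hk hm' ?_)
        rw [hu, hu, if_neg hml, if_pos rfl, h1]
    have hs : (((Ψ ((y, z), c, j)).1 l).1 : ℕ) + 1 = (Ψ ((y, z), c, j)).2.1 := by
      simp only [Ψ, x, spread]
      omega
    rw [jump, if_pos ⟨hi, hs, hnot⟩, hupd, lift_spreadConfig hk hN ψ hm']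
    have : lift ψ k (Ψ ((y, z), c, j)).1 = lift ψ k (spreadConfig hk hN y) :=
      lift_spreadConfig hk hN ψ hm c
    rw [this]
    ring
  refine le_trans (le_of_eq ?_) (sum_comp_le_sum S Ψ hΨ (jump_nonneg (lift ψ k) l))
  rw [Finset.sum_congr rfl hval, Finset.sum_filter, Fintype.sum_prod_type_right]
  simp only [Finset.sum_const, Finset.card_univ, Fintype.card_prod, Fintype.card_fun,
    Fintype.card_fin, nsmul_eq_mul]
  rw [Fintype.sum_prod_type, pow_succ]
  push_cast
  rfl

lemma add_mul_sub_le {x : Fin k → ℕ} {g : ℕ} (h : ∀ r s, r < s → x r + g ≤ x s) (d : ℕ) :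
    ∀ r s : Fin k, (s : ℕ) = r + d → x r + g * d ≤ x s := by
  induction d with
  | zero =>
    intro r s hrs
    rw [Fin.ext hrs]
    simp
  | succ d ih =>
    intro r s hrs
    have h1 := ih r ⟨r + d, by omega⟩ rfl
    have h2 := h ⟨r + d, by omega⟩ s (by rw [Fin.lt_def]; simp only; omega)
    rw [mul_add]
    omega

/-- Subtracting ranks inverts `spread`. Gaps of at least 2 leave the positions strictly ordered
after the subtraction, so that `Tuple.sort` meets no ties and recovers the ordering of `x`. -/
lemma exists_spread_eq (hk : k ≤ L) {x : Fin k → Fin L}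
    (hx : ∀ a b, a ≠ b → (x a : ℕ) ≤ x b → (x a : ℕ) + 2 ≤ x b) :
    ∃ y : Fin k → Fin (L - k + 1), spread hk (Tuple.sort y) y = x := by
  set σ := Tuple.sort x
  have hmono := Tuple.monotone_sort x
  have hgap : ∀ r s : Fin k, r < s → (x (σ r) : ℕ) + 2 ≤ x (σ s) := fun r s hrs =>
    hx _ _ (fun h => hrs.ne (σ.injective h)) (hmono hrs.le)
  have h1 : ∀ r s : Fin k, r < s → (x (σ r) : ℕ) + 1 ≤ x (σ s) := fun r s hrs => by
    have := hgap r s hrs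
    omega
  have hlow : ∀ r : Fin k, (r : ℕ) ≤ x (σ r) := by
    intro r
    have := add_mul_sub_le h1 r ⟨0, (Nat.zero_le _).trans_lt r.2⟩ r (by simp)
    omega
  have hup : ∀ r : Fin k, (x (σ r) : ℕ) - r < L - k + 1 := by
    intro r
    have hr := r.2
    have := add_mul_sub_le h1 (k - 1 - r) r ⟨k - 1, by omega⟩ (by simp only; omega)
    have h2 := (x (σ ⟨k - 1, by omega⟩)).2
    omega
  have hup' : ∀ a, (x a : ℕ) - (σ.symm a : ℕ) < L - k + 1 := by
    intro a
    have := hup (σ.symm a)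
    rwa [Equiv.apply_symm_apply] at this
  have hlow' : ∀ a, (σ.symm a : ℕ) ≤ x a := by
    intro a
    have := hlow (σ.symm a)
    rwa [Equiv.apply_symm_apply] at this
  let y : Fin k → Fin (L - k + 1) := fun a => ⟨x a - σ.symm a, hup' a⟩
  have hy : StrictMono (y ∘ σ) := by
    intro r s hrs
    have h3 := add_mul_sub_le hgap (s - r) r s (by have : (r : ℕ) < s := hrs; omega)
    have h4 : (r : ℕ) < s := hrs
    have h5 := hlow r
    simp only [y, Function.comp_apply, Equiv.symm_apply_apply, Fin.mk_lt_mk]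
    omega
  have hinj : Function.Injective y := (EquivLike.injective_comp σ _).mp hy.injective
  have hσ : Tuple.sort y = σ := Equiv.ext fun r =>
    hinj (congrFun (Tuple.unique_monotone (Tuple.monotone_sort y) hy.monotone) r)
  refine ⟨y, funext fun a => Fin.ext ?_⟩
  have := hlow' a
  simp only [spread, hσ, y]
  omega

lemma sum_lift_not_colliding_le (hk : k ≤ L) (hN : 1 ≤ N) (ψ : (Fin L → Fin (N + 1)) → ℝ) :
    ∑ Z : Fin k → Fin L × Fin N with ¬ Colliding Z, lift ψ k Z ^ 2 ≤
      (N : ℝ) ^ k * ∑ y, lift ψ k (spreadConfig hk hN y) ^ 2 := by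
  refine (sum_le_sum_comp _ (fun q : (Fin k → Fin (L - k + 1)) × (Fin k → Fin N) =>
    fun a => (spread hk (Tuple.sort q.1) q.1 a, q.2 a)) ?_ fun Z => sq_nonneg _).trans
    (le_of_eq ?_)
  · intro Z hZ
    have hZ' : ¬ Colliding Z := (Finset.mem_filter.mp hZ).2
    obtain ⟨y, hy⟩ := exists_spread_eq hk (x := fun a => (Z a).1) (by
      intro a b hab h
      by_contra hc
      exact hZ' ⟨a, b, hab, h, by omega⟩)
    refine ⟨(y, fun a => (Z a).2), funext fun a => ?_⟩
    simp only [hy]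
  · simp only [lift_spreadConfig hk hN ψ (Tuple.monotone_sort _)]
    rw [Fintype.sum_prod_type_right]
    simp

/-- Bound by free bosons in the case of small spin. -/
theorem truncSum_le_of_spread (hk : k ≤ L) (hN : 1 ≤ N) {R : ℕ} (hR1 : 1 ≤ R) (hR : 2 * R + 3 ≤ L)
    {β E δ : ℝ} (hβ : 0 < β) (hδ : δ < 1)
    (hcoll : 4 * (k : ℝ) ^ 2 / R + 128 * R * k * E / N ≤ δ) :
    truncSum L N k β E ≤ ∏ p : Fin (L - k),
      (1 - Real.exp (-(β * ((1 - δ) * (N / 2))) * pathFreq (L - k + 1) (p + 1)))⁻¹ := by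
  have hNpos : (0 : ℝ) < N := by exact_mod_cast hN
  have hfac : (0 : ℝ) < k.factorial := by exact_mod_cast k.factorial_pos
  have hδ' : 0 < 1 - δ := by linarith
  -- The weight lost to collisions is charged to the norm through `c`. In the product `c * a` the
  -- factor `1 - δ` cancels, leaving exactly the constant of `mul_cubeEnergy_spread_le`.
  refine sum_exp_le_of_bosons (c := (N : ℝ) ^ k / (k.factorial * (1 - δ)))
    (sectorHam_isHermitian L N k) hβ (by positivity) (by positivity)
    (liftAlong (spreadConfig hk hN)) (fun v π y => lift_spreadConfig_comp_perm hk hN _ π y) ?_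
  intro v hv hE
  have h1 := sum_colliding_le (lift_colourInvariant (k := k) (extend v))
    (fun Z hZ => lift_of_not_injective _ hZ) hN hR1 hR
  have h2 := sum_lift_not_colliding_le hk hN (extend v)
  have h3 := Finset.sum_filter_add_sum_filter_not Finset.univ
    (Colliding (L := L) (N := N) (k := k)) fun Z => lift (extend v) k Z ^ 2
  have h4 := mul_cubeEnergy_spread_le hk hN (extend v)
  rw [chainEnergy_lift_extend] at h1 h4
  rw [sum_lift_extend_sq] at h1 h3
  have hvv : 0 ≤ v ⬝ᵥ v := (dotProduct_self_pos hv).le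
  simp only [liftAlong_apply]
  constructor
  · have h5 : 32 * R * k / N * (4 * k.factorial * (v ⬝ᵥ sectorHam L N k *ᵥ v)) ≤
        128 * R * k * E / N * (k.factorial * (v ⬝ᵥ v)) := by
      calc 32 * R * k / N * (4 * k.factorial * (v ⬝ᵥ sectorHam L N k *ᵥ v))
          ≤ 32 * R * k / N * (4 * k.factorial * (E * (v ⬝ᵥ v))) := by gcongr
        _ = _ := by ring
    have h6 := mul_le_mul_of_nonneg_right hcoll (mul_nonneg hfac.le hvv)
    have h7 : (1 - δ) * (k.factorial * (v ⬝ᵥ v)) ≤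
        (N : ℝ) ^ k * ∑ y, lift (extend v) k (spreadConfig hk hN y) ^ 2 := by linarith
    rw [div_mul_eq_mul_div, le_div_iff₀ (by positivity)]
    linarith
  · have h8 : (N : ℝ) ^ k / (k.factorial * (1 - δ)) * ((1 - δ) * (N / 2)) =
        2 * (N : ℝ) ^ (k + 1) / (4 * k.factorial) := by
      field_simp
      ring
    have h9 : cubeEnergy (liftAlong (spreadConfig hk hN) v) =
        cubeEnergy fun y => lift (extend v) k (spreadConfig hk hN y) := rfl
    rw [h8, h9, div_mul_eq_mul_div, div_le_iff₀ (by positivity)]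
    linarith

end HardCore

/-! ### Large spin: bosons stacked at one site. -/

section LargeSpin

variable {L N k : ℕ}

/-- A configuration with particles at prescribed positions. -/
def stackConfig (hk : k ≤ N) (y : Fin k → Fin L) : Fin k → Fin L × Fin N :=
  fun a => (y a, Fin.castLE hk a)

/-- Particle `a` has colour `a`, so any number of particles may share a site; this is what `k ≤ N`
is for. -/
lemma stackConfig_injective (hk : k ≤ N) (y : Fin k → Fin L) :
    Function.Injective (stackConfig hk y) := fun _ _ h =>
  Fin.castLE_injective hk (congrArg Prod.snd h)

lemma lift_eq_lift_stackConfig (hk : k ≤ N) (ψ : (Fin L → Fin (N + 1)) → ℝ)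
    {Z : Fin k → Fin L × Fin N} (hZ : Function.Injective Z) :
    lift ψ k Z = lift ψ k (stackConfig hk fun a => (Z a).1) :=
  lift_congr_sites ψ hZ (stackConfig_injective hk _) fun _ => rfl

lemma lift_stackConfig_comp_perm (hk : k ≤ N) (ψ : (Fin L → Fin (N + 1)) → ℝ)
    (π : Equiv.Perm (Fin k)) (y : Fin k → Fin L) :
    lift ψ k (stackConfig hk (y ∘ π)) = lift ψ k (stackConfig hk y) := by
  rw [← lift_comp_perm ψ (stackConfig hk y) π]
  exact lift_congr_sites ψ (stackConfig_injective hk _)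
    ((EquivLike.injective_comp π _).mpr (stackConfig_injective hk _)) fun _ => rfl

lemma card_injective (N k : ℕ) :
    (Finset.univ.filter fun c : Fin k → Fin N => Function.Injective c).card =
      N.descFactorial k := by
  rw [← Fintype.card_subtype, Fintype.card_congr (Equiv.subtypeInjectiveEquivEmbedding _ _),
    Fintype.card_embedding_eq, Fintype.card_fin, Fintype.card_fin]

/-- Bernoulli's inequality for `(1 - k/N)^(k+1)`, with `k(k+1) ≤ 2k²`. -/
lemma descFactorial_ge (hk : k ≤ N) (hN : 1 ≤ N) :
    (N : ℝ) ^ (k + 1) * (1 - 2 * (k : ℝ) ^ 2 / N) ≤ N.descFactorial (k + 1) := by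
  have hNpos : (0 : ℝ) < N := by exact_mod_cast hN
  rcases Nat.eq_zero_or_pos k with rfl | hk0
  · simp
  have h1 : ((N - k : ℕ) : ℝ) ^ (k + 1) ≤ N.descFactorial (k + 1) := by
    have := Nat.pow_sub_le_descFactorial N (k + 1)
    rw [Nat.add_sub_add_right] at this
    exact_mod_cast this
  refine le_trans ?_ h1
  have hkN : (k : ℝ) / N ≤ 1 := by
    rw [div_le_one hNpos]
    exact_mod_cast hk
  have h2 := one_add_mul_le_pow (a := -((k : ℝ) / N)) (by linarith) (k + 1)
  have h3 : ((N - k : ℕ) : ℝ) ^ (k + 1) = (N : ℝ) ^ (k + 1) * (1 + -((k : ℝ) / N)) ^ (k + 1) := by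
    rw [← mul_pow, Nat.cast_sub hk]
    congr 1
    field_simp
    ring
  rw [h3]
  refine mul_le_mul_of_nonneg_left (le_trans ?_ h2) (by positivity)
  have h4 : 1 - 2 * (k : ℝ) ^ 2 / N = 1 - (2 * k) * (k / N) := by ring
  have h5 : (0 : ℝ) ≤ (k : ℝ) / N := by positivity
  have h6 : (1 : ℝ) ≤ k := by exact_mod_cast hk0
  rw [h4]
  push_cast
  nlinarith

lemma mul_cubeEnergy_stack_le (hk : k ≤ N) (ψ : (Fin L → Fin (N + 1)) → ℝ) :
    2 * (N.descFactorial (k + 1) : ℝ) * cubeEnergy (fun y => lift ψ k (stackConfig hk y)) ≤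
      chainEnergy (lift ψ k) := by
  refine le_trans ?_ (sum_jump_le (lift ψ k))
  rw [mul_assoc, cubeEnergy, Finset.mul_sum]
  refine mul_le_mul_of_nonneg_left (Finset.sum_le_sum fun l _ => ?_) (by norm_num)
  let Q := ((Fin k → Fin L) × Fin L) × (Fin (k + 1) → Fin N)
  -- The colour `c 0` belongs to the target. Since all `k + 1` colours are distinct, no jump is
  -- blocked.
  let Ψ : Q → (Fin k → Fin L × Fin N) × (Fin L × Fin N) := fun q =>
    (fun a => (q.1.1 a, q.2 a.succ), (q.1.2, q.2 0))
  let S : Finset Q := (Finset.univ.filter fun q : (Fin k → Fin L) × Fin L =>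
    (q.1 l : ℕ) + 1 = q.2) ×ˢ Finset.univ.filter fun c : Fin (k + 1) → Fin N => Function.Injective c
  have hΨ : Set.InjOn Ψ S := by
    rintro ⟨⟨y, z⟩, c⟩ _ ⟨⟨y', z'⟩, c'⟩ _ h
    have h1 := congrArg Prod.fst h
    have h2 : y = y' := funext fun a => congrArg Prod.fst (congrFun h1 a)
    have h3 : ∀ a : Fin k, c a.succ = c' a.succ := fun a => congrArg Prod.snd (congrFun h1 a)
    have h4 : z = z' := congrArg (fun q => q.2.1) h
    have h5 : c 0 = c' 0 := congrArg (fun q => q.2.2) h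
    have h6 : c = c' := funext fun a => Fin.cases h5 h3 a
    rw [h2, h4, h6]
  have hval : ∀ q ∈ S, jump (lift ψ k) l (Ψ q) =
      (lift ψ k (stackConfig hk (Function.update q.1.1 l q.1.2)) -
        lift ψ k (stackConfig hk q.1.1)) ^ 2 := by
    rintro ⟨⟨y, z⟩, c⟩ hq
    obtain ⟨hq1, hq2⟩ := Finset.mem_product.mp hq
    have hz : (y l : ℕ) + 1 = z := (Finset.mem_filter.mp hq1).2
    have hc : Function.Injective c := (Finset.mem_filter.mp hq2).2
    have hi : Function.Injective (Ψ ((y, z), c)).1 := fun a b h =>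
      Fin.succ_injective _ (hc (congrArg Prod.snd h))
    have hnot : ∀ m, (Ψ ((y, z), c)).1 m ≠ (Ψ ((y, z), c)).2 := fun m h =>
      Fin.succ_ne_zero m (hc (congrArg Prod.snd h))
    have hiu : Function.Injective (Function.update (Ψ ((y, z), c)).1 l (Ψ ((y, z), c)).2) := by
      rw [← swap_comp_eq_update hi l _ hnot]
      exact (Equiv.injective _).comp hi
    rw [jump, if_pos ⟨hi, hz, hnot⟩, lift_eq_lift_stackConfig hk ψ hi,
      lift_eq_lift_stackConfig hk ψ hiu]
    have hu : (fun a => (Function.update (Ψ ((y, z), c)).1 l (Ψ ((y, z), c)).2 a).1) =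
        Function.update y l z := by
      funext a
      by_cases ha : a = l
      · subst ha
        simp [Ψ]
      · simp [Ψ, ha]
    rw [hu]
    change (lift ψ k (stackConfig hk y) - _) ^ 2 = _
    ring
  refine le_trans (le_of_eq ?_) (sum_comp_le_sum S Ψ hΨ (jump_nonneg (lift ψ k) l))
  rw [Finset.sum_congr rfl hval, Finset.sum_product_right]
  simp only [Finset.sum_const, card_injective, nsmul_eq_mul]
  rw [Finset.sum_filter, Fintype.sum_prod_type]

lemma sum_lift_sq_le (hk : k ≤ N) (ψ : (Fin L → Fin (N + 1)) → ℝ) :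
    ∑ Z, lift ψ k Z ^ 2 ≤ (N : ℝ) ^ k * ∑ y, lift ψ k (stackConfig hk y) ^ 2 := by
  calc ∑ Z, lift ψ k Z ^ 2
      ≤ ∑ Z : Fin k → Fin L × Fin N, lift ψ k (stackConfig hk fun a => (Z a).1) ^ 2 := by
        refine Finset.sum_le_sum fun Z _ => ?_
        by_cases hZ : Function.Injective Z
        · rw [lift_eq_lift_stackConfig hk ψ hZ]
        · rw [lift_of_not_injective ψ hZ, zero_pow two_ne_zero]
          exact sq_nonneg _
    _ = _ := by
        rw [← (Equiv.arrowProdEquivProdArrow (Fin k) (fun _ => Fin L) fun _ => Fin N).symm.sum_comp,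
          Fintype.sum_prod_type_right]
        simp [Equiv.arrowProdEquivProdArrow]

/-- Bound by free bosons in the case of large spin. -/
theorem truncSum_le_of_stack {m : ℕ} (hk : k ≤ N) (hN : 1 ≤ N) {β E δ : ℝ} (hβ : 0 < β)
    (hδ : δ < 1) (hcoll : 2 * (k : ℝ) ^ 2 / N ≤ δ) :
    truncSum (m + 1) N k β E ≤ ∏ p : Fin m,
      (1 - Real.exp (-(β * ((1 - δ) * (N / 2))) * pathFreq (m + 1) (p + 1)))⁻¹ := by
  have hNpos : (0 : ℝ) < N := by exact_mod_cast hN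
  have hfac : (0 : ℝ) < k.factorial := by exact_mod_cast k.factorial_pos
  have hδ' : 0 < 1 - δ := by linarith
  -- No weight is lost in the norm here; `1 - δ` comes only from the number of injective colourings.
  refine sum_exp_le_of_bosons (c := (N : ℝ) ^ k / k.factorial)
    (sectorHam_isHermitian (m + 1) N k) hβ (by positivity) (by positivity)
    (liftAlong (stackConfig hk)) (fun v π y => lift_stackConfig_comp_perm hk _ π y) ?_
  intro v hv hE
  have h2 := sum_lift_sq_le hk (extend v)
  have h4 := mul_cubeEnergy_stack_le hk (extend v)
  rw [chainEnergy_lift_extend] at h4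
  rw [sum_lift_extend_sq] at h2
  simp only [liftAlong_apply]
  constructor
  · rw [div_mul_eq_mul_div, le_div_iff₀ (by positivity)]
    linarith
  · have h9 : cubeEnergy (liftAlong (stackConfig hk) v) =
        cubeEnergy fun y => lift (extend v) k (stackConfig hk y) := rfl
    have h10 := cubeEnergy_nonneg fun y => lift (extend v) k (stackConfig hk y)
    rw [h9, div_mul_eq_mul_div, div_mul_eq_mul_div, div_le_iff₀ hfac]
    have h11 : (N : ℝ) ^ (k + 1) * (1 - δ) ≤ N.descFactorial (k + 1) :=
      le_trans (mul_le_mul_of_nonneg_left (by linarith) (by positivity)) (descFactorial_ge hk hN)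
    have h12 := mul_le_mul_of_nonneg_right h11 h10
    rw [pow_succ] at h12
    linarith

lemma truncSum_zero_le (β E : ℝ) (hβ : 0 ≤ β) : truncSum L N 0 β E ≤ 1 := by
  have hcard : Fintype.card (Sector L N 0) ≤ 1 := by
    refine Fintype.card_le_one_iff.mpr fun σ τ => Subtype.ext (funext fun x => Fin.ext ?_)
    have h1 := Finset.sum_eq_zero_iff.mp σ.2 x (Finset.mem_univ x)
    have h2 := Finset.sum_eq_zero_iff.mp τ.2 x (Finset.mem_univ x)
    rw [h1, h2]
  unfold truncSum
  calc _ ≤ ∑ i : Sector L N 0, (1 : ℝ) := by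
        refine le_trans (Finset.sum_le_sum fun i _ => ?_)
          (Finset.sum_le_sum_of_subset_of_nonneg (Finset.subset_univ _) fun _ _ _ => zero_le_one)
        rw [Real.exp_le_one_iff]
        have := eigenvalues_sectorHam_nonneg (L := L) (N := N) (k := 0) i
        nlinarith
    _ ≤ 1 := by
        rw [Finset.sum_const, nsmul_eq_mul, mul_one, Finset.card_univ]
        exact_mod_cast hcard

end LargeSpin

end

end Heisenberg

namespace Heisenberg

noncomputable section

open MeasureTheory Set

/-! ### The free energy of bosons on a path and the integral `C₁`. -/

section BoseIntegral

/-- The grand potential of a boson mode with energy `u ^ 2`. -/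
def bose (u : ℝ) : ℝ := -Real.log (1 - Real.exp (-u ^ 2))

lemma neg_log_one_sub_exp_nonneg {x : ℝ} (hx : 0 ≤ x) : 0 ≤ -Real.log (1 - Real.exp (-x)) := by
  have h1 : Real.exp (-x) ≤ 1 := Real.exp_le_one_iff.mpr (by linarith)
  have h2 := Real.exp_pos (-x)
  have := Real.log_nonpos (x := 1 - Real.exp (-x)) (by linarith) (by linarith)
  linarith

lemma neg_log_one_sub_exp_anti {x y : ℝ} (hx : 0 < x) (hxy : x ≤ y) :
    -Real.log (1 - Real.exp (-y)) ≤ -Real.log (1 - Real.exp (-x)) := by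
  have h1 : Real.exp (-x) < 1 := Real.exp_lt_one_iff.mpr (by linarith)
  have h2 : Real.exp (-y) ≤ Real.exp (-x) := Real.exp_le_exp.mpr (by linarith)
  have := Real.log_le_log (x := 1 - Real.exp (-x)) (y := 1 - Real.exp (-y))
    (by linarith) (by linarith)
  linarith

lemma neg_log_one_sub_exp_eq {x : ℝ} (hx : 0 < x) :
    -Real.log (1 - Real.exp (-x)) = Real.log (1 + 1 / (Real.exp x - 1)) := by
  have h1 : 1 < Real.exp x := Real.one_lt_exp_iff.mpr hx
  have h2 : Real.exp x - 1 ≠ 0 := by linarith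
  rw [← Real.log_inv]
  congr 1
  rw [Real.exp_neg]
  have h3 : Real.exp x ≠ 0 := (Real.exp_pos x).ne'
  field_simp
  ring

lemma neg_log_one_sub_exp_le_inv {x : ℝ} (hx : 0 < x) :
    -Real.log (1 - Real.exp (-x)) ≤ 1 / (Real.exp x - 1) := by
  have h1 : 1 < Real.exp x := Real.one_lt_exp_iff.mpr hx
  have h2 : 0 < 1 / (Real.exp x - 1) := by
    apply one_div_pos.mpr
    linarith
  rw [neg_log_one_sub_exp_eq hx]
  have := Real.log_le_sub_one_of_pos (x := 1 + 1 / (Real.exp x - 1)) (by linarith)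
  linarith

lemma neg_log_one_sub_exp_le_sq {x : ℝ} (hx : 0 < x) :
    -Real.log (1 - Real.exp (-x)) ≤ 2 / x ^ 2 := by
  refine (neg_log_one_sub_exp_le_inv hx).trans ?_
  have h := Real.quadratic_le_exp_of_nonneg hx.le
  rw [div_le_div_iff₀ (by nlinarith) (by positivity)]
  nlinarith

lemma bose_nonneg (u : ℝ) : 0 ≤ bose u := neg_log_one_sub_exp_nonneg (sq_nonneg u)

lemma bose_anti {u v : ℝ} (hu : 0 < u) (huv : u ≤ v) : bose v ≤ bose u :=
  neg_log_one_sub_exp_anti (by positivity) (by gcongr)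

lemma measurable_bose : Measurable bose := by
  unfold bose
  fun_prop

/-- The singularity at zero is logarithmic, and at infinity `u⁻²` is a sufficient bound. -/
lemma integrableOn_bose : IntegrableOn bose (Ioi 0) := by
  rw [← Ioc_union_Ioi_eq_Ioi (zero_le_one (α := ℝ))]
  refine IntegrableOn.union ?_ ?_
  · have h : IntegrableOn (fun u : ℝ => Real.log 2 - 2 * Real.log u) (Ioc 0 1) := by
      refine (integrableOn_const (by simp)).sub (Integrable.const_mul ?_ 2)
      exact (intervalIntegral.intervalIntegrable_log').1
    refine Integrable.mono' h measurable_bose.aestronglyMeasurable ?_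
    refine (ae_restrict_iff' measurableSet_Ioc).mpr (Filter.Eventually.of_forall fun u hu => ?_)
    rw [Real.norm_of_nonneg (bose_nonneg u), bose, neg_log_one_sub_exp_eq (by have := hu.1; positivity)]
    have hu0 : 0 < u := hu.1
    have h1 := Real.add_one_le_exp (u ^ 2)
    have h2 : 0 < u ^ 2 := by positivity
    have h3 : u ^ 2 ≤ 1 := pow_le_one₀ hu0.le hu.2
    have h4 : 1 + 1 / (Real.exp (u ^ 2) - 1) ≤ 2 / u ^ 2 := by
      have : 1 / (Real.exp (u ^ 2) - 1) ≤ 1 / u ^ 2 :=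
        one_div_le_one_div_of_le h2 (by linarith)
      have h5 : 1 ≤ 1 / u ^ 2 := by rwa [le_div_iff₀ h2, one_mul]
      calc _ ≤ 1 / u ^ 2 + 1 / u ^ 2 := by linarith
        _ = 2 / u ^ 2 := by ring
    have h6 : 0 < 1 / (Real.exp (u ^ 2) - 1) := one_div_pos.mpr (by linarith)
    have h7 := Real.log_le_log (by linarith) h4
    rw [Real.log_div two_ne_zero h2.ne', Real.log_pow] at h7
    exact_mod_cast h7
  · have h := integrableOn_Ioi_rpow_of_lt (a := -2) (by norm_num) (zero_lt_one (α := ℝ))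
    refine Integrable.mono' h measurable_bose.aestronglyMeasurable ?_
    refine (ae_restrict_iff' measurableSet_Ioi).mpr (Filter.Eventually.of_forall fun u hu => ?_)
    have hu0 : 0 < u := zero_lt_one.trans hu
    rw [Real.norm_of_nonneg (bose_nonneg u), Real.rpow_neg hu0.le]
    refine (neg_log_one_sub_exp_le_inv (by positivity)).trans ?_
    have h1 := Real.add_one_le_exp (u ^ 2)
    have h2 : 0 < u ^ 2 := by positivity
    rw [one_div]
    refine inv_anti₀ (by positivity) ?_
    rw [show (2 : ℝ) = ((2 : ℕ) : ℝ) by norm_num, Real.rpow_natCast]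
    linarith

lemma C₁_eq : C₁ = -(1 / Real.pi * ∫ u in Ioi 0, bose u) := by
  have h := integral_comp_abs (f := fun u => Real.log (1 - Real.exp (-u ^ 2)))
  simp only [sq_abs] at h
  unfold C₁ bose
  rw [h, integral_neg]
  field_simp

/-- The function decreases and the sum starts at `p = 1`, so each term lies below the integral over
the preceding unit interval. -/
lemma sum_bose_le {s : ℝ} (hs : 0 < s) (m : ℕ) :
    ∑ p ∈ Finset.range m, bose (s * (p + 1)) ≤ s⁻¹ * ∫ u in Ioi 0, bose u := by
  have hint : IntegrableOn (fun t => bose (s * t)) (Ioi 0) := by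
    have := (integrableOn_Ioi_comp_mul_left_iff bose 0 hs).mpr (by simpa using integrableOn_bose)
    exact this
  have hii : ∀ p : ℕ, IntervalIntegrable (fun t => bose (s * t)) volume (p : ℝ) ((p + 1 : ℕ) : ℝ) := by
    intro p
    rw [intervalIntegrable_iff_integrableOn_Ioc_of_le (by push_cast; linarith)]
    exact hint.mono_set fun t ht => (Nat.cast_nonneg p).trans_lt ht.1
  have hstep : ∀ p : ℕ, bose (s * (p + 1)) ≤ ∫ t in (p : ℝ)..((p + 1 : ℕ) : ℝ), bose (s * t) := by
    intro p
    have h1 : bose (s * (p + 1)) = ∫ _t in (p : ℝ)..((p + 1 : ℕ) : ℝ), bose (s * (p + 1)) := by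
      rw [intervalIntegral.integral_const]
      push_cast
      simp
    rw [h1]
    refine intervalIntegral.integral_mono_on_of_le_Ioo (by push_cast; linarith)
      intervalIntegrable_const (hii p) fun t ht => ?_
    have h0 : (0 : ℝ) < t := (Nat.cast_nonneg p).trans_lt ht.1
    refine bose_anti (by positivity) (mul_le_mul_of_nonneg_left ?_ hs.le)
    have := ht.2
    push_cast at this
    exact this.le
  calc _ ≤ ∑ p ∈ Finset.range m, ∫ t in (p : ℝ)..((p + 1 : ℕ) : ℝ), bose (s * t) :=
        Finset.sum_le_sum fun p _ => hstep p
    _ = ∫ t in ((0 : ℕ) : ℝ)..(m : ℝ), bose (s * t) :=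
        intervalIntegral.sum_integral_adjacent_intervals (a := fun p : ℕ => (p : ℝ)) fun p _ => hii p
    _ ≤ ∫ t in Ioi 0, bose (s * t) := by
        rw [intervalIntegral.integral_of_le (by simp)]
        refine setIntegral_mono_set hint (Filter.Eventually.of_forall fun t => bose_nonneg _) ?_
        refine Filter.Eventually.of_forall fun t ht => ?_
        have := ht.1
        rw [Nat.cast_zero] at this
        exact this
    _ = s⁻¹ * ∫ u in Ioi 0, bose u := by
        rw [integral_comp_mul_left_Ioi bose 0 hs]
        simp

lemma integral_bose_pos : 0 < ∫ u in Ioi 0, bose u := by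
  have h := sum_bose_le one_pos 1
  have h1 : 0 < bose 1 := by
    have h2 : Real.exp (-1 ^ 2) < 1 := Real.exp_lt_one_iff.mpr (by norm_num)
    have h3 := Real.exp_pos (-1 ^ 2)
    have := Real.log_neg (x := 1 - Real.exp (-1 ^ 2)) (by linarith) (by linarith)
    unfold bose
    linarith
  simp at h
  linarith

lemma C₁_neg : C₁ < 0 := by
  rw [C₁_eq]
  have := integral_bose_pos
  have := Real.pi_pos
  have : 0 < 1 / Real.pi * ∫ u in Ioi 0, bose u := by positivity
  linarith

lemma pathFreq_eq_sq (n p : ℕ) : pathFreq n p = (2 * Real.sin (Real.pi * p / n / 2)) ^ 2 := by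
  have h := Real.cos_sq (Real.pi * p / n / 2)
  have h1 := Real.sin_sq_add_cos_sq (Real.pi * p / n / 2)
  rw [mul_div_cancel₀ _ (two_ne_zero (α := ℝ))] at h
  unfold pathFreq
  nlinarith

/-- For long waves, `θ² ≤ 1/w`, the cubic lower bound on the sine makes the dispersion quadratic up
to a relative error `1/(16w)` in `θ`. For shorter waves the exponent is at least `2w/5`, and the
whole term is below `13/w²`. -/
lemma neg_log_pathFreq_le {n p : ℕ} (hp : 1 ≤ p) (hpn : p < n) {c w : ℝ} (hw : 1 / 2 ≤ w)
    (hc : w ^ 2 ≤ c) :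
    -Real.log (1 - Real.exp (-c * pathFreq n p)) ≤
      bose (w * (1 - 1 / (16 * w)) * (Real.pi / n) * p) + 13 / w ^ 2 := by
  have hn : (0 : ℝ) < n := by exact_mod_cast (Nat.zero_le p).trans_lt hpn
  have hp0 : (0 : ℝ) < p := by exact_mod_cast hp
  have hw0 : 0 < w := by linarith
  have hpi := Real.pi_pos
  set θ := Real.pi * p / n with hθ
  have hθ0 : 0 < θ := by positivity
  have hθpi : θ ≤ Real.pi := by
    rw [hθ, div_le_iff₀ hn]
    have : (p : ℝ) ≤ n := by exact_mod_cast hpn.le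
    exact mul_le_mul_of_nonneg_left this hpi.le
  have hfreq : pathFreq n p = (2 * Real.sin (θ / 2)) ^ 2 := pathFreq_eq_sq n p
  have hpos := pathFreq_pos hp hpn
  have hanti : -Real.log (1 - Real.exp (-c * pathFreq n p)) ≤
      -Real.log (1 - Real.exp (-(w ^ 2 * pathFreq n p))) := by
    rw [neg_mul]
    exact neg_log_one_sub_exp_anti (by positivity) (by gcongr)
  refine hanti.trans ?_
  have hw16 : 1 / (16 * w) ≤ 1 / 8 := by
    rw [div_le_div_iff₀ (by positivity) (by norm_num)]
    linarith
  have hκ : 0 < 1 - 1 / (16 * w) := by linarith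
  rcases le_or_gt (θ ^ 2) (1 / w) with h | h
  · have h2 : θ ^ 2 ≤ 2 := h.trans (by rw [div_le_iff₀ hw0]; linarith)
    have h4 := Real.sin_gt_sub_cube (by positivity : 0 < θ / 2)
    have h5 : (1 - 1 / (16 * w)) * θ ≤ 2 * Real.sin (θ / 2) := by
      have h6 : 1 / (16 * w) = 1 / w / 16 := by field_simp
      rw [h6]
      nlinarith
    have h7 : bose (w * (2 * Real.sin (θ / 2))) ≤
        bose (w * (1 - 1 / (16 * w)) * (Real.pi / n) * p) := by
      refine bose_anti (by positivity) ?_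
      calc w * (1 - 1 / (16 * w)) * (Real.pi / n) * p = w * ((1 - 1 / (16 * w)) * θ) := by
            rw [hθ]
            ring
        _ ≤ _ := by gcongr
    have h8 : bose (w * (2 * Real.sin (θ / 2))) =
        -Real.log (1 - Real.exp (-(w ^ 2 * pathFreq n p))) := by
      rw [bose, hfreq, mul_pow]
    have : 0 ≤ 13 / w ^ 2 := by positivity
    linarith
  · have h1 := Real.mul_le_sin (by positivity : 0 ≤ θ / 2) (by linarith)
    have h2 : (2 / Real.pi * θ) ^ 2 ≤ pathFreq n p := by
      rw [hfreq]
      have : 2 / Real.pi * θ ≤ 2 * Real.sin (θ / 2) := by linarith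
      gcongr
    have hpi2 : Real.pi ^ 2 ≤ 10 := by nlinarith [Real.pi_lt_d2, Real.pi_gt_three]
    have h3 : 2 / 5 * w ≤ w ^ 2 * pathFreq n p := by
      have h4 : 2 / 5 * (1 / w) ≤ pathFreq n p := by
        refine le_trans ?_ h2
        rw [mul_pow, div_pow]
        have h5 : (2 : ℝ) / 5 ≤ 2 ^ 2 / Real.pi ^ 2 := by
          rw [div_le_div_iff₀ (by norm_num) (by positivity)]
          linarith
        gcongr
      calc 2 / 5 * w = w ^ 2 * (2 / 5 * (1 / w)) := by field_simp
        _ ≤ _ := by gcongr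
    have h4 := neg_log_one_sub_exp_anti (by positivity) h3
    have h5 := neg_log_one_sub_exp_le_sq (by positivity : 0 < 2 / 5 * w)
    have h6 : 2 / (2 / 5 * w) ^ 2 ≤ 13 / w ^ 2 := by
      rw [div_le_div_iff₀ (by positivity) (by positivity)]
      nlinarith [sq_nonneg w]
    have := bose_nonneg (w * (1 - 1 / (16 * w)) * (Real.pi / n) * p)
    linarith

/-- The grand potential of free bosons on a path. -/
theorem log_prod_boson_le (m : ℕ) {c w : ℝ} (hw : 1 / 2 ≤ w) (hc : w ^ 2 ≤ c) :
    Real.log (∏ p : Fin m, (1 - Real.exp (-c * pathFreq (m + 1) (p + 1)))⁻¹) ≤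
      (m + 1) * (-C₁ / w * (1 + 1 / (8 * w)) + 13 / w ^ 2) := by
  have hw0 : 0 < w := by linarith
  have hcpos : 0 < c := lt_of_lt_of_le (by positivity) hc
  have hpi := Real.pi_pos
  have hw16 : 1 / (16 * w) ≤ 1 / 8 := by
    rw [div_le_div_iff₀ (by positivity) (by norm_num)]
    linarith
  have hκ : 0 < 1 - 1 / (16 * w) := by linarith
  rw [Real.log_prod]
  · have h1 : ∀ p ∈ (Finset.univ : Finset (Fin m)),
        Real.log (1 - Real.exp (-c * pathFreq (m + 1) (p + 1)))⁻¹ ≤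
          bose (w * (1 - 1 / (16 * w)) * (Real.pi / (m + 1 : ℕ)) * ((p : ℕ) + 1)) + 13 / w ^ 2 := by
      intro p _
      rw [Real.log_inv]
      have := neg_log_pathFreq_le (n := m + 1) (p := p + 1) (by omega) (by omega) hw hc
      push_cast at this ⊢
      exact this
    refine (Finset.sum_le_sum h1).trans ?_
    rw [Finset.sum_add_distrib, Finset.sum_const, Finset.card_univ, Fintype.card_fin, nsmul_eq_mul,
      Fin.sum_univ_eq_sum_range fun p =>
        bose (w * (1 - 1 / (16 * w)) * (Real.pi / (m + 1 : ℕ)) * ((p : ℕ) + 1))]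
    have h2 := sum_bose_le (s := w * (1 - 1 / (16 * w)) * (Real.pi / (m + 1 : ℕ))) (by positivity) m
    refine (add_le_add h2 le_rfl).trans ?_
    rw [C₁_eq]
    have hI := integral_bose_pos
    set I := ∫ u in Ioi 0, bose u
    have h3 : (w * (1 - 1 / (16 * w)) * (Real.pi / (m + 1 : ℕ)))⁻¹ * I =
        (m + 1) * (1 / Real.pi * I / w) * (1 - 1 / (16 * w))⁻¹ := by
      push_cast
      field_simp
    have h4 : (1 - 1 / (16 * w))⁻¹ ≤ 1 + 1 / (8 * w) := by
      rw [inv_le_iff_one_le_mul₀ hκ]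
      have h5 : 1 / (8 * w) = 2 * (1 / (16 * w)) := by
        field_simp
        norm_num
      have h6 : 0 < 1 / (16 * w) := by positivity
      rw [h5]
      nlinarith
    rw [h3]
    have h7 := mul_le_mul_of_nonneg_left h4
      (by positivity : 0 ≤ ((m : ℝ) + 1) * (1 / Real.pi * I / w))
    have h8 : 0 ≤ 13 / w ^ 2 := by positivity
    calc _ ≤ (m + 1) * (1 / Real.pi * I / w) * (1 + 1 / (8 * w)) + (m + 1) * (13 / w ^ 2) := by
          nlinarith
      _ = _ := by ring
  · intro p _
    have := pathFreq_pos (n := m + 1) (p := p + 1) (by omega) (by omega)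
    have : Real.exp (-c * pathFreq (m + 1) (p + 1)) < 1 := Real.exp_lt_one_iff.mpr (by nlinarith)
    have : 0 < 1 - Real.exp (-c * pathFreq (m + 1) (p + 1)) := by linarith
    positivity

end BoseIntegral

end

end Heisenberg

namespace Heisenberg

noncomputable section

/-! ### Improving an a priori bound on the partition function. -/

section Bootstrap

variable {L N : ℕ}

/-- The constant in the relative error of the free energy of bosons. -/
def bosonErr : ℝ := 3 + 52 / (-C₁)

lemma bosonErr_pos : 0 < bosonErr := by
  have := neg_pos.mpr C₁_neg
  unfold bosonErr
  positivity

/-- The boson bound is applied with `(1 - δ) w` in place of `w`, which is allowed since `(1 - δ)² ≤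
1 - δ`. With `1 - δ ≥ 1/2`, the constants 3 and `52 = 4 · 13` in `bosonErr` absorb all corrections.
-/
lemma log_prod_boson_le_of_error {M L : ℕ} (hM : M + 1 ≤ L) {c w δ : ℝ} (hw : 1 ≤ w)
    (hδ0 : 0 ≤ δ) (hδ : δ ≤ 1 / 2) (hc : (1 - δ) * w ^ 2 ≤ c) :
    Real.log (∏ p : Fin M, (1 - Real.exp (-c * pathFreq (M + 1) (p + 1)))⁻¹) ≤
      L * (-C₁ / w * (1 + bosonErr * (δ + 1 / w))) := by
  have hD := neg_pos.mpr C₁_neg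
  set D := -C₁ with hDdef
  have hw0 : 0 < w := by linarith
  have h1δ : 0 < 1 - δ := by linarith
  have hw' : 1 / 2 ≤ (1 - δ) * w := by nlinarith
  have hc' : ((1 - δ) * w) ^ 2 ≤ c := by
    refine le_trans ?_ hc
    rw [mul_pow]
    have : (1 - δ) ^ 2 ≤ 1 - δ := by nlinarith
    gcongr
  refine (log_prod_boson_le M hw' hc').trans ?_
  have hML : (M : ℝ) + 1 ≤ L := by exact_mod_cast hM
  have hinv : 1 / ((1 - δ) * w) ≤ (1 + 2 * δ) * (1 / w) := by
    rw [div_le_iff₀ (by positivity)]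
    have : (1 + 2 * δ) * (1 / w) * ((1 - δ) * w) = (1 + 2 * δ) * (1 - δ) := by
      field_simp
    rw [this]
    nlinarith
  have hinv2 : 1 / ((1 - δ) * w) ≤ 2 * (1 / w) :=
    hinv.trans (mul_le_mul_of_nonneg_right (by linarith) (by positivity))
  have hv : 0 < 1 / w := by positivity
  have hv' : 0 < 1 / ((1 - δ) * w) := by positivity
  have e1 : -C₁ / ((1 - δ) * w) * (1 + 1 / (8 * ((1 - δ) * w))) + 13 / ((1 - δ) * w) ^ 2 =
      D * (1 / ((1 - δ) * w)) * (1 + 1 / 8 * (1 / ((1 - δ) * w))) +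
        13 * (1 / ((1 - δ) * w)) ^ 2 := by
    rw [← hDdef]
    field_simp
  have e2 : D / w * (1 + bosonErr * (δ + 1 / w)) =
      D * (1 / w) + (3 * D + 52) * (1 / w) * (δ + 1 / w) := by
    unfold bosonErr
    rw [← hDdef]
    field_simp
  rw [e1, e2]
  set v := 1 / w
  set u := 1 / ((1 - δ) * w)
  have h1 : D * u ≤ D * ((1 + 2 * δ) * v) := by gcongr
  have h2 : D * u * (1 / 8 * u) ≤ D * (2 * v) * (1 / 8 * (2 * v)) := by gcongr
  have h3 : 13 * u ^ 2 ≤ 13 * (2 * v) ^ 2 := by gcongr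
  have h4 : 0 < D * v ^ 2 := by positivity
  have h5 : 0 ≤ D * v * δ := by positivity
  have h6 : 0 ≤ v * δ := by positivity
  have h7 : D * u * (1 + 1 / 8 * u) + 13 * u ^ 2 ≤
      D * v + (3 * D + 52) * v * (δ + v) := by nlinarith
  have h8 : 0 ≤ D * v + (3 * D + 52) * v * (δ + v) := by positivity
  calc ((M : ℝ) + 1) * (D * u * (1 + 1 / 8 * u) + 13 * u ^ 2)
      ≤ ((M : ℝ) + 1) * (D * v + (3 * D + 52) * v * (δ + v)) := by gcongr
    _ ≤ _ := by gcongr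

/-- The cut-off `E = 2X/β` makes the high-energy part at most 1 and leaves only particle numbers up
to `32XL²/w²`, for which `hB` demands a boson bound. The factor `N L + 1` counts the sectors. -/
lemma log_partitionFunction_le_of_bosons {β X w δ : ℝ} (hβ : 0 < β) (hN : 1 ≤ N) (hw : 1 ≤ w)
    (hwb : w ^ 2 ≤ β * N / 2) (hδ0 : 0 ≤ δ) (hδ : δ ≤ 1 / 2)
    (hX : Real.log (partitionFunction L (β / 2) N) ≤ X)
    (hB : ∀ k : ℕ, 1 ≤ k → (k : ℝ) ≤ 32 * X * L ^ 2 / w ^ 2 → ∃ M, M + 1 ≤ L ∧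
      truncSum L N k β (2 * X / β) ≤ ∏ p : Fin M,
        (1 - Real.exp (-(β * ((1 - δ) * (N / 2))) * pathFreq (M + 1) (p + 1)))⁻¹) :
    Real.log (partitionFunction L β N) ≤ Real.log (2 * (N * L + 1)) +
      L * (-C₁ / w * (1 + bosonErr * (δ + 1 / w))) := by
  have hD := neg_pos.mpr C₁_neg
  have hA := bosonErr_pos
  have hw0 : 0 < w := by linarith
  have hNpos : (0 : ℝ) < N := by exact_mod_cast hN
  have hX0 : 0 ≤ X := (log_partitionFunction_nonneg L N (by positivity)).trans hX
  set Φ := L * (-C₁ / w * (1 + bosonErr * (δ + 1 / w))) with hΦ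
  have hΦ0 : 0 ≤ Φ := by positivity
  have hmain := partitionFunction_le_of_truncSum (L := L) (N := N) (β := β) (E := 2 * X / β)
    (B := Real.exp Φ) hβ.le (by
      intro k hkL hk
      rcases Nat.eq_zero_or_pos k with rfl | hk0
      · exact (truncSum_zero_le β _ hβ.le).trans (Real.one_le_exp hΦ0)
      rcases hk with hk | hk
      · omega
      have hLpos : (0 : ℝ) < L := by
        have : L ≠ 0 := by
          rintro rfl
          omega
        positivity
      have hk' : (k : ℝ) ≤ 32 * X * L ^ 2 / w ^ 2 := by
        rw [div_lt_div_iff₀ (by positivity) hβ] at hk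
        rw [le_div_iff₀ (by positivity)]
        have h1 := mul_le_mul_of_nonneg_left hwb (Nat.cast_nonneg (α := ℝ) k)
        linarith
      obtain ⟨M, hM, h⟩ := hB k hk0 hk'
      refine h.trans ?_
      have h1 := log_prod_boson_le_of_error hM (c := β * ((1 - δ) * (N / 2))) hw hδ0 hδ (by
        have : 0 ≤ 1 - δ := by linarith
        have := mul_le_mul_of_nonneg_left hwb this
        linarith)
      refine (Real.log_le_iff_le_exp ?_).mp h1
      refine Finset.prod_pos fun p _ => inv_pos.mpr ?_
      have h2 := pathFreq_pos (n := M + 1) (p := p + 1) (by omega) (by omega)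
      have h3 : 0 < 1 - δ := by linarith
      have h4 : Real.exp (-(β * ((1 - δ) * (N / 2))) * pathFreq (M + 1) (p + 1)) < 1 :=
        Real.exp_lt_one_iff.mpr (by
          rw [neg_mul]
          exact neg_neg_of_pos (by positivity))
      linarith)
  have hZ1 := one_le_partitionFunction L N hβ.le
  have hZ2 := one_le_partitionFunction L N (by positivity : 0 ≤ β / 2)
  have h1 : Real.exp (-(β * (2 * X / β) / 2)) * partitionFunction L (β / 2) N ≤ 1 := by
    have h2 : β * (2 * X / β) / 2 = X := by field_simp
    rw [h2]
    have h3 := (Real.log_le_iff_le_exp (by linarith)).mp hX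
    calc _ ≤ Real.exp (-X) * Real.exp X := by gcongr
      _ = 1 := by rw [← Real.exp_add]; simp
  have h2 : 1 ≤ ((N : ℝ) * L + 1) * Real.exp Φ := by
    have h3 := Real.one_le_exp hΦ0
    have h4 : (0 : ℝ) ≤ (N : ℝ) * L := by positivity
    nlinarith
  have h3 : partitionFunction L β N ≤ 2 * (N * L + 1) * Real.exp Φ := by linarith
  have h4 := Real.log_le_log (by linarith) h3
  rwa [Real.log_mul (by positivity) (Real.exp_pos Φ).ne', Real.log_exp] at h4

/-- Improvement of an a priori bound on the partition function, for small spin. -/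
theorem log_partitionFunction_le_of_small_spin {β X w : ℝ} (hβ : 0 < β) (hN : 1 ≤ N) (hw : 1 ≤ w)
    (hwb : w ^ 2 ≤ β * N / 2) (hX : Real.log (partitionFunction L (β / 2) N) ≤ X)
    (hδ : 43008 * (X ^ 2 * L ^ 3 / w ^ 4) ≤ 1 / 2) :
    Real.log (partitionFunction L β N) ≤ Real.log (2 * (N * L + 1)) +
      L * (-C₁ / w * (1 + bosonErr * (43008 * (X ^ 2 * L ^ 3 / w ^ 4) + 1 / w))) := by
  have hw0 : 0 < w := by linarith
  have hNpos : (0 : ℝ) < N := by exact_mod_cast hN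
  have hX0 : 0 ≤ X := (log_partitionFunction_nonneg L N (by positivity)).trans hX
  refine log_partitionFunction_le_of_bosons hβ hN hw hwb (by positivity) hδ hX ?_
  intro k hk1 hk
  have hk1' : (1 : ℝ) ≤ k := by exact_mod_cast hk1
  -- `ρ` measures the probability of collisions, as `k² ≤ 1024 L ρ`. With `L/10 ≤ R ≤ L/2` the two
  -- collision terms give `40960 + 2048 = 43008`, and the smallness assumed in `hδ` also forces `84
  -- k² ≤ L`.
  set ρ := X ^ 2 * (L : ℝ) ^ 3 / w ^ 4 with hρ
  have hρ0 : 0 ≤ ρ := by positivity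
  have hksq : (k : ℝ) ^ 2 ≤ 1024 * L * ρ := by
    calc (k : ℝ) ^ 2 ≤ (32 * X * L ^ 2 / w ^ 2) ^ 2 := by gcongr
      _ = 1024 * L * ρ := by rw [hρ]; field_simp; ring
  have hkL : 84 * (k : ℝ) ^ 2 ≤ L := by
    have h1 : (L : ℝ) * ρ ≤ L * (1 / 86016) := by
      gcongr
      linarith
    linarith
  have hL84 : (84 : ℝ) ≤ L := by nlinarith
  have hL84' : 84 ≤ L := by exact_mod_cast hL84
  have hkL' : k ≤ L := by
    have : (k : ℝ) ≤ L := by nlinarith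
    exact_mod_cast this
  have hR1 : (L : ℝ) / 10 ≤ ((L - 3) / 2 : ℕ) := by
    have h1 : L ≤ 10 * ((L - 3) / 2) := by omega
    have h2 : (L : ℝ) ≤ 10 * ((L - 3) / 2 : ℕ) := by exact_mod_cast h1
    linarith
  have hR2 : (((L - 3) / 2 : ℕ) : ℝ) ≤ L / 2 := by
    have h1 : 2 * ((L - 3) / 2) ≤ L := by omega
    have h2 : 2 * (((L - 3) / 2 : ℕ) : ℝ) ≤ L := by exact_mod_cast h1
    linarith
  refine ⟨L - k, by omega, truncSum_le_of_spread hkL' hN (R := (L - 3) / 2) (by omega) (by omega)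
    hβ (by linarith) ?_⟩
  have hLpos : (0 : ℝ) < L := by linarith
  set R : ℝ := (((L - 3) / 2 : ℕ) : ℝ)
  have hRpos : 0 < R := lt_of_lt_of_le (by positivity) hR1
  have h1 : 4 * (k : ℝ) ^ 2 / R ≤ 40960 * ρ := by
    rw [div_le_iff₀ hRpos]
    have : ρ * (L / 10) ≤ ρ * R := by gcongr
    linarith
  have h2 : 2 * X / β / N ≤ X / w ^ 2 := by
    rw [div_div, div_le_div_iff₀ (by positivity) (by positivity)]
    have := mul_le_mul_of_nonneg_left hwb hX0
    linarith
  have h3 : 128 * R * k * (2 * X / β) / N ≤ 2048 * ρ := by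
    calc 128 * R * k * (2 * X / β) / N = 128 * R * k * (2 * X / β / N) := by ring
      _ ≤ 128 * (L / 2) * (32 * X * L ^ 2 / w ^ 2) * (X / w ^ 2) := by gcongr
      _ = 2048 * ρ := by rw [hρ]; field_simp; ring
  linarith

/-- Improvement of an a priori bound on the partition function, for large spin. -/
theorem log_partitionFunction_le_of_large_spin {β X w : ℝ} (hβ : 0 < β) (hN : 1 ≤ N) (hL : 1 ≤ L)
    (hw : 1 ≤ w) (hwb : w ^ 2 ≤ β * N / 2) (hX : Real.log (partitionFunction L (β / 2) N) ≤ X)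
    (hδ : 2048 * (X ^ 2 * L ^ 4 / (w ^ 4 * N)) ≤ 1 / 2) :
    Real.log (partitionFunction L β N) ≤ Real.log (2 * (N * L + 1)) +
      L * (-C₁ / w * (1 + bosonErr * (2048 * (X ^ 2 * L ^ 4 / (w ^ 4 * N)) + 1 / w))) := by
  have hw0 : 0 < w := by linarith
  have hNpos : (0 : ℝ) < N := by exact_mod_cast hN
  have hX0 : 0 ≤ X := (log_partitionFunction_nonneg L N (by positivity)).trans hX
  refine log_partitionFunction_le_of_bosons hβ hN hw hwb (by positivity) hδ hX ?_
  intro k hk1 hk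
  have hk1' : (1 : ℝ) ≤ k := by exact_mod_cast hk1
  -- The constant is `2048 = 2 · 32²`, from the bound on the particle number.
  have hksq : 2 * (k : ℝ) ^ 2 / N ≤ 2048 * (X ^ 2 * L ^ 4 / (w ^ 4 * N)) := by
    calc 2 * (k : ℝ) ^ 2 / N ≤ 2 * (32 * X * L ^ 2 / w ^ 2) ^ 2 / N := by gcongr
      _ = _ := by field_simp; ring
  have hkN : k ≤ N := by
    have h1 : 2 * (k : ℝ) ^ 2 / N ≤ 1 / 2 := hksq.trans hδ
    rw [div_le_iff₀ hNpos] at h1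
    have : (k : ℝ) ≤ N := by nlinarith
    exact_mod_cast this
  obtain ⟨M, rfl⟩ : ∃ M, L = M + 1 := ⟨L - 1, by omega⟩
  exact ⟨M, le_rfl, truncSum_le_of_stack hkN hN hβ (by linarith) hksq⟩

end Bootstrap

end

end Heisenberg

namespace Heisenberg

noncomputable section

/-! ### Choice of the length scales. -/

section Asymptotics

variable {N : ℕ}

lemma le_ceil_le_two_mul {x : ℝ} (hx : 1 ≤ x) : x ≤ ⌈x⌉₊ ∧ (⌈x⌉₊ : ℝ) ≤ 2 * x :=
  ⟨Nat.le_ceil x, by have := Nat.ceil_lt_add_one (by linarith : 0 ≤ x); linarith⟩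

set_option maxHeartbeats 2000000 in
/-- Three successive improvements of the trivial bound on the partition function. -/
theorem exists_length_of_small_spin : ∃ C η : ℝ, 0 < C ∧ 0 < η ∧
    ∀ (β t r : ℝ) (N : ℕ), 0 < β → 1 ≤ N → β * N / 2 = t ^ 96 → 0 < t → 1 ≤ r → r ^ 2 ≤ η * t →
      Real.exp (r ^ 6) = t ^ 96 → (N : ℝ) + 1 ≤ Real.exp (5 * r ^ 6) →
      ∃ L : ℕ, L ≠ 0 ∧ Real.log (partitionFunction L β N) / L ≤
        -C₁ / t ^ 48 * (1 + C * (r ^ 5 / t ^ 8)) := by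
  have hD := neg_pos.mpr C₁_neg
  have hB := bosonErr_pos
  set D := -C₁ with hDdef
  set B := bosonErr with hBdef
  -- `G` is the constant of the second round: 7 from counting sectors, the rest from the bosons. `T`
  -- collects the lower bounds on `t` needed below. The exponent 96 keeps all powers of `t`
  -- integral.
  let G := 7 + 8 * D * (1 + 2 * B)
  have hG : 0 < G := by positivity
  let T := 2 ^ 36 + 4 * D * (1 + 2 * B) + 2 ^ 28 * G ^ 2
  have hT0 : 0 < T := by positivity
  refine ⟨7 / D + B * (43008 * 2048 * G ^ 2 + 1), 1 / T, by positivity, by positivity, ?_⟩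
  intro β t r N hβ hN hb ht0 hr hrt hexp hNexp
  have hTt : T * r ^ 2 ≤ t := by
    rw [div_mul_eq_mul_div, one_mul, le_div_iff₀ hT0] at hrt
    linarith
  have hr0 : 0 < r := by linarith
  have hr2 : 1 ≤ r ^ 2 := one_le_pow₀ hr
  have hT1 : (2 : ℝ) ^ 36 ≤ T := by
    have : 0 ≤ 4 * D * (1 + 2 * B) + 2 ^ 28 * G ^ 2 := by positivity
    simp only [T]
    linarith
  have hT2 : 4 * D * (1 + 2 * B) ≤ T := by
    have : 0 ≤ 2 ^ 36 + 2 ^ 28 * G ^ 2 := by positivity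
    simp only [T]
    linarith
  have hT3 : 2 ^ 28 * G ^ 2 ≤ T := by
    have : 0 ≤ 2 ^ 36 + 4 * D * (1 + 2 * B) := by positivity
    simp only [T]
    linarith
  have hTle : T ≤ t := by nlinarith
  have ht2 : 2 ^ 36 ≤ t := hT1.trans hTle
  have ht1 : 1 ≤ t := by linarith
  have hrt' : r ^ 2 ≤ t := by nlinarith
  have hr6 : r ^ 6 ≤ t ^ 3 := by
    calc r ^ 6 = (r ^ 2) ^ 3 := by ring
      _ ≤ t ^ 3 := by gcongr
  have hr12 : r ^ 12 ≤ t ^ 6 := by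
    calc r ^ 12 = (r ^ 2) ^ 6 := by ring
      _ ≤ t ^ 6 := by gcongr
  have hr16 : 1 ≤ r ^ 6 := one_le_pow₀ hr
  have hrlt : r ≤ t := by nlinarith
  have hNpos : (0 : ℝ) < N := by exact_mod_cast hN
  have hlogN : Real.log ((N : ℝ) + 1) ≤ 5 * r ^ 6 :=
    (Real.log_le_iff_le_exp (by positivity)).mpr hNexp
  have hlog : ∀ ℓ : ℕ, 1 ≤ ℓ → (ℓ : ℝ) ≤ t ^ 96 → Real.log (2 * ((N : ℝ) * ℓ + 1)) ≤ 7 * r ^ 6 := by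
    intro ℓ hℓ1 hℓ
    refine (Real.log_le_iff_le_exp (by positivity)).mpr ?_
    have hℓ1' : (1 : ℝ) ≤ ℓ := by exact_mod_cast hℓ1
    have h2 : 2 ≤ Real.exp (r ^ 6) := by
      have := Real.add_one_le_exp (r ^ 6)
      linarith
    calc 2 * ((N : ℝ) * ℓ + 1) ≤ 2 * (((N : ℝ) + 1) * ℓ) := by linarith
      _ ≤ Real.exp (r ^ 6) * (Real.exp (5 * r ^ 6) * Real.exp (r ^ 6)) := by
          rw [← hexp] at hℓ
          gcongr
      _ = Real.exp (7 * r ^ 6) := by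
          rw [← Real.exp_add, ← Real.exp_add]
          congr 1
          ring
  -- Each round uses a bound at half its inverse temperature, so the rounds run at `β/4`, `β/2` and
  -- `β`. The value `t ^ 48 / 2` is an admissible `w` in the first two.
  have hw1 : 1 ≤ t ^ 48 / 2 := by
    have : t ≤ t ^ 48 := le_self_pow₀ ht1 (by norm_num)
    linarith
  have hfac : D / (t ^ 48 / 2) * (1 + B * (1 / 2 + 1 / (t ^ 48 / 2))) ≤
      2 * D * (1 + 2 * B) / t ^ 48 := by
    have h1 : 1 / (t ^ 48 / 2) ≤ 1 := by
      rw [div_le_one (by positivity)]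
      exact hw1
    calc D / (t ^ 48 / 2) * (1 + B * (1 / 2 + 1 / (t ^ 48 / 2)))
        ≤ D / (t ^ 48 / 2) * (1 + B * (1 / 2 + 1)) := by gcongr
      _ ≤ D / (t ^ 48 / 2) * (1 + 2 * B) :=
          mul_le_mul_of_nonneg_left (by linarith) (by positivity)
      _ = _ := by ring
  -- the first length scale
  obtain ⟨hl1, hl1'⟩ := le_ceil_le_two_mul (one_le_pow₀ ht1 : 1 ≤ t ^ 36)
  set ℓ₁ := ⌈t ^ 36⌉₊
  have hl1pos : (0 : ℝ) < ℓ₁ := lt_of_lt_of_le (by positivity) hl1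
  have hl1nat : 1 ≤ ℓ₁ := by exact_mod_cast hl1pos
  have hl1b : (ℓ₁ : ℝ) ≤ t ^ 96 := by
    calc (ℓ₁ : ℝ) ≤ 2 * t ^ 36 := hl1'
      _ ≤ t * t ^ 36 := by gcongr; linarith
      _ = t ^ 37 := by ring
      _ ≤ t ^ 96 := pow_le_pow_right₀ ht1 (by norm_num)
  have hX1 : Real.log (partitionFunction ℓ₁ (β / 4 / 2) N) ≤ ℓ₁ * (5 * r ^ 6) :=
    (log_partitionFunction_le ℓ₁ N (by positivity)).trans (by gcongr)
  -- With the trivial, extensive `X` the collision error is of order `r¹² t^(5·36 - 192)`, and `r¹²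
  -- ≤ t⁶`.
  have hδ1 : 43008 * ((ℓ₁ * (5 * r ^ 6)) ^ 2 * (ℓ₁ : ℝ) ^ 3 / (t ^ 48 / 2) ^ 4) ≤ 1 / 2 := by
    have h1 : (ℓ₁ * (5 * r ^ 6)) ^ 2 * (ℓ₁ : ℝ) ^ 3 / (t ^ 48 / 2) ^ 4 ≤ 12800 / t ^ 6 := by
      calc (ℓ₁ * (5 * r ^ 6)) ^ 2 * (ℓ₁ : ℝ) ^ 3 / (t ^ 48 / 2) ^ 4
          = 25 * r ^ 12 * (ℓ₁ : ℝ) ^ 5 / (t ^ 48 / 2) ^ 4 := by ring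
        _ ≤ 25 * t ^ 6 * (2 * t ^ 36) ^ 5 / (t ^ 48 / 2) ^ 4 := by gcongr
        _ = 12800 / t ^ 6 := by field_simp; norm_num
    have h2 : 12800 / t ^ 6 ≤ 12800 / 2 ^ 36 := by
      have : t ≤ t ^ 6 := le_self_pow₀ ht1 (by norm_num)
      gcongr
      linarith
    norm_num at h2
    linarith
  -- At this length the bosons contribute only of order `t^(36 - 48)`. The bound is dominated by the
  -- logarithm of the number of sectors and is no longer proportional to the length.
  have hZ1 : Real.log (partitionFunction ℓ₁ (β / 4) N) ≤ 8 * r ^ 6 := by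
    have h := log_partitionFunction_le_of_small_spin (L := ℓ₁) (β := β / 4) (by positivity) hN hw1
      (by nlinarith [hb]) hX1 hδ1
    have h1 := hlog ℓ₁ hl1nat hl1b
    have h2 : (ℓ₁ : ℝ) * (D / (t ^ 48 / 2) * (1 + B * (43008 * ((ℓ₁ * (5 * r ^ 6)) ^ 2 *
        (ℓ₁ : ℝ) ^ 3 / (t ^ 48 / 2) ^ 4) + 1 / (t ^ 48 / 2)))) ≤ 1 := by
      calc _ ≤ (ℓ₁ : ℝ) * (D / (t ^ 48 / 2) * (1 + B * (1 / 2 + 1 / (t ^ 48 / 2)))) := by gcongr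
        _ ≤ (2 * t ^ 36) * (2 * D * (1 + 2 * B) / t ^ 48) := by gcongr
        _ = 4 * D * (1 + 2 * B) / t ^ 12 := by field_simp; ring
        _ ≤ 1 := by
          rw [div_le_one (by positivity)]
          have : t ≤ t ^ 12 := le_self_pow₀ ht1 (by norm_num)
          linarith
    linarith
  -- the second length scale
  obtain ⟨hq2, hq2'⟩ := le_ceil_le_two_mul (one_le_pow₀ ht1 : 1 ≤ t ^ 15)
  set q₂ := ⌈t ^ 15⌉₊
  have hq2pos : (0 : ℝ) < q₂ := lt_of_lt_of_le (by positivity) hq2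
  have hq2nat : 1 ≤ q₂ := by exact_mod_cast hq2pos
  have hl2' : ((q₂ * ℓ₁ : ℕ) : ℝ) ≤ 4 * t ^ 51 := by
    push_cast
    calc (q₂ : ℝ) * ℓ₁ ≤ (2 * t ^ 15) * (2 * t ^ 36) := by gcongr
      _ = 4 * t ^ 51 := by ring
  have hl2b : ((q₂ * ℓ₁ : ℕ) : ℝ) ≤ t ^ 96 := by
    calc ((q₂ * ℓ₁ : ℕ) : ℝ) ≤ 4 * t ^ 51 := hl2'
      _ ≤ t * t ^ 51 := by gcongr; linarith
      _ = t ^ 52 := by ring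
      _ ≤ t ^ 96 := pow_le_pow_right₀ ht1 (by norm_num)
  have hX2 : Real.log (partitionFunction (q₂ * ℓ₁) (β / 2 / 2) N) ≤ q₂ * (8 * r ^ 6) := by
    have h1 : β / 2 / 2 = β / 4 := by ring
    rw [h1]
    exact (log_partitionFunction_mul_le q₂ ℓ₁ N (by positivity)).trans (by gcongr)
  have hδ2 : 43008 * ((q₂ * (8 * r ^ 6)) ^ 2 * ((q₂ * ℓ₁ : ℕ) : ℝ) ^ 3 / (t ^ 48 / 2) ^ 4) ≤
      1 / 2 := by
    have h1 : (q₂ * (8 * r ^ 6)) ^ 2 * ((q₂ * ℓ₁ : ℕ) : ℝ) ^ 3 / (t ^ 48 / 2) ^ 4 ≤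
        262144 / t ^ 3 := by
      calc (q₂ * (8 * r ^ 6)) ^ 2 * ((q₂ * ℓ₁ : ℕ) : ℝ) ^ 3 / (t ^ 48 / 2) ^ 4
          = 64 * r ^ 12 * (q₂ : ℝ) ^ 2 * ((q₂ * ℓ₁ : ℕ) : ℝ) ^ 3 / (t ^ 48 / 2) ^ 4 := by ring
        _ ≤ 64 * t ^ 6 * (2 * t ^ 15) ^ 2 * (4 * t ^ 51) ^ 3 / (t ^ 48 / 2) ^ 4 := by gcongr
        _ = 262144 / t ^ 3 := by field_simp; norm_num
    have h2 : 262144 / t ^ 3 ≤ 262144 / 2 ^ 36 := by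
      have : t ≤ t ^ 3 := le_self_pow₀ ht1 (by norm_num)
      gcongr
      linarith
    norm_num at h2
    linarith
  -- Now the bosons contribute of order `t^(51 - 48) = t³`, which dominates because `r⁶ ≤ t³`. This
  -- is the true order of magnitude.
  have hZ2 : Real.log (partitionFunction (q₂ * ℓ₁) (β / 2) N) ≤ G * t ^ 3 := by
    have hpos96 : 0 < t ^ 96 := by positivity
    have h := log_partitionFunction_le_of_small_spin (L := q₂ * ℓ₁) (β := β / 2) (by positivity) hN
      hw1 (by nlinarith [hb]) hX2 hδ2
    have h1 := hlog (q₂ * ℓ₁) (Nat.mul_pos hq2nat hl1nat) hl2b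
    have h2 : ((q₂ * ℓ₁ : ℕ) : ℝ) * (D / (t ^ 48 / 2) * (1 + B * (43008 * ((q₂ * (8 * r ^ 6)) ^ 2 *
        ((q₂ * ℓ₁ : ℕ) : ℝ) ^ 3 / (t ^ 48 / 2) ^ 4) + 1 / (t ^ 48 / 2)))) ≤
        8 * D * (1 + 2 * B) * t ^ 3 := by
      calc _ ≤ ((q₂ * ℓ₁ : ℕ) : ℝ) *
            (D / (t ^ 48 / 2) * (1 + B * (1 / 2 + 1 / (t ^ 48 / 2)))) := by gcongr
        _ ≤ (4 * t ^ 51) * (2 * D * (1 + 2 * B) / t ^ 48) := by gcongr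
        _ = 8 * D * (1 + 2 * B) * t ^ 3 := by field_simp; ring
    have h3 : G * t ^ 3 = 7 * t ^ 3 + 8 * D * (1 + 2 * B) * t ^ 3 := by
      simp only [G]
      ring
    linarith
  -- the third length scale
  have htr : 1 ≤ t ^ 5 * r := one_le_mul_of_one_le_of_one_le (one_le_pow₀ ht1) hr
  obtain ⟨hq3, hq3'⟩ := le_ceil_le_two_mul htr
  set q₃ := ⌈t ^ 5 * r⌉₊
  have hq3pos : (0 : ℝ) < q₃ := lt_of_lt_of_le (by positivity) hq3
  have hq3nat : 1 ≤ q₃ := by exact_mod_cast hq3pos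
  have hl3 : t ^ 56 * r ≤ ((q₃ * (q₂ * ℓ₁) : ℕ) : ℝ) := by
    push_cast
    calc t ^ 56 * r = (t ^ 5 * r) * (t ^ 15 * t ^ 36) := by ring
      _ ≤ (q₃ : ℝ) * ((q₂ : ℝ) * (ℓ₁ : ℝ)) := by gcongr
  have hl3' : ((q₃ * (q₂ * ℓ₁) : ℕ) : ℝ) ≤ 8 * (t ^ 56 * r) := by
    rw [Nat.cast_mul]
    calc (q₃ : ℝ) * ((q₂ * ℓ₁ : ℕ) : ℝ) ≤ (2 * (t ^ 5 * r)) * (4 * t ^ 51) := by gcongr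
      _ = 8 * (t ^ 56 * r) := by ring
  have hl3b : ((q₃ * (q₂ * ℓ₁) : ℕ) : ℝ) ≤ t ^ 96 := by
    calc ((q₃ * (q₂ * ℓ₁) : ℕ) : ℝ) ≤ 8 * (t ^ 56 * r) := hl3'
      _ ≤ t * (t ^ 56 * t) := by gcongr; linarith
      _ = t ^ 58 := by ring
      _ ≤ t ^ 96 := pow_le_pow_right₀ ht1 (by norm_num)
  have hX3 : Real.log (partitionFunction (q₃ * (q₂ * ℓ₁)) (β / 2) N) ≤ q₃ * (G * t ^ 3) :=
    (log_partitionFunction_mul_le q₃ (q₂ * ℓ₁) N (by positivity)).trans (by gcongr)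
  -- The length `t⁵⁶ r` balances the errors: collisions give `r⁵/t⁸`, and the sector count `r⁶`
  -- divided by the boson term of order `t⁵⁶ r / t⁴⁸` gives the same.
  have hρ3 : (q₃ * (G * t ^ 3)) ^ 2 * ((q₃ * (q₂ * ℓ₁) : ℕ) : ℝ) ^ 3 / (t ^ 48) ^ 4 ≤
      2048 * G ^ 2 * (r ^ 5 / t ^ 8) := by
    calc (q₃ * (G * t ^ 3)) ^ 2 * ((q₃ * (q₂ * ℓ₁) : ℕ) : ℝ) ^ 3 / (t ^ 48) ^ 4
        ≤ ((2 * (t ^ 5 * r)) * (G * t ^ 3)) ^ 2 * (8 * (t ^ 56 * r)) ^ 3 / (t ^ 48) ^ 4 := by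
          gcongr
      _ = 2048 * G ^ 2 * (r ^ 5 / t ^ 8) := by field_simp; ring
  have hr5 : r ^ 5 ≤ t ^ 3 := (pow_le_pow_right₀ hr (by norm_num)).trans hr6
  have hδ3 : 43008 * ((q₃ * (G * t ^ 3)) ^ 2 * ((q₃ * (q₂ * ℓ₁) : ℕ) : ℝ) ^ 3 / (t ^ 48) ^ 4) ≤
      1 / 2 := by
    have h1 : r ^ 5 / t ^ 8 ≤ 1 / T := by
      rw [div_le_div_iff₀ (by positivity) hT0, one_mul]
      calc r ^ 5 * T ≤ t ^ 3 * t := by gcongr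
        _ = t ^ 4 := by ring
        _ ≤ t ^ 8 := pow_le_pow_right₀ ht1 (by norm_num)
    calc _ ≤ 43008 * (2048 * G ^ 2 * (1 / T)) := by
          refine mul_le_mul_of_nonneg_left (hρ3.trans ?_) (by norm_num)
          gcongr
      _ ≤ 1 / 2 := by
          rw [mul_one_div, mul_div_assoc', div_le_div_iff₀ hT0 two_pos]
          nlinarith [sq_nonneg G]
  have hw3 : 1 ≤ t ^ 48 := one_le_pow₀ ht1
  have h := log_partitionFunction_le_of_small_spin (L := q₃ * (q₂ * ℓ₁)) hβ hN hw3
    (by rw [hb, ← pow_mul]) hX3 hδ3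
  refine ⟨q₃ * (q₂ * ℓ₁), (Nat.mul_pos hq3nat (Nat.mul_pos hq2nat hl1nat)).ne', ?_⟩
  have h1 := hlog _ (Nat.mul_pos hq3nat (Nat.mul_pos hq2nat hl1nat)) hl3b
  set ℓ : ℝ := ((q₃ * (q₂ * ℓ₁) : ℕ) : ℝ)
  have hℓpos : 0 < ℓ := lt_of_lt_of_le (by positivity) hl3
  set e := r ^ 5 / t ^ 8 with he
  have he0 : 0 < e := by positivity
  have hwe : 1 / t ^ 48 ≤ e := by
    rw [he, div_le_div_iff₀ (by positivity) (by positivity), one_mul]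
    calc t ^ 8 ≤ t ^ 48 := pow_le_pow_right₀ ht1 (by norm_num)
      _ ≤ r ^ 5 * t ^ 48 := le_mul_of_one_le_left (by positivity) (one_le_pow₀ hr)
  have h2 : Real.log (2 * ((N : ℝ) * ℓ + 1)) ≤ ℓ * (D / t ^ 48 * (7 / D * e)) := by
    calc _ ≤ 7 * r ^ 6 := h1
      _ = (t ^ 56 * r) * (D / t ^ 48 * (7 / D * e)) := by rw [he]; field_simp
      _ ≤ _ := by gcongr
  have h3 : ℓ * (D / t ^ 48 * (1 + B * (43008 * ((q₃ * (G * t ^ 3)) ^ 2 * ℓ ^ 3 / (t ^ 48) ^ 4) +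
      1 / t ^ 48))) ≤ ℓ * (D / t ^ 48 * (1 + B * (43008 * (2048 * G ^ 2 * e) + e))) := by
    gcongr
  rw [div_le_iff₀ hℓpos]
  calc _ ≤ ℓ * (D / t ^ 48 * (7 / D * e)) +
        ℓ * (D / t ^ 48 * (1 + B * (43008 * (2048 * G ^ 2 * e) + e))) := by linarith
    _ = _ := by ring

/-- One improvement of the trivial bound on the partition function, for large spin. -/
theorem exists_length_of_large_spin : ∃ C T : ℝ, 0 < C ∧ 0 < T ∧
    ∀ (β S t u : ℝ) (N : ℕ), 0 < β → 1 ≤ N → S = (N : ℝ) / 2 → β * S = t ^ 96 → T ≤ t → 1 ≤ u →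
      Real.exp (u ^ 3) = S ^ 2 * t ^ 96 → t ^ 384 ≤ S →
      ∃ L : ℕ, L ≠ 0 ∧ Real.log (partitionFunction L β N) / L ≤
        -C₁ / t ^ 48 * (1 + C * (u / t ^ 8)) := by
  have hD := neg_pos.mpr C₁_neg
  have hB := bosonErr_pos
  set D := -C₁ with hDdef
  set B := bosonErr with hBdef
  -- Here `288 = 9 · 2⁶ / 2` arises in the collision error, and `36 = 3 · 12` from `log S ≤ 12
  -- S^(1/12)`.
  let K : ℝ := 288 * 36 ^ 6
  have hK : K = 288 * 36 ^ 6 := rfl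
  refine ⟨3 / D + B * (2048 * K + 1), 4096 * K, by positivity, by positivity, ?_⟩
  intro β S t u N hβ hN hS hb htT hu hexp htS
  have ht16 : 16 ≤ t := by
    rw [hK] at htT
    norm_num at htT
    linarith
  have ht1 : 1 ≤ t := by linarith
  have ht0 : 0 < t := by linarith
  have hu0 : 0 < u := by linarith
  have htS' : t ≤ S := (le_self_pow₀ ht1 (by norm_num)).trans htS
  have hS16 : 16 ≤ S := by linarith
  have hS0 : 0 < S := by linarith
  have hNS : (N : ℝ) = 2 * S := by rw [hS]; ring
  have hS2 : S ^ 2 ≤ Real.exp (u ^ 3) := by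
    rw [hexp]
    exact le_mul_of_one_le_right (by positivity) (one_le_pow₀ ht1)
  have hexpS : Real.exp (u ^ 3) ≤ S ^ 3 := by
    rw [hexp]
    have : t ^ 96 ≤ S := (pow_le_pow_right₀ ht1 (by norm_num)).trans htS
    calc S ^ 2 * t ^ 96 ≤ S ^ 2 * S := by gcongr
      _ = S ^ 3 := by ring
  have hS6 : S ^ 6 ≤ Real.exp (3 * u ^ 3) := by
    have h1 : Real.exp (3 * u ^ 3) = Real.exp (u ^ 3) ^ 3 := by
      rw [← Real.exp_nat_mul]
      norm_num
    rw [h1]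
    calc S ^ 6 = (S ^ 2) ^ 3 := by ring
      _ ≤ _ := by gcongr
  have hu18 : u ^ 18 ≤ 36 ^ 6 * (S / t ^ 192) := by
    have h1 : u ^ 3 ≤ 3 * Real.log S := by
      have := Real.log_le_log (Real.exp_pos _) hexpS
      rw [Real.log_exp, Real.log_pow] at this
      exact_mod_cast this
    have h2 := Real.log_le_rpow_div hS0.le (ε := 1 / 12) (by norm_num)
    have h3 : u ^ 3 ≤ 36 * S ^ (1 / 12 : ℝ) := by linarith
    have h4 : (S ^ (1 / 12 : ℝ)) ^ 6 = Real.sqrt S := by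
      rw [← Real.rpow_natCast, ← Real.rpow_mul hS0.le, Real.sqrt_eq_rpow]
      norm_num
    have h5 : t ^ 192 ≤ Real.sqrt S := by
      refine Real.le_sqrt_of_sq_le ?_
      rw [← pow_mul]
      exact htS
    calc u ^ 18 = (u ^ 3) ^ 6 := by ring
      _ ≤ (36 * S ^ (1 / 12 : ℝ)) ^ 6 := by gcongr
      _ = 36 ^ 6 * Real.sqrt S := by rw [mul_pow, h4]
      _ ≤ 36 ^ 6 * (S / t ^ 192) := by
          gcongr
          rw [le_div_iff₀ (by positivity)]
          calc Real.sqrt S * t ^ 192 ≤ Real.sqrt S * Real.sqrt S := by gcongr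
            _ = S := Real.mul_self_sqrt hS0.le
  have hu2 : 1 ≤ t ^ 56 * u ^ 2 := one_le_mul_of_one_le_of_one_le (one_le_pow₀ ht1) (one_le_pow₀ hu)
  obtain ⟨hl, hl'⟩ := le_ceil_le_two_mul hu2
  -- Counting sectors costs order `u³`, which relative to the boson term `L / t⁴⁸` is `u/t⁸`. The
  -- collision error is much smaller because `S ≥ t³⁸⁴`, so the trivial a priori bound suffices.
  set L := ⌈t ^ 56 * u ^ 2⌉₊
  have hLpos : (0 : ℝ) < L := lt_of_lt_of_le (by positivity) hl
  have hLnat : 1 ≤ L := by exact_mod_cast hLpos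
  have hL1 : (1 : ℝ) ≤ L := by exact_mod_cast hLnat
  have hlogN : Real.log ((N : ℝ) + 1) ≤ 3 * u ^ 3 := by
    refine (Real.log_le_iff_le_exp (by positivity)).mpr (le_trans ?_ hS6)
    rw [hNS]
    have : S ^ 2 ≤ S ^ 6 := pow_le_pow_right₀ (by linarith) (by norm_num)
    nlinarith
  have hlog : Real.log (2 * ((N : ℝ) * L + 1)) ≤ 3 * u ^ 3 := by
    refine (Real.log_le_iff_le_exp (by positivity)).mpr ?_
    have h1 : u ^ 2 ≤ Real.exp (u ^ 3) := by
      have := Real.add_one_le_exp (u ^ 3)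
      have : u ^ 2 ≤ u ^ 3 := pow_le_pow_right₀ hu (by norm_num)
      linarith
    have h2 : t ^ 56 ≤ S := (pow_le_pow_right₀ ht1 (by norm_num)).trans htS
    have h3 : Real.exp (3 * u ^ 3) = Real.exp (u ^ 3) * Real.exp (u ^ 3) * Real.exp (u ^ 3) := by
      rw [← Real.exp_add, ← Real.exp_add]
      congr 1
      ring
    rw [h3, hNS]
    calc 2 * (2 * S * L + 1) ≤ 8 * S * L := by nlinarith
      _ ≤ 8 * S * (2 * (t ^ 56 * u ^ 2)) := by gcongr
      _ = 16 * S * t ^ 56 * u ^ 2 := by ring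
      _ ≤ S * S * S * Real.exp (u ^ 3) := by gcongr
      _ ≤ S * S * S * S * Real.exp (u ^ 3) := by
          have : 0 ≤ S * S * S * Real.exp (u ^ 3) := by positivity
          nlinarith
      _ = S ^ 2 * S ^ 2 * Real.exp (u ^ 3) := by ring
      _ ≤ _ := by gcongr
  have hX : Real.log (partitionFunction L (β / 2) N) ≤ L * (3 * u ^ 3) :=
    (log_partitionFunction_le L N (by positivity)).trans (by gcongr)
  have hρ : (L * (3 * u ^ 3)) ^ 2 * (L : ℝ) ^ 4 / ((t ^ 48) ^ 4 * N) ≤ K / t ^ 48 := by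
    rw [hNS]
    calc (L * (3 * u ^ 3)) ^ 2 * (L : ℝ) ^ 4 / ((t ^ 48) ^ 4 * (2 * S))
        ≤ ((2 * (t ^ 56 * u ^ 2)) * (3 * u ^ 3)) ^ 2 * (2 * (t ^ 56 * u ^ 2)) ^ 4 /
            ((t ^ 48) ^ 4 * (2 * S)) := by gcongr
      _ = 288 * t ^ 144 * u ^ 18 / S := by field_simp; ring
      _ ≤ 288 * t ^ 144 * (36 ^ 6 * (S / t ^ 192)) / S := by gcongr
      _ = K / t ^ 48 := by rw [hK]; field_simp
  have ht48 : t ≤ t ^ 48 := le_self_pow₀ ht1 (by norm_num)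
  have hδ : 2048 * ((L * (3 * u ^ 3)) ^ 2 * (L : ℝ) ^ 4 / ((t ^ 48) ^ 4 * N)) ≤ 1 / 2 := by
    have h1 : K / t ^ 48 ≤ 1 / 4096 := by
      rw [div_le_div_iff₀ (by positivity) (by norm_num)]
      linarith
    linarith
  have h := log_partitionFunction_le_of_large_spin hβ hN hLnat (one_le_pow₀ ht1 : 1 ≤ t ^ 48)
    (by rw [mul_div_assoc, ← hS, hb, ← pow_mul]) hX hδ
  refine ⟨L, by omega, ?_⟩
  set e := u / t ^ 8 with he
  have he0 : 0 < e := by positivity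
  have hwe : 1 / t ^ 48 ≤ e := by
    rw [he, div_le_div_iff₀ (by positivity) (by positivity), one_mul]
    calc t ^ 8 ≤ t ^ 48 := pow_le_pow_right₀ ht1 (by norm_num)
      _ ≤ u * t ^ 48 := le_mul_of_one_le_left (by positivity) hu
  have h2 : Real.log (2 * ((N : ℝ) * L + 1)) ≤ L * (D / t ^ 48 * (3 / D * e)) := by
    calc _ ≤ 3 * u ^ 3 := hlog
      _ = (t ^ 56 * u ^ 2) * (D / t ^ 48 * (3 / D * e)) := by rw [he]; field_simp
      _ ≤ _ := by gcongr
  have h3 : L * (D / t ^ 48 * (1 + B * (2048 * ((L * (3 * u ^ 3)) ^ 2 * (L : ℝ) ^ 4 /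
      ((t ^ 48) ^ 4 * N)) + 1 / t ^ 48))) ≤
      L * (D / t ^ 48 * (1 + B * (2048 * (K * e) + e))) := by
    have h4 : K / t ^ 48 ≤ K * e := by
      rw [div_eq_mul_one_div]
      gcongr
    have h5 := hρ.trans h4
    gcongr
  rw [div_le_iff₀ hLpos]
  calc _ ≤ L * (D / t ^ 48 * (3 / D * e)) +
        L * (D / t ^ 48 * (1 + B * (2048 * (K * e) + e))) := by linarith
    _ = _ := by ring

/-- The logarithm is eventually dominated by small powers. -/
lemma exists_log_le (η : ℝ) (hη : 0 < η) : ∃ K : ℝ, 1 ≤ K ∧ ∀ b, K ≤ b →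
    Real.log b ≤ η * b ^ (1 / 32 : ℝ) := by
  have h := (isLittleO_log_rpow_atTop (by norm_num : (0 : ℝ) < 1 / 32)).def hη
  obtain ⟨K, hK⟩ := Filter.eventually_atTop.mp h
  refine ⟨max K 1, le_max_right _ _, fun b hb => ?_⟩
  have h1 := hK b ((le_max_left _ _).trans hb)
  have hb1 : 1 ≤ b := (le_max_right _ _).trans hb
  rwa [Real.norm_of_nonneg (Real.log_nonneg hb1), Real.norm_of_nonneg (by positivity)] at h1

/-- The free energy of the chain is asymptotically bounded below by the one of free magnons. -/
theorem exists_le_freeEnergy : ∃ C K : ℝ, 0 < C ∧ 0 < K ∧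
    ∀ (β S : ℝ) (N : ℕ), 0 < β → 1 ≤ N → S = (N : ℝ) / 2 → K ≤ β * S →
      C₁ * S ^ (-(1 / 2) : ℝ) * β ^ (-(3 / 2) : ℝ) * (1 + C * errorTerm β S) ≤ freeEnergy β N := by
  obtain ⟨C, η, hC, hη, hsmall⟩ := exists_length_of_small_spin
  obtain ⟨C', T, hC', hT, hlarge⟩ := exists_length_of_large_spin
  -- As `1/32 = 3/96`, this says `r⁶ ≤ (η t)³`, that is `r² ≤ η t`.
  obtain ⟨K, hK1, hK⟩ := exists_log_le (η ^ 3) (by positivity)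
  refine ⟨2 * C + C', max (max K (T ^ 96)) (Real.exp 2), by positivity,
    lt_max_of_lt_right (Real.exp_pos 2), ?_⟩
  intro β S N hβ hN hS hKb
  have hbK : K ≤ β * S := (le_max_left _ _).trans ((le_max_left _ _).trans hKb)
  have hbT : T ^ 96 ≤ β * S := (le_max_right _ _).trans ((le_max_left _ _).trans hKb)
  have hbe : Real.exp 2 ≤ β * S := (le_max_right _ _).trans hKb
  have hNpos : (1 : ℝ) ≤ N := by exact_mod_cast hN
  have hS0 : 0 < S := by rw [hS]; linarith
  set b := β * S with hb
  have hb0 : 0 < b := by positivity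
  have hb3 : 3 ≤ b := by
    have := Real.add_one_le_exp (2 : ℝ)
    linarith
  have hlogb : 2 ≤ Real.log b := by
    have := Real.log_le_log (Real.exp_pos 2) hbe
    rwa [Real.log_exp] at this
  set t := b ^ (1 / 96 : ℝ) with ht
  have ht0 : 0 < t := by positivity
  have hpow : ∀ n : ℕ, t ^ n = b ^ ((n : ℝ) / 96) := by
    intro n
    rw [ht, ← Real.rpow_natCast, ← Real.rpow_mul hb0.le]
    congr 1
    ring
  have ht96 : t ^ 96 = b := by
    rw [hpow]
    norm_num
  have htT : T ≤ t := by
    refine le_of_pow_le_pow_left₀ (by norm_num : 96 ≠ 0) ht0.le ?_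
    rwa [ht96]
  have ht1 : 1 ≤ t := Real.one_le_rpow (by linarith) (by norm_num)
  set r := Real.log b ^ (1 / 6 : ℝ) with hr
  have hr1 : 1 ≤ r := Real.one_le_rpow (by linarith) (by norm_num)
  have hr6 : r ^ 6 = Real.log b := by
    rw [hr, ← Real.rpow_natCast, ← Real.rpow_mul (by linarith)]
    norm_num
  have hr3 : Real.log b ^ (1 / 2 : ℝ) = r ^ 3 := by
    rw [hr, ← Real.rpow_natCast, ← Real.rpow_mul (by linarith)]
    norm_num
  have hexpr : Real.exp (r ^ 6) = b := by rw [hr6, Real.exp_log hb0]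
  have hrt : r ^ 2 ≤ η * t := by
    refine le_of_pow_le_pow_left₀ (by norm_num : 3 ≠ 0) (by positivity) ?_
    have h1 := hK b hbK
    have h2 : b ^ (1 / 32 : ℝ) = t ^ 3 := by
      rw [hpow]
      norm_num
    rw [h2, ← hr6] at h1
    calc (r ^ 2) ^ 3 = r ^ 6 := by ring
      _ ≤ η ^ 3 * t ^ 3 := h1
      _ = (η * t) ^ 3 := by ring
  have hbS : β * S ^ 3 = b * S ^ 2 := by rw [hb]; ring
  -- Since `S ≥ 1/2`, `βS³ ≥ b/4`. The bound makes the cube root `u` positive and, for small spin,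
  -- lets `2u` absorb `r²`, which turns the error `r⁵/t⁸` into `errorTerm`.
  have hΛ : Real.log b / 8 ≤ Real.log (β * S ^ 3) := by
    have h1 : b * (1 / 4) ≤ β * S ^ 3 := by
      rw [hbS]
      have : 1 / 4 ≤ S ^ 2 := by
        have : 1 / 2 ≤ S := by rw [hS]; linarith
        nlinarith
      gcongr
    have h2 := Real.log_le_log (by positivity) h1
    rw [Real.log_mul hb0.ne' (by norm_num)] at h2
    have h3 : Real.log (1 / 4 : ℝ) = -(2 * Real.log 2) := by
      rw [one_div, Real.log_inv, show (4 : ℝ) = 2 ^ 2 by norm_num, Real.log_pow]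
      norm_num
    have h4 := Real.log_two_lt_d9
    linarith
  set u := Real.log (β * S ^ 3) ^ (1 / 3 : ℝ) with hu
  have hu0 : 0 < u := Real.rpow_pos_of_pos (by linarith) _
  have hu3 : u ^ 3 = Real.log (β * S ^ 3) := by
    rw [hu, ← Real.rpow_natCast, ← Real.rpow_mul (by linarith)]
    norm_num
  have hexpu : Real.exp (u ^ 3) = S ^ 2 * t ^ 96 := by
    rw [hu3, Real.exp_log (by positivity), hbS, ht96, mul_comm]
  have herr : errorTerm β S = r ^ 3 * u / t ^ 8 := by
    unfold errorTerm
    rw [← hb, hr3, ← hu]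
    have : b ^ (-(1 / 12) : ℝ) = (t ^ 8)⁻¹ := by
      rw [Real.rpow_neg hb0.le, hpow]
      norm_num
    rw [this]
    field_simp
  have hpref : S ^ (-(1 / 2) : ℝ) * β ^ (-(3 / 2) : ℝ) = 1 / β * (1 / t ^ 48) := by
    have h1 : t ^ 48 = β ^ (1 / 2 : ℝ) * S ^ (1 / 2 : ℝ) := by
      rw [hpow, ← Real.mul_rpow hβ.le hS0.le, ← hb]
      norm_num
    have h2 : β ^ (3 / 2 : ℝ) = β * β ^ (1 / 2 : ℝ) := by
      rw [← Real.rpow_one_add' hβ.le (by norm_num)]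
      norm_num
    rw [Real.rpow_neg hS0.le, Real.rpow_neg hβ.le, h1, h2]
    have := Real.rpow_pos_of_pos hβ (1 / 2)
    have := Real.rpow_pos_of_pos hS0 (1 / 2)
    field_simp
  have hD := neg_pos.mpr C₁_neg
  suffices hmain : ∃ L : ℕ, L ≠ 0 ∧ Real.log (partitionFunction L β N) / L ≤
      -C₁ / t ^ 48 * (1 + (2 * C + C') * errorTerm β S) by
    obtain ⟨L, hL, h⟩ := hmain
    refine le_trans ?_ (le_freeEnergy N hβ hL)
    have h1 := mul_le_mul_of_nonneg_left h (by positivity : 0 ≤ 1 / β)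
    calc C₁ * S ^ (-(1 / 2) : ℝ) * β ^ (-(3 / 2) : ℝ) * (1 + (2 * C + C') * errorTerm β S)
        = C₁ * (S ^ (-(1 / 2) : ℝ) * β ^ (-(3 / 2) : ℝ)) *
            (1 + (2 * C + C') * errorTerm β S) := by ring
      _ = -(1 / β * (-C₁ / t ^ 48 * (1 + (2 * C + C') * errorTerm β S))) := by
          rw [hpref]
          ring
      _ ≤ _ := by linarith
  rw [herr]
  -- The threshold is `S = (βS)⁴`. Below it `log N` is at most of order `log βS`; above it the spin
  -- exceeds every power of `t` that occurs in the collision estimate.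
  rcases le_or_gt (t ^ 384) S with hcase | hcase
  · have hS1 : 1 ≤ S := (one_le_pow₀ ht1).trans hcase
    have hu1 : 1 ≤ u := by
      refine Real.one_le_rpow ?_ (by norm_num)
      have h1 : b ≤ β * S ^ 3 := by
        rw [hbS]
        exact le_mul_of_one_le_right hb0.le (one_le_pow₀ hS1)
      have := Real.log_le_log hb0 h1
      linarith
    obtain ⟨L, hL, h⟩ := hlarge β S t u N hβ hN hS (by rw [ht96]) htT hu1 hexpu hcase
    refine ⟨L, hL, h.trans ?_⟩
    have h1 : u / t ^ 8 ≤ r ^ 3 * u / t ^ 8 := by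
      gcongr
      exact le_mul_of_one_le_left hu0.le (one_le_pow₀ hr1)
    have h2 : C' * (u / t ^ 8) ≤ (2 * C + C') * (r ^ 3 * u / t ^ 8) := by
      gcongr
      linarith
    gcongr
  · have hNexp : (N : ℝ) + 1 ≤ Real.exp (5 * r ^ 6) := by
      have h1 : Real.exp (5 * r ^ 6) = b ^ 5 := by
        rw [← hexpr, ← Real.exp_nat_mul]
        norm_num
      have h2 : t ^ 384 = b ^ 4 := by rw [← ht96, ← pow_mul]
      rw [h2, hS] at hcase
      rw [h1]
      have h3 : 1 ≤ b ^ 4 := one_le_pow₀ (by linarith)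
      have h4 : b ^ 5 = b * b ^ 4 := by ring
      nlinarith
    obtain ⟨L, hL, h⟩ := hsmall β t r N hβ hN (by rw [ht96, hb, hS]; ring) ht0 hr1 hrt
      (by rw [hexpr, ht96]) hNexp
    refine ⟨L, hL, h.trans ?_⟩
    have hru : r ^ 2 ≤ 2 * u := by
      refine le_of_pow_le_pow_left₀ (by norm_num : 3 ≠ 0) (by positivity) ?_
      have h1 : (r ^ 2) ^ 3 = Real.log b := by rw [← hr6]; ring
      have h2 : (2 * u) ^ 3 = 8 * Real.log (β * S ^ 3) := by rw [mul_pow, hu3]; norm_num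
      rw [h1, h2]
      linarith
    have h1 : C * (r ^ 5 / t ^ 8) ≤ (2 * C + C') * (r ^ 3 * u / t ^ 8) := by
      calc C * (r ^ 5 / t ^ 8) = C * (r ^ 3 * r ^ 2 / t ^ 8) := by ring
        _ ≤ C * (r ^ 3 * (2 * u) / t ^ 8) := by gcongr
        _ = 2 * C * (r ^ 3 * u / t ^ 8) := by ring
        _ ≤ _ := by
          gcongr
          linarith
    gcongr

end Asymptotics

end

end Heisenberg

/-- Here `N = 2S` ranges over the positive integers, i.e. `S = N / 2 ∈ {1/2, 1, 3/2, …}`. The first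
part says that the limit defining `f(β, S)` exists. In the second part the constants `C` and `K`
are independent of both `β` and `S`. -/
theorem proposition5p1 :
    (∀ (β : ℝ) (N : ℕ), 0 < β → 1 ≤ N →
      Filter.Tendsto (fun L : ℕ => Heisenberg.finiteFreeEnergy L β N) Filter.atTop
        (nhds (Heisenberg.freeEnergy β N))) ∧
    ∃ C K : ℝ, 0 < C ∧ 0 < K ∧
      ∀ (β S : ℝ) (N : ℕ), 0 < β → 1 ≤ N → S = (N : ℝ) / 2 → K ≤ β * S →
        Heisenberg.C₁ * S ^ (-(1 / 2) : ℝ) * β ^ (-(3 / 2) : ℝ) *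
            (1 + C * Heisenberg.errorTerm β S) ≤
          Heisenberg.freeEnergy β N :=
  ⟨fun _ N hβ _ => Heisenberg.tendsto_finiteFreeEnergy N hβ, Heisenberg.exists_le_freeEnergy⟩
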